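/- **Theorem 1.4.** Let $1\le k\le n$, let $\Omega\subseteq\mathbb{R}^n$ be open and non-empty, and assume $\Omega=\mathbb{R}^n$ if $k=n$. Let $V:\Omega\to\mathrm{Gr}(k,n)$ be a distribution of $k$-planes of class $C^1$, that is, locally $V(x)=\mathrm{span}\{X_1(x),\dots,X_k(x)\}$ with vector fields $X_i$ of class $C^1$. Let $q\in[1,\infty]$ and $s,\alpha\in(0,1)$ be such that $s<\tfrac12$ and $$\alpha<1-\Big(2-\frac1q\Big)s \qquad (\text{with } 1/\infty=0).$$ Then there exist an embedded $k$-dimensional submanifold $S\subseteq\Omega$ of class $Y^{1+\alpha,q}$ and a Borel set $E$ with $\mathbb{1}_E\in W^{s,1}(S)$ such that $$E\subseteq\tau(S,V):=\{x\in S:\mathrm{Tan}(S,x)=V(x)\}\qquad\text{and}\qquad \mathscr{H}^k(E)>0.$$ Here $S$ is of class $Y^{1+\alpha,q}$ if $S$ is a closed subset of $\mathbb{R}^n$, is an embedded $k$-dimensional $C^1$ submanifold of $\mathbb{R}^n$, and is covered by relatively open subsets each of which is the graph $\{w+\varphi(w):w\in U\}$ of a $C^1$ map $\varphi:U\to P^\perp$,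 with $P\in\mathrm{Gr}(k,n)$, $U\subseteq P$ relatively open, and $D\varphi\in W^{\alpha,q}(U)$. For $p<\infty$ and a set $\Gamma$ that is either $S$ with the measure $\mu=\mathscr{H}^k$ or a relatively open subset $U$ of a $k$-plane with $\mu$ the Lebesgue measure of that plane, $v\in W^{s,p}(\Gamma)$ means that $v\in L^p(\mu\llcorner\Gamma)$ and $$\int_\Gamma\int_\Gamma\frac{|v(x)-v(y)|^p}{|x-y|^{sp+k}}\,d\mu(x)\,d\mu(y)<\infty,$$ while $W^{s,\infty}(U)=C^{s}(U)$ is the space of bounded $s$-Hölder continuous functions. -/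

import Mathlib

open Set Filter Topology MeasureTheory
open scoped ENNReal NNReal

noncomputable section

/-- `v ∈ W^{s,p}(Γ)`, where `Γ` is a `d`-dimensional subset of a metric space carrying the
`d`-dimensional measure `μ`.

For `p < ∞`: `v ∈ L^p(μ ⌞ Γ)` and the Sobolev-Slobodeckij (Gagliardo) seminorm
`∫_Γ ∫_Γ |v x - v y| ^ p / |x - y| ^ (s p + d) dμ(y) dμ(x)` is finite (the integrand is `0` on the
diagonal, since `0 / 0 = 0` in `ℝ≥0∞`).
For `p = ∞`: `W^{s,∞}` is the space of bounded `s`-Hölder continuous functions. -/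
def MemFracSobolev {X F : Type*} [PseudoEMetricSpace X] [MeasurableSpace X]
    [NormedAddCommGroup F] (d : ℕ) (s : ℝ) (p : ℝ≥0∞) (μ : Measure X) (Γ : Set X) (v : X → F) :
    Prop :=
  if p = ∞ then
    (∃ C : ℝ, ∀ x ∈ Γ, ‖v x‖ ≤ C) ∧ ∃ C : ℝ≥0, HolderOnWith C s.toNNReal v Γ
  else
    MemLp v p (μ.restrict Γ) ∧
      ∫⁻ x in Γ, ∫⁻ y in Γ,
        ‖v x - v y‖ₑ ^ p.toReal / edist x y ^ (s * p.toReal + d) ∂μ ∂μ < ∞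

/-- `V` is a distribution of `k`-planes of class `C¹` on `Ω`: `V x` is a `k`-dimensional linear
subspace for `x ∈ Ω`, and locally `V` is spanned by `k` vector fields of class `C¹`.
(Values of `V` outside `Ω` are irrelevant.) -/
structure IsC1Distribution {n : ℕ} (k : ℕ) (Ω : Set (EuclideanSpace ℝ (Fin n)))
    (V : EuclideanSpace ℝ (Fin n) → Submodule ℝ (EuclideanSpace ℝ (Fin n))) : Prop where
  finrank_eq : ∀ x ∈ Ω, Module.finrank ℝ (V x) = k
  locally_spanned : ∀ x ∈ Ω, ∃ O : Set (EuclideanSpace ℝ (Fin n)), IsOpen O ∧ x ∈ O ∧ O ⊆ Ω ∧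
    ∃ X : Fin k → EuclideanSpace ℝ (Fin n) → EuclideanSpace ℝ (Fin n),
      (∀ i, ContDiffOn ℝ 1 (X i) O) ∧
      ∀ y ∈ O, V y = Submodule.span ℝ (Set.range fun i => X i y)

/-- The graph `{w + φ w : w ∈ U}` of a map `φ : U ⊆ P → Pᗮ`. -/
def graphOver {n : ℕ} (P : Submodule ℝ (EuclideanSpace ℝ (Fin n))) (U : Set P) (φ : P → Pᗮ) :
    Set (EuclideanSpace ℝ (Fin n)) :=
  (fun w : P => (w : EuclideanSpace ℝ (Fin n)) + (φ w : EuclideanSpace ℝ (Fin n))) '' U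

/-- `φ : U ⊆ P → Pᗮ` is a graph chart of class `C¹` of `S`: `P` is a `k`-plane, `U` is relatively
open in `P`, `φ` is `C¹` on `U`, and the graph of `φ` is a relatively open subset of `S`. -/
structure IsC1GraphChart {n : ℕ} (k : ℕ) (S : Set (EuclideanSpace ℝ (Fin n)))
    (P : Submodule ℝ (EuclideanSpace ℝ (Fin n))) (U : Set P) (φ : P → Pᗮ) : Prop where
  finrank_eq : Module.finrank ℝ P = k
  isOpen : IsOpen U
  contDiffOn : ContDiffOn ℝ 1 φ U
  graph_eq : ∃ O : Set (EuclideanSpace ℝ (Fin n)), IsOpen O ∧ S ∩ O = graphOver P U φ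

/-- `S` is an embedded `k`-dimensional submanifold of class `C¹` of `ℝⁿ` (without boundary):
locally it is the graph of a `C¹` map over a `k`-plane. -/
def IsC1Submanifold {n : ℕ} (k : ℕ) (S : Set (EuclideanSpace ℝ (Fin n))) : Prop :=
  ∀ x ∈ S, ∃ (P : Submodule ℝ (EuclideanSpace ℝ (Fin n))) (U : Set P) (φ : P → Pᗮ),
    IsC1GraphChart k S P U φ ∧ x ∈ graphOver P U φ

/-- `S` is a `k`-dimensional submanifold of class `Y^{1+α,q}` of `ℝⁿ`: a closed set which is an
embedded `k`-dimensional `C¹` submanifold and has an atlas of `C¹` graph charts `φ : U ⊆ P → Pᗮ`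
with `Dφ ∈ W^{α,q}(U)`. (Each `P` carries its Lebesgue measure `volume`. The operator norm on
linear maps `P → Pᗮ` is equivalent to the Euclidean norm on `k × (n - k)` matrices.) -/
structure IsYSubmanifold {n : ℕ} (k : ℕ) (α : ℝ) (q : ℝ≥0∞)
    (S : Set (EuclideanSpace ℝ (Fin n))) : Prop where
  isClosed : IsClosed S
  isC1Submanifold : IsC1Submanifold k S
  atlas : ∀ x ∈ S, ∃ (P : Submodule ℝ (EuclideanSpace ℝ (Fin n))) (U : Set P) (φ : P → Pᗮ),
    IsC1GraphChart k S P U φ ∧ x ∈ graphOver P U φ ∧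
      MemFracSobolev k α q volume U (fderiv ℝ φ)

/-- The tangency set `τ(S,V) = {x ∈ S : Tan(S,x) = V(x)}`. For a `C¹` submanifold `S` the tangent
cone `tangentConeAt ℝ S x` (all limits of `cᵢ (xᵢ - x)` with `xᵢ ∈ S`, `xᵢ → x`, `cᵢ ∈ ℝ`) is the
classical tangent plane of `S` at `x`. -/
def tangencySet {n : ℕ} (S : Set (EuclideanSpace ℝ (Fin n)))
    (V : EuclideanSpace ℝ (Fin n) → Submodule ℝ (EuclideanSpace ℝ (Fin n))) :
    Set (EuclideanSpace ℝ (Fin n)) :=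
  {x ∈ S | tangentConeAt ℝ S x = (V x : Set (EuclideanSpace ℝ (Fin n)))}

end

/-! ### Scaling of the Gagliardo kernels -/

section Kernels

variable {X : Type*} [NormedAddCommGroup X] [NormedSpace ℝ X] [FiniteDimensional ℝ X]
  [MeasurableSpace X] [BorelSpace X] (μ : Measure X) [μ.IsAddHaarMeasure]

/-! Let `k < n`. Near a point `x₀` of `Ω` the plane `V y` is the graph over `P = V x₀` of a linear
map `F y` depending on `y` in a `C¹` way, so the graph of `φ` is tangent to `V` above `w` exactly
when `Dφ(w) = F(w + φ(w))`. In general this system has no solution on an open set, but it can be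
solved on a set of positive measure, in the spirit of Alberti's Lusin theorem for gradients.

Write the system as `Du = G(w, u)` with `G` bounded and Lipschitz, and take nested grids of mesh
`h_j ~ 2^(-j)`. Step `j` adds on each cell a linear function vanishing at the corner of the cell,
which brings the gradient to the value of `G` prescribed at that corner. As `G` is Lipschitz, the
correction has size `O(2^(-j))` (`norm_stepCorr_le`). Each correction is multiplied by a cutoff
vanishing near the walls of the grid, at distances up to order `θ^j h_j`. Off all the walls the
cutoffs equal `1` and the limit solves the system (`fderiv_approxSol_eq`). These points form a
product `K` of fat Cantor sets, which has positive measure because the relative size of the walls is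
a small multiple of `∑ θ^j`.

The exponents come from counting powers of `θ = 2^(-γ)`. The `j`-th gradient term varies at scale
`(θ/2)^j`. Its flat part (cutoff times correction) has size `2^(-j)`; its steep part (derivative of
the cutoff) has size `(2θ)^(-j)`, but lives on walls of measure `θ^j`. Summability asks for `γ < 1`,
and `W^{α,q}` regularity for `γ (1 - 1/q + α) < 1 - α`. The indicator of `K` is in `W^{s,1}` once
`dist(·, K)^(-s)` is integrable on the cube off `K`. About `2^j` walls of width `(θ/2)^j` in each
direction contribute `2^j (θ/2)^(j(1-s))`, which is summable when `γ > s/(1-s)`. A suitable `γ`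
exists precisely because `s < 1/2` and `α < 1 - (2 - 1/q) s` (`exists_thickness_ratio`). The outcome
is `exists_contDiff_fderiv_eq`.

To get a closed `S` inside `Ω`, the solution is added to the upper cap of a small round `k`-sphere
with pole `x₀`, the perturbation being supported near the pole (`isYSubmanifold_perturbedSphere`).
The set `E` is the part of the graph above `K`. The graph map is Lipschitz near `K` and does not
decrease distances, so measure and fractional regularity pass from `K` to `E`. If `k = n`, then `S =
ℝⁿ` and every point is a tangency point. -/

theorem lintegral_inv_smul (f : X → ℝ≥0∞) {g : ℝ} (hg : 0 < g) :
    ∫⁻ z, f (g⁻¹ • z) ∂μ = ENNReal.ofReal (g ^ Module.finrank ℝ X) * ∫⁻ z, f z ∂μ := by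
  have hg' : g⁻¹ ≠ 0 := (inv_pos.2 hg).ne'
  have h := (Homeomorph.smulOfNeZero (α := X) g⁻¹ hg').measurableEmbedding.lintegral_map
    (μ := μ) f
  have h2 := μ.map_addHaar_smul hg'
  change ∫⁻ z, f z ∂(Measure.map (fun z => g⁻¹ • z) μ) = ∫⁻ z, f (g⁻¹ • z) ∂μ at h
  rw [← h, h2, lintegral_smul_measure, smul_eq_mul, inv_pow, inv_inv, abs_of_pos (by positivity)]

/-- The integral of the truncated kernel `max ‖z‖ r ^ (-(s + d))` is of order `r ^ (-s)`. -/
theorem exists_lintegral_max_rpow_le {s : ℝ} (hs : 0 < s) :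
    ∃ C : ℝ≥0∞, C < ∞ ∧ ∀ r : ℝ, 0 < r →
      ∫⁻ z, ENNReal.ofReal ((max ‖z‖ r) ^ (-(s + Module.finrank ℝ X))) ∂μ
        ≤ C * ENNReal.ofReal (r ^ (-s)) := by
  set d := Module.finrank ℝ X with hd
  refine ⟨∫⁻ z, ENNReal.ofReal ((max ‖z‖ 1) ^ (-(s + d))) ∂μ, ?_, ?_⟩
  · have hfin := finite_integral_one_add_norm (E := X) (μ := μ) (r := s + d) (by linarith)
    calc _ ≤ ∫⁻ z, ENNReal.ofReal (2 ^ (s + d)) * ENNReal.ofReal ((1 + ‖z‖) ^ (-(s + d))) ∂μ := by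
          refine lintegral_mono fun z => ?_
          rw [← ENNReal.ofReal_mul (by positivity)]
          refine ENNReal.ofReal_le_ofReal ?_
          have h1 : (1 + ‖z‖) / 2 ≤ max ‖z‖ 1 := by
            rcases le_total ‖z‖ 1 with h | h <;> simp [h] <;> linarith
          calc (max ‖z‖ 1) ^ (-(s + d)) ≤ ((1 + ‖z‖) / 2) ^ (-(s + d)) := by
                apply Real.rpow_le_rpow_of_nonpos (by positivity) h1
                have : (0 : ℝ) ≤ d := Nat.cast_nonneg _
                linarith
            _ = _ := by
                rw [Real.div_rpow (by positivity) (by positivity), Real.rpow_neg (by norm_num : (0:ℝ) ≤ 2)]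
                field_simp
      _ < ∞ := by
          rw [lintegral_const_mul' _ _ ENNReal.ofReal_ne_top]
          exact ENNReal.mul_lt_top ENNReal.ofReal_lt_top hfin
  · intro r hr
    -- Homogeneity reduces the claim to `r = 1`: the Jacobian `r ^ d` turns `r ^ (-(s + d))` into `r
    -- ^ (-s)`.
    have key : ∀ z : X, ENNReal.ofReal ((max ‖z‖ r) ^ (-(s + d))) =
        ENNReal.ofReal (r ^ (-(s + d))) *
          ENNReal.ofReal ((max ‖r⁻¹ • z‖ 1) ^ (-(s + d))) := by
      intro z
      rw [← ENNReal.ofReal_mul (by positivity), ← Real.mul_rpow hr.le (by positivity),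
        mul_max_of_nonneg _ _ hr.le, norm_smul, norm_inv, Real.norm_of_nonneg hr.le,
        mul_inv_cancel_left₀ hr.ne', mul_one]
    simp_rw [key]
    rw [lintegral_const_mul' _ _ ENNReal.ofReal_ne_top,
      lintegral_inv_smul μ (fun z => ENNReal.ofReal ((max ‖z‖ 1) ^ (-(s + d)))) hr, ← hd,
      ← mul_assoc, ← ENNReal.ofReal_mul (by positivity), mul_comm]
    gcongr
    rw [← Real.rpow_natCast, ← Real.rpow_add hr]
    ring_nf
    exact le_rfl

/-- The Gagliardo kernel integrated against the modulus of continuity `min 2 (‖z‖ / g)`. -/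
theorem exists_lintegral_min_rpow_le (hX : 1 ≤ Module.finrank ℝ X) {α q : ℝ} (hα0 : 0 < α)
    (hα1 : α < 1) (hq : 1 ≤ q) :
    ∃ C : ℝ≥0∞, C < ∞ ∧ ∀ g : ℝ, 0 < g →
      ∫⁻ z, ENNReal.ofReal ((min 2 (‖z‖ / g)) ^ q * ‖z‖ ^ (-(α * q + Module.finrank ℝ X))) ∂μ
        ≤ C * ENNReal.ofReal (g ^ (-(α * q))) := by
  set d := Module.finrank ℝ X with hd
  have hdnn : (0 : ℝ) ≤ d := Nat.cast_nonneg _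
  have hαq : 0 < α * q := by positivity
  refine ⟨∫⁻ z, ENNReal.ofReal ((min 2 ‖z‖) ^ q * ‖z‖ ^ (-(α * q + d))) ∂μ, ?_, ?_⟩
  · have hmeas : Measurable fun z : X => (min 2 ‖z‖) ^ q * ‖z‖ ^ (-(α * q + d)) := by fun_prop
    -- Near `0` the integrand is `‖z‖ ^ (q - αq - d)`, integrable because `α < 1`; far away the
    -- minimum is at most `2` and `αq > 0` suffices.
    rw [← lintegral_add_compl _ (measurableSet_ball (x := (0 : X)) (ε := 1))]
    refine ENNReal.add_lt_top.2 ⟨?_, ?_⟩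
    · have hint : IntegrableOn (fun z : X => (min 2 ‖z‖) ^ q * ‖z‖ ^ (-(α * q + d)))
          (Metric.ball 0 1) μ := by
        refine integrableOn_ball_of_norm_le_rpow (C := 1) (α := α * q + d - q) hX ?_ ?_
          hmeas.aestronglyMeasurable
        · nlinarith
        · rw [ae_restrict_iff' measurableSet_ball]
          have h0 : ∀ᵐ z ∂μ, z ≠ 0 := by
            have : Nontrivial X := Module.nontrivial_of_finrank_pos (R := ℝ) (by omega)
            simp [ae_iff]
          filter_upwards [h0] with z hz hz1
          rw [mem_ball_zero_iff] at hz1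
          have hzp : 0 < ‖z‖ := norm_pos_iff.2 hz
          rw [Real.norm_of_nonneg (by positivity), min_eq_right (by linarith),
            ← Real.rpow_add hzp, one_mul]
          apply le_of_eq; congr 1; ring
      exact (hasFiniteIntegral_iff_ofReal (by filter_upwards with z; positivity)).1
        hint.hasFiniteIntegral
    · have hfin := finite_integral_one_add_norm (E := X) (μ := μ) (r := α * q + d) (by linarith)
      calc _ ≤ ∫⁻ z in (Metric.ball 0 1)ᶜ, ENNReal.ofReal (2 ^ q * 2 ^ (α * q + d)) *
              ENNReal.ofReal ((1 + ‖z‖) ^ (-(α * q + d))) ∂μ := by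
            refine setLIntegral_mono' measurableSet_ball.compl fun z hz => ?_
            have hz1 : 1 ≤ ‖z‖ := by simpa using hz
            rw [← ENNReal.ofReal_mul (by positivity), mul_assoc]
            refine ENNReal.ofReal_le_ofReal ?_
            gcongr
            · exact min_le_left _ _
            · calc ‖z‖ ^ (-(α * q + d)) ≤ ((1 + ‖z‖) / 2) ^ (-(α * q + d)) := by
                    apply Real.rpow_le_rpow_of_nonpos (by positivity) (by linarith)
                    linarith
                _ = _ := by
                    rw [Real.div_rpow (by positivity) (by positivity),
                      Real.rpow_neg (by norm_num : (0:ℝ) ≤ 2)]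
                    field_simp
        _ ≤ _ := setLIntegral_le_lintegral _ _
        _ < ∞ := by
            rw [lintegral_const_mul' _ _ ENNReal.ofReal_ne_top]
            exact ENNReal.mul_lt_top ENNReal.ofReal_lt_top hfin
  · intro g hg
    have key : ∀ z : X, ENNReal.ofReal ((min 2 (‖z‖ / g)) ^ q * ‖z‖ ^ (-(α * q + d))) =
        ENNReal.ofReal (g ^ (-(α * q + d))) *
          ENNReal.ofReal ((min 2 ‖g⁻¹ • z‖) ^ q * ‖g⁻¹ • z‖ ^ (-(α * q + d))) := by
      intro z
      rw [← ENNReal.ofReal_mul (by positivity), norm_smul, norm_inv, Real.norm_of_nonneg hg.le,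
        mul_left_comm, ← Real.mul_rpow hg.le (by positivity), mul_inv_cancel_left₀ hg.ne',
        div_eq_inv_mul]
    simp_rw [key]
    rw [lintegral_const_mul' _ _ ENNReal.ofReal_ne_top,
      lintegral_inv_smul μ
        (fun z => ENNReal.ofReal ((min 2 ‖z‖) ^ q * ‖z‖ ^ (-(α * q + d)))) hg, ← hd,
      ← mul_assoc, ← ENNReal.ofReal_mul (by positivity), mul_comm]
    gcongr
    rw [← Real.rpow_natCast, ← Real.rpow_add hg]
    ring_nf
    exact le_rfl

end Kernels

/-- Each `b j` is at most `r ^ j` times the `q`-th root of the weighted sum. This pointwise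
inequality stands in for Minkowski's in the seminorm of a series: the terms decay geometrically and
can afford the weights. -/
theorem ENNReal.tsum_rpow_le_weighted {q : ℝ} (hq : 0 < q) (b : ℕ → ℝ≥0∞) {r : ℝ≥0} (hr : r ≠ 0) :
    (∑' j, b j) ^ q ≤ (∑' j, (r : ℝ≥0∞) ^ j) ^ q * ∑' j, (((r : ℝ≥0∞) ^ j)⁻¹ * b j) ^ q := by
  set S := ∑' j, (((r : ℝ≥0∞) ^ j)⁻¹ * b j) ^ q with hS
  have hb : ∀ j, b j ≤ (r : ℝ≥0∞) ^ j * S ^ (1 / q) := by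
    intro j
    have h1 : (((r : ℝ≥0∞) ^ j)⁻¹ * b j) ^ q ≤ S :=
      ENNReal.le_tsum (f := fun j => (((r : ℝ≥0∞) ^ j)⁻¹ * b j) ^ q) j
    have h2 : ((r : ℝ≥0∞) ^ j)⁻¹ * b j ≤ S ^ (1 / q) := by
      rw [one_div]; exact (ENNReal.le_rpow_inv_iff hq).2 h1
    have h0 : (r : ℝ≥0∞) ^ j ≠ 0 := pow_ne_zero _ (by simpa using hr)
    have ht : (r : ℝ≥0∞) ^ j ≠ ∞ := ENNReal.pow_ne_top ENNReal.coe_ne_top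
    calc b j = (r : ℝ≥0∞) ^ j * (((r : ℝ≥0∞) ^ j)⁻¹ * b j) := by
          rw [← mul_assoc, ENNReal.mul_inv_cancel h0 ht, one_mul]
      _ ≤ _ := by gcongr
  calc (∑' j, b j) ^ q ≤ (∑' j, (r : ℝ≥0∞) ^ j * S ^ (1 / q)) ^ q := by
        gcongr with j; exact hb j
    _ = _ := by
        rw [ENNReal.tsum_mul_right, ENNReal.mul_rpow_of_nonneg _ _ hq.le, ← ENNReal.rpow_mul,
          one_div, inv_mul_cancel₀ hq.ne', ENNReal.rpow_one]

/-! ### Elementary properties of fractional Sobolev classes -/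

section Basic

variable {X F : Type*} [NormedAddCommGroup F]

theorem MemFracSobolev.mono [PseudoEMetricSpace X] [MeasurableSpace X] {d : ℕ} {s : ℝ} {p : ℝ≥0∞}
    {μ : Measure X} {Γ Γ' : Set X} {v : X → F} (h : MemFracSobolev d s p μ Γ v) (hΓ : Γ' ⊆ Γ) :
    MemFracSobolev d s p μ Γ' v := by
  unfold MemFracSobolev at h ⊢
  split_ifs at h ⊢ with hp
  · obtain ⟨⟨C, hC⟩, D, hD⟩ := h
    exact ⟨⟨C, fun x hx => hC x (hΓ hx)⟩, D, hD.mono hΓ⟩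
  · refine ⟨h.1.mono_measure (Measure.restrict_mono hΓ le_rfl), lt_of_le_of_lt ?_ h.2⟩
    refine (lintegral_mono_set hΓ).trans ?_
    exact lintegral_mono fun x => lintegral_mono_set hΓ

theorem MemFracSobolev.congr [PseudoEMetricSpace X] [MeasurableSpace X] {d : ℕ} {s : ℝ} {p : ℝ≥0∞}
    {μ : Measure X} {Γ : Set X} {v w : X → F} (h : MemFracSobolev d s p μ Γ v)
    (hΓ : MeasurableSet Γ) (hvw : EqOn v w Γ) :
    MemFracSobolev d s p μ Γ w := by
  unfold MemFracSobolev at h ⊢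
  split_ifs at h ⊢ with hp
  · obtain ⟨⟨C, hC⟩, D, hD⟩ := h
    refine ⟨⟨C, fun x hx => by rw [← hvw hx]; exact hC x hx⟩, D, fun x hx y hy => ?_⟩
    rw [← hvw hx, ← hvw hy]; exact hD x hx y hy
  · refine ⟨h.1.ae_eq ((ae_restrict_iff' hΓ).2 (Eventually.of_forall hvw)), ?_⟩
    refine lt_of_le_of_lt (le_of_eq ?_) h.2
    refine setLIntegral_congr_fun hΓ fun x hx => ?_
    refine setLIntegral_congr_fun hΓ fun y hy => ?_
    simp only [hvw hx, hvw hy]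

/-- Splitting the double integral of a sum only needs one measurable summand; continuity of `w`
provides it. -/
theorem MemFracSobolev.add [MetricSpace X] [MeasurableSpace X] [BorelSpace X]
    [SecondCountableTopology X] {d : ℕ} {s : ℝ} {p : ℝ≥0∞} (hp1 : 1 ≤ p)
    {μ : Measure X} [SFinite μ] {Γ : Set X} {v w : X → F}
    (hv : MemFracSobolev d s p μ Γ v) (hw : MemFracSobolev d s p μ Γ w) (hwc : Continuous w) :
    MemFracSobolev d s p μ Γ (v + w) := by
  unfold MemFracSobolev at hv hw ⊢
  split_ifs at hv hw ⊢ with hp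
  · obtain ⟨⟨C, hC⟩, D, hD⟩ := hv
    obtain ⟨⟨C', hC'⟩, D', hD'⟩ := hw
    refine ⟨⟨C + C', fun x hx => (norm_add_le _ _).trans (add_le_add (hC x hx) (hC' x hx))⟩,
      D + D', fun x hx y hy => ?_⟩
    have h1 : edist ((v + w) x) ((v + w) y) ≤ edist (v x) (v y) + edist (w x) (w y) :=
      edist_add_add_le _ _ _ _
    refine h1.trans ?_
    rw [ENNReal.coe_add, add_mul]
    exact add_le_add (hD x hx y hy) (hD' x hx y hy)
  · refine ⟨hv.1.add hw.1, ?_⟩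
    have hpr : 1 ≤ p.toReal := by
      rw [← ENNReal.toReal_one]; exact ENNReal.toReal_mono hp hp1
    set q := p.toReal
    have hm : Measurable fun z : X × X =>
        ‖w z.1 - w z.2‖ₑ ^ q / edist z.1 z.2 ^ (s * q + d) := by
      have : Continuous fun z : X × X => ‖w z.1 - w z.2‖ₑ := by fun_prop
      have h2 : Measurable fun z : X × X => edist z.1 z.2 := measurable_edist
      exact (this.measurable.pow_const q).div (h2.pow_const _)
    have hbound : ∀ x y : X, ‖(v + w) x - (v + w) y‖ₑ ^ q / edist x y ^ (s * q + d) ≤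
        2 ^ (q - 1) * (‖v x - v y‖ₑ ^ q / edist x y ^ (s * q + d) +
          ‖w x - w y‖ₑ ^ q / edist x y ^ (s * q + d)) := by
      intro x y
      rw [← ENNReal.add_div, ← mul_div_assoc]
      gcongr
      refine le_trans ?_ (ENNReal.rpow_add_le_mul_rpow_add_rpow _ _ hpr)
      gcongr
      have : (v + w) x - (v + w) y = (v x - v y) + (w x - w y) := by
        simp only [Pi.add_apply]; abel
      rw [this]
      exact enorm_add_le _ _
    have h2t : (2 : ℝ≥0∞) ^ (q - 1) ≠ ∞ := ENNReal.rpow_ne_top_of_nonneg (by linarith) (by simp)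
    calc _ ≤ ∫⁻ x in Γ, ∫⁻ y in Γ, 2 ^ (q - 1) * (‖v x - v y‖ₑ ^ q / edist x y ^ (s * q + d) +
          ‖w x - w y‖ₑ ^ q / edist x y ^ (s * q + d)) ∂μ ∂μ :=
          lintegral_mono fun x => lintegral_mono fun y => hbound x y
      _ = 2 ^ (q - 1) * ((∫⁻ x in Γ, ∫⁻ y in Γ, ‖v x - v y‖ₑ ^ q / edist x y ^ (s * q + d) ∂μ ∂μ) +
          ∫⁻ x in Γ, ∫⁻ y in Γ, ‖w x - w y‖ₑ ^ q / edist x y ^ (s * q + d) ∂μ ∂μ) := by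
          simp_rw [lintegral_const_mul' _ _ h2t]
          congr 1
          rw [← lintegral_add_right _ hm.lintegral_prod_right']
          congr 1
          ext x
          exact lintegral_add_right _ (hm.comp measurable_prodMk_left)
      _ < ∞ := ENNReal.mul_lt_top h2t.lt_top (ENNReal.add_lt_top.2 ⟨hv.2, hw.2⟩)

end Basic

/-- The modulus `M * min 2 (t / g)` describes oscillation of amplitude `M` at scale `g`. All later
estimates have this form, so that a single scaled kernel, that of `exists_lintegral_min_rpow_le`,
controls them. -/
theorem rpow_enorm_div_edist_le {X F : Type*} [NormedAddCommGroup X] [NormedAddCommGroup F]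
    {v : X → F} {M g q β : ℝ} (hM : 0 ≤ M) (hg : 0 < g) (hq : 0 < q) {x y : X}
    (h : ‖v x - v y‖ ≤ M * min 2 (‖x - y‖ / g)) :
    ‖v x - v y‖ₑ ^ q / edist x y ^ β ≤
      ENNReal.ofReal (M ^ q) * ENNReal.ofReal ((min 2 (‖x - y‖ / g)) ^ q * ‖x - y‖ ^ (-β)) := by
  rcases eq_or_ne x y with rfl | hxy
  · simp [hq]
  have hpos : 0 < ‖x - y‖ := norm_pos_iff.2 (sub_ne_zero.2 hxy)
  rw [edist_dist, dist_eq_norm, ENNReal.ofReal_rpow_of_pos hpos, ← ofReal_norm,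
    ENNReal.ofReal_rpow_of_nonneg (norm_nonneg _) hq.le,
    ← ENNReal.ofReal_div_of_pos (by positivity), ← ENNReal.ofReal_mul (by positivity)]
  refine ENNReal.ofReal_le_ofReal ?_
  rw [← mul_assoc, Real.rpow_neg hpos.le, ← div_eq_mul_inv,
    ← Real.mul_rpow hM (by positivity)]
  gcongr

/-! ### Lipschitz functions -/

section Lebesgue

variable {X F : Type*} [NormedAddCommGroup X] [NormedSpace ℝ X] [FiniteDimensional ℝ X]
  [MeasurableSpace X] [BorelSpace X] [NormedAddCommGroup F]

/-- A bounded Lipschitz function on a set of finite measure is in every `W^{α,p}`. -/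
theorem memFracSobolev_of_lipschitzOnWith (μ : Measure X) [μ.IsAddHaarMeasure]
    (hX : 1 ≤ Module.finrank ℝ X) {α : ℝ} (hα0 : 0 < α) (hα1 : α < 1) {p : ℝ≥0∞} (hp1 : 1 ≤ p)
    {U : Set X} (hU : MeasurableSet U) (hμU : μ U ≠ ∞) {v : X → F} {M : ℝ} {L : ℝ≥0}
    (hM : ∀ x ∈ U, ‖v x‖ ≤ M) (hL : LipschitzOnWith L v U)
    (hvm : AEStronglyMeasurable v (μ.restrict U)) :
    MemFracSobolev (Module.finrank ℝ X) α p μ U v := by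
  -- Amplitude over scale is `L + 1`, which dominates the Lipschitz constant; the added ones keep
  -- both amplitude and scale positive.
  have hmin : ∀ x ∈ U, ∀ y ∈ U,
      ‖v x - v y‖ ≤ (|M| + 1) * min 2 (‖x - y‖ / ((|M| + 1) / (L + 1))) := by
    intro x hx y hy
    have hMp : 0 < |M| + 1 := by positivity
    rw [mul_min_of_nonneg _ _ hMp.le]
    refine le_min ?_ ?_
    · refine (norm_sub_le _ _).trans ?_
      have := le_abs_self M
      linarith [hM x hx, hM y hy]
    · have h1 : ‖v x - v y‖ ≤ L * ‖x - y‖ := by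
        simpa [dist_eq_norm] using hL.dist_le_mul x hx y hy
      have h2 : (|M| + 1) * (‖x - y‖ / ((|M| + 1) / (L + 1))) = (L + 1) * ‖x - y‖ := by
        field_simp
      rw [h2]
      nlinarith [norm_nonneg (x - y)]
  set M' := |M| + 1 with hM'
  have hM'0 : 0 < M' := by positivity
  set g := M' / (L + 1) with hg
  have hg0 : 0 < g := by positivity
  unfold MemFracSobolev
  split_ifs with hp
  · refine ⟨⟨M, hM⟩, (2 * M' * g ^ (-α)).toNNReal, fun x hx y hy => ?_⟩
    rw [edist_dist, edist_dist, dist_eq_norm, dist_eq_norm, Real.coe_toNNReal _ hα0.le,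
      ENNReal.ofReal_rpow_of_nonneg (norm_nonneg _) hα0.le, ← ENNReal.ofReal_coe_nnreal,
      Real.coe_toNNReal _ (by positivity), ← ENNReal.ofReal_mul (by positivity)]
    refine ENNReal.ofReal_le_ofReal ((hmin x hx y hy).trans ?_)
    -- The interpolation `min 2 t ≤ 2 t ^ α` turns the modulus into a Hölder bound.
    have h3 : min 2 (‖x - y‖ / g) ≤ 2 * (‖x - y‖ / g) ^ α := by
      rcases le_total (‖x - y‖ / g) 1 with h | h
      · refine (min_le_right _ _).trans ?_
        have := Real.rpow_le_rpow_of_exponent_ge_of_imp (x := ‖x - y‖ / g) (y := 1) (z := α)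
          (by positivity) h hα1.le (by intro _ h; exact absurd h one_ne_zero)
        rw [Real.rpow_one] at this
        have h0 : 0 ≤ (‖x - y‖ / g) ^ α := by positivity
        linarith
      · refine (min_le_left _ _).trans ?_
        have := Real.one_le_rpow h hα0.le
        linarith
    calc _ ≤ M' * (2 * (‖x - y‖ / g) ^ α) := by gcongr
      _ = _ := by
        rw [Real.div_rpow (norm_nonneg _) hg0.le, Real.rpow_neg hg0.le]; field_simp
  · have hq : 1 ≤ p.toReal := by
      rw [← ENNReal.toReal_one]; exact ENNReal.toReal_mono hp hp1
    set q := p.toReal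
    have hfin : IsFiniteMeasure (μ.restrict U) := ⟨by simpa using hμU.lt_top⟩
    refine ⟨?_, ?_⟩
    · exact MemLp.of_bound hvm M ((ae_restrict_iff' hU).2 (Eventually.of_forall hM))
    obtain ⟨C, hC, hCg⟩ := exists_lintegral_min_rpow_le μ hX hα0 hα1 hq
    calc _ ≤ ∫⁻ x in U, ∫⁻ y in U, ENNReal.ofReal (M' ^ q) *
          ENNReal.ofReal ((min 2 (‖x - y‖ / g)) ^ q *
            ‖x - y‖ ^ (-(α * q + Module.finrank ℝ X))) ∂μ ∂μ := by
          refine setLIntegral_mono' hU fun x hx => setLIntegral_mono' hU fun y hy => ?_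
          exact rpow_enorm_div_edist_le hM'0.le hg0 (by linarith) (hmin x hx y hy)
      _ ≤ ∫⁻ x in U, ENNReal.ofReal (M' ^ q) * (C * ENNReal.ofReal (g ^ (-(α * q)))) ∂μ := by
          refine lintegral_mono fun x => ?_
          rw [lintegral_const_mul' _ _ ENNReal.ofReal_ne_top]
          gcongr
          refine le_trans (setLIntegral_le_lintegral _ _) (le_trans (le_of_eq ?_) (hCg g hg0))
          exact lintegral_sub_left_eq_self (fun z => ENNReal.ofReal ((min 2 (‖z‖ / g)) ^ q *
            ‖z‖ ^ (-(α * q + Module.finrank ℝ X)))) x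
      _ < ∞ := by
          rw [lintegral_const]
          refine ENNReal.mul_lt_top (ENNReal.mul_lt_top ENNReal.ofReal_lt_top
            (ENNReal.mul_lt_top hC ENNReal.ofReal_lt_top)) (by simpa using hμU.lt_top)

end Lebesgue

/-! ### Seminorms of series with geometric decay -/

section Series

variable {X F : Type*} [NormedAddCommGroup X] [NormedSpace ℝ X] [FiniteDimensional ℝ X]
  [MeasurableSpace X] [BorelSpace X] [NormedAddCommGroup F]

/-- A function supported in `A` takes different values at two points only if one of them lies in
`A`; the weight here majorizes that condition. Both halves agree by translation invariance and
evenness of `K`. -/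
theorem lintegral_indicator_add_mul_sub_le (μ : Measure X) [μ.IsAddHaarMeasure] {A : Set X}
    (hA : MeasurableSet A) {K : X → ℝ≥0∞} (hK : Measurable K) (hKneg : ∀ z, K (-z) = K z) :
    ∫⁻ x, ∫⁻ y, (A.indicator 1 x + A.indicator 1 y) * K (x - y) ∂μ ∂μ = 2 * μ A * ∫⁻ z, K z ∂μ := by
  have h1 : Measurable (A.indicator (1 : X → ℝ≥0∞)) := measurable_one.indicator hA
  have hKd : Measurable fun z : X × X => K (z.1 - z.2) := hK.comp (measurable_fst.sub measurable_snd)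
  have ha : ∫⁻ x, ∫⁻ y, A.indicator 1 x * K (x - y) ∂μ ∂μ = μ A * ∫⁻ z, K z ∂μ := by
    have : ∀ x, ∫⁻ y, A.indicator 1 x * K (x - y) ∂μ = A.indicator 1 x * ∫⁻ z, K z ∂μ := by
      intro x
      rw [lintegral_const_mul (f := fun y => K (x - y)) _ (hKd.comp measurable_prodMk_left),
        lintegral_sub_left_eq_self K x]
    simp_rw [this]
    rw [lintegral_mul_const _ h1, lintegral_indicator_one hA]
  have hb : ∫⁻ x, ∫⁻ y, A.indicator 1 y * K (x - y) ∂μ ∂μ = μ A * ∫⁻ z, K z ∂μ := by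
    rw [lintegral_lintegral_swap, ← ha]
    · refine lintegral_congr fun y => lintegral_congr fun x => ?_
      rw [← hKneg, neg_sub]
    · exact ((h1.comp measurable_snd).mul hKd).aemeasurable
  simp_rw [add_mul]
  have hm : Measurable fun z : X × X => A.indicator 1 z.2 * K (z.1 - z.2) :=
    (h1.comp measurable_snd).mul hKd
  calc _ = ∫⁻ x, (∫⁻ y, A.indicator 1 x * K (x - y) ∂μ + ∫⁻ y, A.indicator 1 y * K (x - y) ∂μ) ∂μ :=
        lintegral_congr fun x => lintegral_add_right _ (hm.comp measurable_prodMk_left)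
    _ = _ := by
        rw [lintegral_add_right _ hm.lintegral_prod_right', ha, hb]; ring

/-- A series of functions with moduli of continuity `M j * min 2 (· / g j)`, the `j`-th one
supported in `A j`, has finite Gagliardo seminorm when `M j ^ q * g j ^ (-αq) * μ (A j)` decays
geometrically. -/
theorem gagliardo_lt_top_of_hasSum (μ : Measure X) [μ.IsAddHaarMeasure]
    (hX : 1 ≤ Module.finrank ℝ X) {α : ℝ} (hα0 : 0 < α) (hα1 : α < 1) {q : ℝ} (hq : 1 ≤ q)
    {f : ℕ → X → F} {v : X → F} (hsum : ∀ x, HasSum (fun j => f j x) (v x))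
    {M g : ℕ → ℝ} {A : ℕ → Set X} (hM : ∀ j, 0 ≤ M j)
    (hg : ∀ j, 0 < g j) (hA : ∀ j, MeasurableSet (A j)) (hfA : ∀ j, ∀ x ∉ A j, f j x = 0)
    (hf : ∀ j x y, ‖f j x - f j y‖ ≤ M j * min 2 (‖x - y‖ / g j))
    {C ρ : ℝ} (hρ0 : 0 < ρ) (hρ1 : ρ < 1)
    (hdecay : ∀ j, ENNReal.ofReal (M j ^ q * g j ^ (-(α * q))) * μ (A j) ≤
      ENNReal.ofReal (C * ρ ^ j)) :
    ∫⁻ x, ∫⁻ y, ‖v x - v y‖ₑ ^ q / edist x y ^ (α * q + Module.finrank ℝ X) ∂μ ∂μ < ∞ := by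
  set d := Module.finrank ℝ X with hd
  have hq0 : 0 < q := by linarith
  obtain ⟨B, hB, hBg⟩ := exists_lintegral_min_rpow_le μ hX hα0 hα1 hq
  rw [← hd] at hBg
  -- With this weight `(r ^ j)⁻¹ ^ q = ρ ^ (-j / 2)`: the weighted inequality spends half of the
  -- geometric decay and the other half makes the series converge.
  let r : ℝ≥0 := (ρ ^ (1 / (2 * q))).toNNReal
  have hrr : (r : ℝ) = ρ ^ (1 / (2 * q)) := Real.coe_toNNReal _ (by positivity)
  have hr0 : r ≠ 0 := by
    have : (0 : ℝ) < r := by rw [hrr]; positivity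
    exact_mod_cast this.ne'
  have hr1 : r < 1 := by
    have : (r : ℝ) < 1 := by rw [hrr]; exact Real.rpow_lt_one hρ0.le hρ1 (by positivity)
    exact_mod_cast this
  let R : ℝ≥0∞ := (∑' j, (r : ℝ≥0∞) ^ j) ^ q
  have hR : R ≠ ∞ := by
    refine ENNReal.rpow_ne_top_of_nonneg hq0.le ?_
    rw [ENNReal.tsum_geometric]
    refine ENNReal.inv_ne_top.2 ?_
    exact (tsub_pos_of_lt (by exact_mod_cast hr1)).ne'
  let W : ℕ → ℝ≥0∞ := fun j => (((r : ℝ≥0∞) ^ j)⁻¹) ^ q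
  have hW : ∀ j, W j = ENNReal.ofReal (ρ ^ (-(j / 2 : ℝ))) := by
    intro j
    have hr0' : (0 : ℝ) < r := by rw [hrr]; positivity
    have : ((r : ℝ≥0∞) ^ j)⁻¹ = ENNReal.ofReal (((r : ℝ) ^ j)⁻¹) := by
      rw [ENNReal.ofReal_inv_of_pos (by positivity), ENNReal.ofReal_pow hr0'.le,
        ENNReal.ofReal_coe_nnreal]
    simp only [W]
    rw [this, ENNReal.ofReal_rpow_of_pos (by positivity), hrr]
    congr 1
    rw [← Real.rpow_natCast, ← Real.rpow_mul hρ0.le, ← Real.rpow_neg hρ0.le, ← Real.rpow_mul hρ0.le]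
    congr 1
    field_simp
  let K : ℕ → X → ℝ≥0∞ := fun j z =>
    ENNReal.ofReal ((min 2 (‖z‖ / g j)) ^ q * ‖z‖ ^ (-(α * q + d)))
  have hKm : ∀ j, Measurable (K j) := fun j => by
    refine Measurable.ennreal_ofReal ?_
    fun_prop
  have hpt : ∀ x y, ‖v x - v y‖ₑ ^ q / edist x y ^ (α * q + d) ≤
      R * ∑' j, W j * (ENNReal.ofReal (M j ^ q) *
        (((A j).indicator 1 x + (A j).indicator 1 y) * K j (x - y))) := by
    intro x y
    have h1 : ‖v x - v y‖ₑ ≤ ∑' j, ‖f j x - f j y‖ₑ := by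
      rw [← ((hsum x).sub (hsum y)).tsum_eq]
      exact enorm_tsum_le_tsum_enorm
    have h2 : ‖v x - v y‖ₑ ^ q ≤ R * ∑' j, W j * ‖f j x - f j y‖ₑ ^ q := by
      refine (ENNReal.rpow_le_rpow h1 hq0.le).trans ?_
      refine (ENNReal.tsum_rpow_le_weighted hq0 _ hr0).trans (le_of_eq ?_)
      simp_rw [ENNReal.mul_rpow_of_nonneg _ _ hq0.le]
      rfl
    calc _ ≤ (R * ∑' j, W j * ‖f j x - f j y‖ₑ ^ q) / edist x y ^ (α * q + d) := by gcongr
      _ = R * ∑' j, W j * (‖f j x - f j y‖ₑ ^ q / edist x y ^ (α * q + d)) := by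
          simp_rw [div_eq_mul_inv]
          rw [mul_assoc, ← ENNReal.tsum_mul_right]
          simp_rw [mul_assoc]
      _ ≤ _ := by
          gcongr with j
          by_cases hx : x ∈ A j
          · refine (rpow_enorm_div_edist_le (hM j) (hg j) hq0 (hf j x y)).trans ?_
            gcongr
            simp only [indicator_of_mem hx, Pi.one_apply]
            rw [add_mul, one_mul]
            exact le_self_add
          · by_cases hy : y ∈ A j
            · refine (rpow_enorm_div_edist_le (hM j) (hg j) hq0 (hf j x y)).trans ?_
              gcongr
              simp only [indicator_of_mem hy, indicator_of_notMem hx, Pi.one_apply]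
              rw [zero_add, one_mul]
            · rw [hfA j x hx, hfA j y hy]
              simp [hq0]
  have hm : ∀ j, Measurable fun z : X × X => W j * (ENNReal.ofReal (M j ^ q) *
        (((A j).indicator 1 z.1 + (A j).indicator 1 z.2) * K j (z.1 - z.2))) := by
    intro j
    have h1 : Measurable ((A j).indicator (1 : X → ℝ≥0∞)) := measurable_one.indicator (hA j)
    refine Measurable.const_mul (Measurable.const_mul (Measurable.mul ?_ ?_) _) _
    · exact (h1.comp measurable_fst).add (h1.comp measurable_snd)
    · exact (hKm j).comp (measurable_fst.sub measurable_snd)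
  have hWt : ∀ j, W j ≠ ∞ := fun j => by rw [hW]; exact ENNReal.ofReal_ne_top
  calc _ ≤ ∫⁻ x, ∫⁻ y, R * ∑' j, W j * (ENNReal.ofReal (M j ^ q) *
        (((A j).indicator 1 x + (A j).indicator 1 y) * K j (x - y))) ∂μ ∂μ :=
        lintegral_mono fun x => lintegral_mono fun y => hpt x y
    _ = R * ∑' j, W j * (ENNReal.ofReal (M j ^ q) *
        ∫⁻ x, ∫⁻ y, ((A j).indicator 1 x + (A j).indicator 1 y) * K j (x - y) ∂μ ∂μ) := by
        simp_rw [lintegral_const_mul' _ _ hR]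
        congr 1
        have hin : ∀ x, ∫⁻ y, ∑' j, W j * (ENNReal.ofReal (M j ^ q) *
            (((A j).indicator 1 x + (A j).indicator 1 y) * K j (x - y))) ∂μ =
            ∑' j, ∫⁻ y, W j * (ENNReal.ofReal (M j ^ q) *
            (((A j).indicator 1 x + (A j).indicator 1 y) * K j (x - y))) ∂μ := fun x =>
          lintegral_tsum fun j => ((hm j).comp measurable_prodMk_left).aemeasurable
        simp_rw [hin]
        rw [lintegral_tsum fun j => (hm j).lintegral_prod_right'.aemeasurable]
        refine tsum_congr fun j => ?_
        simp_rw [lintegral_const_mul' _ _ (hWt j), lintegral_const_mul' _ _ ENNReal.ofReal_ne_top]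
    _ ≤ R * ∑' j, ENNReal.ofReal (2 * C * (ρ ^ (1 / 2 : ℝ)) ^ j) * B := by
        refine mul_le_mul' le_rfl (ENNReal.tsum_le_tsum fun j => ?_)
        rw [lintegral_indicator_add_mul_sub_le μ (hA j) (hKm j)
          (fun z => by simp only [K, norm_neg]), hW]
        calc _ ≤ ENNReal.ofReal (ρ ^ (-(j / 2 : ℝ))) * (ENNReal.ofReal (M j ^ q) *
              (2 * μ (A j) * (B * ENNReal.ofReal (g j ^ (-(α * q)))))) := by
              gcongr; exact hBg _ (hg j)
          _ = ENNReal.ofReal (ρ ^ (-(j / 2 : ℝ))) * 2 * (ENNReal.ofReal (M j ^ q) *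
              ENNReal.ofReal (g j ^ (-(α * q))) * μ (A j)) * B := by ring
          _ ≤ ENNReal.ofReal (ρ ^ (-(j / 2 : ℝ))) * 2 * ENNReal.ofReal (C * ρ ^ j) * B := by
              rw [← ENNReal.ofReal_mul (Real.rpow_nonneg (hM j) _)]
              gcongr; exact hdecay j
          _ = _ := by
              rw [show (2 : ℝ≥0∞) = ENNReal.ofReal 2 by simp, ← ENNReal.ofReal_mul (by positivity),
                ← ENNReal.ofReal_mul (by positivity)]
              congr 2
              rw [← Real.rpow_natCast, ← Real.rpow_natCast, ← Real.rpow_mul hρ0.le,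
                show (1 / 2 * j : ℝ) = -(j / 2 : ℝ) + j by ring, Real.rpow_add hρ0]
              ring
    _ < ∞ := by
        rw [ENNReal.tsum_mul_right]
        refine ENNReal.mul_lt_top hR.lt_top (ENNReal.mul_lt_top ?_ hB)
        have hs : Summable fun j : ℕ => 2 * C * (ρ ^ (1 / 2 : ℝ)) ^ j :=
          (summable_geometric_of_lt_one (by positivity)
            (Real.rpow_lt_one hρ0.le hρ1 (by norm_num))).mul_left _
        exact hs.tsum_ofReal_lt_top

end Series

/-- The Hölder counterpart of `gagliardo_lt_top_of_hasSum`. -/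
theorem exists_holderWith_of_hasSum {X F : Type*} [NormedAddCommGroup X] [NormedAddCommGroup F]
    {α : ℝ} (hα0 : 0 < α) (hα1 : α < 1)
    {f : ℕ → X → F} {v : X → F} (hsum : ∀ x, HasSum (fun j => f j x) (v x))
    {M g : ℕ → ℝ} (hM : ∀ j, 0 ≤ M j) (hg : ∀ j, 0 < g j)
    (hf : ∀ j x y, ‖f j x - f j y‖ ≤ M j * min 2 (‖x - y‖ / g j))
    {C ρ : ℝ} (hρ0 : 0 < ρ) (hρ1 : ρ < 1) (hdecay : ∀ j, M j * g j ^ (-α) ≤ C * ρ ^ j) :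
    ∃ D : ℝ≥0, HolderWith D α.toNNReal v := by
  have hC : 0 ≤ C := by
    have := hdecay 0
    have h0 : 0 ≤ M 0 * g 0 ^ (-α) := mul_nonneg (hM 0) (Real.rpow_nonneg (hg 0).le _)
    simpa using h0.trans this
  have hgeo := summable_geometric_of_lt_one hρ0.le hρ1
  refine ⟨(2 * C * (1 - ρ)⁻¹).toNNReal, fun x y => ?_⟩
  have h1ρ : 0 < 1 - ρ := by linarith
  rw [edist_dist, edist_dist, dist_eq_norm, dist_eq_norm, Real.coe_toNNReal _ hα0.le,
    ENNReal.ofReal_rpow_of_nonneg (norm_nonneg _) hα0.le, ← ENNReal.ofReal_coe_nnreal,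
    Real.coe_toNNReal _ (by positivity), ← ENNReal.ofReal_mul (by positivity)]
  refine ENNReal.ofReal_le_ofReal ?_
  have hj : ∀ j, ‖f j x - f j y‖ ≤ 2 * C * ‖x - y‖ ^ α * ρ ^ j := by
    intro j
    refine (hf j x y).trans ?_
    have h3 : min 2 (‖x - y‖ / g j) ≤ 2 * (‖x - y‖ / g j) ^ α := by
      have hgj := hg j
      rcases le_total (‖x - y‖ / g j) 1 with h | h
      · refine (min_le_right _ _).trans ?_
        have := Real.rpow_le_rpow_of_exponent_ge_of_imp (x := ‖x - y‖ / g j) (y := 1) (z := α)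
          (by positivity) h hα1.le (by intro _ h; exact absurd h one_ne_zero)
        rw [Real.rpow_one] at this
        have h0 : 0 ≤ (‖x - y‖ / g j) ^ α := by positivity
        linarith
      · refine (min_le_left _ _).trans ?_
        have := Real.one_le_rpow h hα0.le
        linarith
    calc M j * min 2 (‖x - y‖ / g j) ≤ M j * (2 * (‖x - y‖ / g j) ^ α) := by
          gcongr; exact hM j
      _ = 2 * ‖x - y‖ ^ α * (M j * g j ^ (-α)) := by
          rw [Real.div_rpow (norm_nonneg _) (hg j).le, Real.rpow_neg (hg j).le]; ring
      _ ≤ 2 * ‖x - y‖ ^ α * (C * ρ ^ j) := mul_le_mul_of_nonneg_left (hdecay j) (by positivity)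
      _ = _ := by ring
  have hs := (hgeo.mul_left (2 * C * ‖x - y‖ ^ α)).hasSum
  rw [tsum_mul_left, tsum_geometric_of_lt_one hρ0.le hρ1] at hs
  rw [← ((hsum x).sub (hsum y)).tsum_eq]
  refine (tsum_of_norm_bounded hs hj).trans (le_of_eq ?_)
  ring

/-! ### The gradient correction scheme, without smoothing -/

section Recursion

variable {X Y : Type*} [NormedAddCommGroup X] [NormedSpace ℝ X] [NormedAddCommGroup Y]
  [NormedSpace ℝ Y]

/-- Piecewise affine approximate solutions of `Du = G(w, u)`, together with their gradients:
the `j`-th step corrects the gradient on each cell `{p j = const}` to its prescribed value at the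
point `p j w` of the cell. -/
def stepPair (p : ℕ → X → X) (G : X × Y → X →L[ℝ] Y) : ℕ → (X → Y) × (X → X →L[ℝ] Y)
  | 0 => (0, 0)
  | j + 1 =>
    (fun w => (stepPair p G j).1 w +
      (G (p j w, (stepPair p G j).1 (p j w)) - (stepPair p G j).2 w) (w - p j w),
     fun w => G (p j w, (stepPair p G j).1 (p j w)))

/-- The function of the `j`-th step. -/
def stepFun (p : ℕ → X → X) (G : X × Y → X →L[ℝ] Y) (j : ℕ) : X → Y := (stepPair p G j).1

/-- The gradient of the `j`-th step. -/
def stepGrad (p : ℕ → X → X) (G : X × Y → X →L[ℝ] Y) (j : ℕ) : X → X →L[ℝ] Y :=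
  (stepPair p G j).2

/-- The gradient correction of the `j`-th step. -/
def stepCorr (p : ℕ → X → X) (G : X × Y → X →L[ℝ] Y) (j : ℕ) (w : X) : X →L[ℝ] Y :=
  stepGrad p G (j + 1) w - stepGrad p G j w

variable {p : ℕ → X → X} {G : X × Y → X →L[ℝ] Y}

theorem stepGrad_succ (j : ℕ) (w : X) :
    stepGrad p G (j + 1) w = G (p j w, stepFun p G j (p j w)) := rfl

theorem stepFun_succ (j : ℕ) (w : X) :
    stepFun p G (j + 1) w = stepFun p G j w + stepCorr p G j w (w - p j w) := rfl

theorem stepGrad_succ_congr {j : ℕ} {w w' : X} (h : p j w = p j w') :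
    stepGrad p G (j + 1) w = stepGrad p G (j + 1) w' := by
  rw [stepGrad_succ, stepGrad_succ, h]

theorem stepGrad_congr (href : ∀ j w w', p (j + 1) w = p (j + 1) w' → p j w = p j w')
    {j : ℕ} {w w' : X} (h : p j w = p j w') : stepGrad p G j w = stepGrad p G j w' := by
  cases j with
  | zero => rfl
  | succ j => exact stepGrad_succ_congr (href j w w' h)

theorem stepCorr_congr (href : ∀ j w w', p (j + 1) w = p (j + 1) w' → p j w = p j w')
    {j : ℕ} {w w' : X} (h : p j w = p j w') : stepCorr p G j w = stepCorr p G j w' := by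
  rw [stepCorr, stepCorr, stepGrad_succ_congr h, stepGrad_congr href h]

/-- The partitions are nested, so on a cell of level `j` the old gradient and the new correction are
both constant. Inductively the new function is affine there, and its slope is their sum. -/
theorem stepFun_succ_sub (href : ∀ j w w', p (j + 1) w = p (j + 1) w' → p j w = p j w') {j : ℕ} :
    ∀ {w w' : X}, p j w = p j w' →
      stepFun p G (j + 1) w - stepFun p G (j + 1) w' = stepGrad p G (j + 1) w (w - w') := by
  induction j with
  | zero =>
    intro w w' h
    rw [stepFun_succ, stepFun_succ, stepCorr_congr href h, h]
    simp only [stepFun, stepPair, Pi.zero_apply, zero_add]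
    rw [← map_sub, sub_sub_sub_cancel_right, ← stepCorr_congr href h]
    simp [stepCorr, stepGrad, stepPair]
  | succ j ih =>
    intro w w' h
    have h1 := ih (href j w w' h)
    rw [stepFun_succ (j + 1), stepFun_succ (j + 1), stepCorr_congr href h, h, add_sub_add_comm, h1,
      ← map_sub, sub_sub_sub_cancel_right, ← stepCorr_congr href h, stepCorr,
      sub_apply]
    abel

/-- Two successive gradients are values of `G` at nested corners. The increment of a step vanishes
at the corner of its cell, so both function values can be read off from `stepFun p G (j + 1)`, which
is affine with slope at most `B` on the cell of level `j`. The arguments of `G` therefore differ by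
`O(2^(-j))`. -/
theorem norm_stepCorr_le (hid : ∀ j w, p j (p j w) = p j w)
    (href : ∀ j w w', p (j + 1) w = p (j + 1) w' → p j w = p j w') {c : ℝ}
    (hdist : ∀ j w, ‖w - p j w‖ ≤ c * (1 / 2) ^ j) {B : ℝ} (hB : ∀ z, ‖G z‖ ≤ B) {L : ℝ≥0}
    (hL : LipschitzWith L G) (j : ℕ) (w : X) :
    ‖stepCorr p G j w‖ ≤ (B + 2 * L * (1 + B) * c) * (1 / 2) ^ j := by
  have hB0 : 0 ≤ B := (norm_nonneg _).trans (hB 0)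
  have hc0 : 0 ≤ c := by simpa using (norm_nonneg _).trans (hdist 0 w)
  cases j with
  | zero =>
    -- The first correction is a value of `G` itself, without cancellation; this is the summand `B`
    -- of the constant. The factor `2` in the other summand pays for the shift from `j + 1` to `j`.
    have : stepCorr p G 0 w = G (p 0 w, stepFun p G 0 (p 0 w)) := by
      rw [stepCorr, stepGrad_succ]; simp [stepGrad, stepPair]
    rw [this, pow_zero, mul_one]
    have : 0 ≤ 2 * L * (1 + B) * c := by positivity
    linarith [hB (p 0 w, stepFun p G 0 (p 0 w))]
  | succ j =>
    set y := p (j + 1) w with hy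
    have hpy : p j y = p j w := href j _ _ (hid (j + 1) w)
    have hdy : ‖y - p j w‖ ≤ c * (1 / 2) ^ j := by rw [← hpy]; exact hdist j y
    have hfe : stepFun p G j (p j w) = stepFun p G (j + 1) (p j w) := by
      rw [stepFun_succ, hid, sub_self, map_zero, add_zero]
    have hfd : ‖stepFun p G (j + 1) y - stepFun p G (j + 1) (p j w)‖ ≤ B * (c * (1 / 2) ^ j) := by
      rw [stepFun_succ_sub href (by rw [hpy, hid])]
      refine (ContinuousLinearMap.le_opNorm _ _).trans ?_
      gcongr
      rw [stepGrad_succ]; exact hB _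
    have h1 : ‖stepCorr p G (j + 1) w‖ ≤ L * ((1 + B) * (c * (1 / 2) ^ j)) := by
      rw [stepCorr, stepGrad_succ, stepGrad_succ, ← hy, hfe, ← dist_eq_norm]
      refine (hL.dist_le_mul _ _).trans ?_
      gcongr
      rw [Prod.dist_eq, dist_eq_norm, dist_eq_norm]
      have : 0 ≤ c * (1 / 2) ^ j := by positivity
      refine max_le ?_ ?_ <;> nlinarith
    refine h1.trans ?_
    rw [pow_succ]
    have : 0 ≤ B * ((1 / 2 : ℝ) ^ j * (1 / 2)) := by positivity
    nlinarith

theorem stepFun_eq_sum (j : ℕ) (w : X) :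
    stepFun p G j w = ∑ i ∈ Finset.range j, stepCorr p G i w (w - p i w) := by
  induction j with
  | zero => rfl
  | succ j ih => rw [Finset.sum_range_succ, ← ih, stepFun_succ]

theorem stepGrad_eq_sum (j : ℕ) (w : X) :
    stepGrad p G j w = ∑ i ∈ Finset.range j, stepCorr p G i w := by
  induction j with
  | zero => rfl
  | succ j ih => rw [Finset.sum_range_succ, ← ih, stepCorr]; abel

/-- The limit of the step functions solves `Du = G(w, u)` formally. -/
theorem eq_of_hasSum_stepCorr (hid : ∀ j w, p j (p j w) = p j w)
    (href : ∀ j w w', p (j + 1) w = p (j + 1) w' → p j w = p j w') {c : ℝ}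
    (hdist : ∀ j w, ‖w - p j w‖ ≤ c * (1 / 2) ^ j) {B : ℝ} (hB : ∀ z, ‖G z‖ ≤ B)
    (hG : Continuous G) {w : X} {u : Y} {D : X →L[ℝ] Y}
    (hu : HasSum (fun j => stepCorr p G j w (w - p j w)) u)
    (hD : HasSum (fun j => stepCorr p G j w) D) : D = G (w, u) := by
  have hpow : Tendsto (fun j : ℕ => c * (1 / 2 : ℝ) ^ j) atTop (𝓝 0) := by
    simpa using (tendsto_pow_atTop_nhds_zero_of_lt_one (r := (1 / 2 : ℝ)) (by norm_num)
      (by norm_num)).const_mul c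
  have hp : Tendsto (fun j => w - p j w) atTop (𝓝 0) :=
    squeeze_zero_norm (fun j => hdist j w) hpow
  have hp' : Tendsto (fun j => p j w) atTop (𝓝 w) := by
    have := (tendsto_const_nhds (x := w)).sub hp
    simpa using this
  have hf1 : Tendsto (fun j => stepFun p G (j + 1) w) atTop (𝓝 u) := by
    have := (tendsto_add_atTop_iff_nat 1).2 hu.tendsto_sum_nat
    simpa only [stepFun_eq_sum] using this
  have hD1 : Tendsto (fun j => stepGrad p G (j + 1) w) atTop (𝓝 D) := by
    have := (tendsto_add_atTop_iff_nat 1).2 hD.tendsto_sum_nat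
    simpa only [stepGrad_eq_sum] using this
  -- The values at `w` and at its corner belong to the same affine piece of bounded slope, so they
  -- have the same limit `u`.
  have hdiff : Tendsto (fun j => stepFun p G (j + 1) w - stepFun p G j (p j w)) atTop (𝓝 0) := by
    refine squeeze_zero_norm (a := fun j : ℕ => B * (c * (1 / 2 : ℝ) ^ j)) (fun j => ?_)
      (by simpa using hpow.const_mul B)
    have hfe : stepFun p G j (p j w) = stepFun p G (j + 1) (p j w) := by
      rw [stepFun_succ, hid, sub_self, map_zero, add_zero]
    rw [hfe, stepFun_succ_sub href (hid j w).symm]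
    have hB0 : 0 ≤ B := (norm_nonneg _).trans (hB 0)
    refine (ContinuousLinearMap.le_opNorm _ _).trans ?_
    gcongr
    · rw [stepGrad_succ]; exact hB _
    · exact hdist j w
  have hf : Tendsto (fun j => stepFun p G j (p j w)) atTop (𝓝 u) := by
    have := hf1.sub hdiff
    simpa using this
  have hG1 : Tendsto (fun j => G (p j w, stepFun p G j (p j w))) atTop (𝓝 (G (w, u))) :=
    (hG.tendsto _).comp (hp'.prodMk_nhds hf)
  exact tendsto_nhds_unique hD1 hG1

end Recursion

/-! ### Cubical grids and cutoffs near their walls -/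

section Cutoff

theorem ContDiffBump.exists_deriv_bounds {c : ℝ} (f : ContDiffBump c) :
    ∃ C : ℝ≥0, LipschitzWith C f ∧ (∀ x, |deriv f x| ≤ C) ∧ LipschitzWith C (deriv f) := by
  have hd : ContDiff ℝ 1 (deriv f) := by
    have : ContDiff ℝ 2 f := f.contDiff
    exact ((contDiff_succ_iff_deriv (n := 1)).1 this).2.2
  have hsup : HasCompactSupport (deriv f) := f.hasCompactSupport.deriv
  obtain ⟨C₁, h₁⟩ := hd.lipschitzWith_of_hasCompactSupport hsup (by norm_num)
  obtain ⟨C₂, h₂⟩ := (f.contDiff (n := 1)).lipschitzWith_of_hasCompactSupport f.hasCompactSupport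
    (by norm_num)
  refine ⟨max C₁ C₂, h₂.weaken (le_max_right _ _), fun x => ?_, h₁.weaken (le_max_left _ _)⟩
  have := norm_deriv_le_of_lipschitz h₂ (x₀ := x)
  rw [Real.norm_eq_abs] at this
  exact this.trans (by exact_mod_cast le_max_right C₁ C₂)

/-- A bump equal to `1` on `[-1, 1]` and to `0` off `(-2, 2)`. -/
noncomputable def wallBump : ContDiffBump (0 : ℝ) := ⟨1, 2, one_pos, one_lt_two⟩

/-- A bump equal to `1` on `[-1/2, 1/2]` and to `0` off `(-1, 1)`. -/
noncomputable def capBump : ContDiffBump (0 : ℝ) := ⟨1 / 2, 1, by norm_num, by norm_num⟩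

variable {ι X Y : Type*} [Fintype ι] [NormedAddCommGroup X] [InnerProductSpace ℝ X]
  [NormedAddCommGroup Y] [NormedSpace ℝ Y]

/-- The lower corner of the cell containing `w` of the cubical grid of mesh `h` through `w₀`. -/
noncomputable def gridCorner (b : OrthonormalBasis ι ℝ X) (w₀ : X) (h : ℝ) (w : X) : X :=
  w₀ + ∑ i, (h * ⌊inner ℝ (b i) (w - w₀) / h⌋) • b i

/-- The walls of the grid of mesh `h` through `w₀`, of relative thickness `ε`, as a smooth sum of
coordinate bumps. -/
noncomputable def wallSum (b : OrthonormalBasis ι ℝ X) (w₀ : X) (h ε : ℝ) (w : X) : ℝ :=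
  ∑ i, wallBump (Real.sin (Real.pi * (inner ℝ (b i) (w - w₀) / h)) / ε)

/-- A smooth cutoff vanishing near the walls of the grid. -/
noncomputable def wallCutoff (b : OrthonormalBasis ι ℝ X) (w₀ : X) (h ε : ℝ) (w : X) : ℝ :=
  capBump (wallSum b w₀ h ε w)

/-- The derivative of `wallSum`. -/
noncomputable def wallSumDeriv (b : OrthonormalBasis ι ℝ X) (w₀ : X) (h ε : ℝ) (w : X) : X →L[ℝ] ℝ :=
  ∑ i, (deriv wallBump (Real.sin (Real.pi * (inner ℝ (b i) (w - w₀) / h)) / ε) *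
    (Real.cos (Real.pi * (inner ℝ (b i) (w - w₀) / h)) * (Real.pi / h) / ε)) • innerSL ℝ (b i)

/-- The derivative of `wallCutoff`. -/
noncomputable def wallCutoffDeriv (b : OrthonormalBasis ι ℝ X) (w₀ : X) (h ε : ℝ) (w : X) : X →L[ℝ] ℝ :=
  deriv capBump (wallSum b w₀ h ε w) • wallSumDeriv b w₀ h ε w

variable (b : OrthonormalBasis ι ℝ X) (w₀ : X) (h ε : ℝ)

theorem inner_gridCorner_sub (i : ι) (w : X) :
    inner ℝ (b i) (gridCorner b w₀ h w - w₀) = h * ⌊inner ℝ (b i) (w - w₀) / h⌋ := by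
  classical
  rw [gridCorner, add_sub_cancel_left, inner_sum]
  simp [inner_smul_right, b.inner_eq_ite]

theorem gridCorner_eq_iff (hh : 0 < h) {w w' : X} : gridCorner b w₀ h w = gridCorner b w₀ h w' ↔
    ∀ i, ⌊inner ℝ (b i) (w - w₀) / h⌋ = ⌊inner ℝ (b i) (w' - w₀) / h⌋ := by
  constructor
  · intro hw i
    have := congrArg (fun z => inner ℝ (b i) (z - w₀)) hw
    simp only [inner_gridCorner_sub] at this
    exact_mod_cast mul_left_cancel₀ hh.ne' this
  · intro hw
    simp only [gridCorner, hw]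

theorem gridCorner_idem (hh : 0 < h) (w : X) :
    gridCorner b w₀ h (gridCorner b w₀ h w) = gridCorner b w₀ h w := by
  rw [gridCorner_eq_iff b w₀ h hh]
  intro i
  rw [inner_gridCorner_sub, mul_div_cancel_left₀ _ hh.ne', Int.floor_intCast]

/-- The floor at mesh `h` is the integer half of the floor at mesh `h / 2`, so halving the mesh
refines the partition. -/
theorem gridCorner_eq_of_half (hh : 0 < h) {w w' : X}
    (hw : gridCorner b w₀ (h / 2) w = gridCorner b w₀ (h / 2) w') :
    gridCorner b w₀ h w = gridCorner b w₀ h w' := by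
  rw [gridCorner_eq_iff b w₀ _ (by positivity)] at hw ⊢
  intro i
  have key : ∀ t : ℝ, ⌊t / h⌋ = ⌊t / (h / 2)⌋ / 2 := by
    intro t
    have h1 : t / h = (t / (h / 2)) / ((2 : ℕ) : ℝ) := by push_cast; field_simp
    rw [h1, Int.floor_div_natCast]
    norm_num
  rw [key, key, hw i]

theorem norm_sub_gridCorner_le (hh : 0 < h) (w : X) :
    ‖w - gridCorner b w₀ h w‖ ≤ Fintype.card ι * h := by
  have h1 : w - gridCorner b w₀ h w =
      ∑ i, (inner ℝ (b i) (w - gridCorner b w₀ h w) : ℝ) • b i :=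
    (b.sum_repr' (w - gridCorner b w₀ h w)).symm
  rw [h1]
  refine (norm_sum_le _ _).trans ?_
  rw [← nsmul_eq_mul]
  refine Finset.sum_le_card_nsmul _ _ _ fun i _ => ?_
  rw [norm_smul, b.norm_eq_one, mul_one, Real.norm_eq_abs]
  have h2 : inner ℝ (b i) (w - gridCorner b w₀ h w) =
      inner ℝ (b i) (w - w₀) - h * ⌊inner ℝ (b i) (w - w₀) / h⌋ := by
    rw [← inner_gridCorner_sub, ← inner_sub_right, sub_sub_sub_cancel_right]
  rw [h2]
  set t : ℝ := inner ℝ (b i) (w - w₀)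
  have h3 := Int.floor_le (t / h)
  have h4 := Int.lt_floor_add_one (t / h)
  rw [le_div_iff₀ hh] at h3
  rw [div_lt_iff₀ hh] at h4
  rw [abs_le]
  constructor <;> nlinarith

theorem hasFDerivAt_wallSum (w : X) :
    HasFDerivAt (wallSum b w₀ h ε) (wallSumDeriv b w₀ h ε w) w := by
  unfold wallSum wallSumDeriv
  refine HasFDerivAt.fun_sum fun i _ => ?_
  have h1 : HasFDerivAt (fun w : X => inner ℝ (b i) (w - w₀)) (innerSL ℝ (b i)) w := by
    have := (innerSL ℝ (b i)).hasFDerivAt (x := w)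
    simp only [inner_sub_right]
    exact this.sub_const _
  have h2 : HasDerivAt (fun t : ℝ => wallBump (Real.sin (Real.pi * (t / h)) / ε))
      (deriv wallBump (Real.sin (Real.pi * (inner ℝ (b i) (w - w₀) / h)) / ε) *
      (Real.cos (Real.pi * (inner ℝ (b i) (w - w₀) / h)) * (Real.pi / h) / ε))
      (inner ℝ (b i) (w - w₀)) := by
    have hb : DifferentiableAt ℝ wallBump
        (Real.sin (Real.pi * (inner ℝ (b i) (w - w₀) / h)) / ε) :=
      (wallBump.contDiff (n := 1)).differentiable (by norm_num) _
    refine hb.hasDerivAt.comp (inner ℝ (b i) (w - w₀)) (h := fun t : ℝ =>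
      Real.sin (Real.pi * (t / h)) / ε) ?_
    have h3 : HasDerivAt (fun t : ℝ => Real.pi * (t / h)) (Real.pi / h)
        (inner ℝ (b i) (w - w₀)) := by
      have := ((hasDerivAt_id (inner ℝ (b i) (w - w₀) : ℝ)).div_const h).const_mul Real.pi
      simpa [div_eq_mul_inv] using this
    exact h3.sin.div_const ε
  exact HasDerivAt.comp_hasFDerivAt (f := fun w : X => inner ℝ (b i) (w - w₀)) w h2 h1

theorem hasFDerivAt_wallCutoff (w : X) :
    HasFDerivAt (wallCutoff b w₀ h ε) (wallCutoffDeriv b w₀ h ε w) w := by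
  have hb : DifferentiableAt ℝ capBump (wallSum b w₀ h ε w) :=
    (capBump.contDiff (n := 1)).differentiable (by norm_num) _
  exact hb.hasDerivAt.comp_hasFDerivAt w (hasFDerivAt_wallSum b w₀ h ε w)

theorem wallCutoff_nonneg (w : X) : 0 ≤ wallCutoff b w₀ h ε w := capBump.nonneg

theorem wallCutoff_le_one (w : X) : wallCutoff b w₀ h ε w ≤ 1 := capBump.le_one

/-- Near the walls, the cutoff and its derivative vanish. -/
theorem wallCutoff_eq_zero (hε : 0 < ε) {w : X} {i : ι}
    (hi : |Real.sin (Real.pi * (inner ℝ (b i) (w - w₀) / h))| ≤ ε) :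
    wallCutoff b w₀ h ε w = 0 := by
  have h1 : 1 ≤ wallSum b w₀ h ε w := by
    have h2 : wallBump (Real.sin (Real.pi * (inner ℝ (b i) (w - w₀) / h)) / ε) = 1 := by
      refine wallBump.one_of_mem_closedBall ?_
      rw [mem_closedBall_zero_iff, Real.norm_eq_abs, abs_div, abs_of_pos hε]
      exact (div_le_one hε).2 hi
    rw [← h2]
    exact Finset.single_le_sum (f := fun i => wallBump (Real.sin (Real.pi *
      (inner ℝ (b i) (w - w₀) / h)) / ε)) (fun _ _ => wallBump.nonneg) (Finset.mem_univ i)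
  refine capBump.zero_of_le_dist ?_
  rw [Real.dist_0_eq_abs]
  exact h1.trans (le_abs_self _)

theorem wallCutoffDeriv_eq_zero_of_abs_sin_lt (hε : 0 < ε) {w : X} {i : ι}
    (hi : |Real.sin (Real.pi * (inner ℝ (b i) (w - w₀) / h))| < ε) :
    wallCutoff b w₀ h ε =ᶠ[𝓝 w] 0 ∧ wallCutoffDeriv b w₀ h ε w = 0 := by
  have hopen : ∀ᶠ y in 𝓝 w, |Real.sin (Real.pi * (inner ℝ (b i) (y - w₀) / h))| < ε := by
    have hc : Continuous fun y : X => |Real.sin (Real.pi * (inner ℝ (b i) (y - w₀) / h))| := by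
      fun_prop
    exact hc.continuousAt.eventually_lt continuousAt_const hi
  have h0 : wallCutoff b w₀ h ε =ᶠ[𝓝 w] 0 := by
    filter_upwards [hopen] with y hy
    exact wallCutoff_eq_zero b w₀ h ε hε hy.le
  refine ⟨h0, ?_⟩
  have := (hasFDerivAt_wallCutoff b w₀ h ε w).fderiv
  rw [h0.fderiv_eq] at this
  rw [← this]
  simp

/-- Away from the walls, the cutoff is `1` and its derivative vanishes. -/
theorem wallCutoff_eq_one (hε : 0 < ε) {w : X}
    (hi : ∀ i, 2 * ε ≤ |Real.sin (Real.pi * (inner ℝ (b i) (w - w₀) / h))|) :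
    wallCutoff b w₀ h ε w = 1 ∧ wallCutoffDeriv b w₀ h ε w = 0 := by
  have h0 : wallSum b w₀ h ε w = 0 := by
    refine Finset.sum_eq_zero fun i _ => wallBump.zero_of_le_dist ?_
    rw [Real.dist_0_eq_abs, abs_div, abs_of_pos hε]
    exact (le_div_iff₀ hε).2 (hi i)
  have hT : ∀ᶠ x in 𝓝 (0 : ℝ), capBump x = 1 := capBump.eventuallyEq_one
  refine ⟨by rw [wallCutoff, h0]; exact hT.self_of_nhds, ?_⟩
  have hd : deriv capBump 0 = 0 := by
    have : capBump =ᶠ[𝓝 (0 : ℝ)] fun _ => 1 := hT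
    rw [this.deriv_eq]; simp
  rw [wallCutoffDeriv, h0, hd, zero_smul]

/-- Quantitative bounds for the cutoff and its derivative. -/
theorem exists_wallCutoff_bounds [Nonempty ι] (b : OrthonormalBasis ι ℝ X) (w₀ : X) :
    ∃ Λ : ℝ, 1 ≤ Λ ∧ ∀ h ε : ℝ, 0 < h → 0 < ε → ε ≤ 1 →
      (∀ x y, |wallCutoff b w₀ h ε x - wallCutoff b w₀ h ε y| ≤ Λ / (ε * h) * ‖x - y‖) ∧
      (∀ x, ‖wallCutoffDeriv b w₀ h ε x‖ ≤ Λ / (ε * h)) ∧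
      (∀ x y, ‖wallCutoffDeriv b w₀ h ε x - wallCutoffDeriv b w₀ h ε y‖ ≤
        (Λ / (ε * h)) ^ 2 * ‖x - y‖) := by
  obtain ⟨C₁, hκ, hκ', hκ''⟩ := wallBump.exists_deriv_bounds
  obtain ⟨C₂, hT, hT', hT''⟩ := capBump.exists_deriv_bounds
  obtain ⟨C, hC1, hCκ, hCT⟩ : ∃ C : ℝ, 1 ≤ C ∧ (C₁ : ℝ) ≤ C ∧ (C₂ : ℝ) ≤ C :=
    ⟨1 + C₁ + C₂, by have := C₁.2; have := C₂.2; simp only [NNReal.val_eq_coe] at *; linarith,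
      by have := C₂.2; simp only [NNReal.val_eq_coe] at *; linarith,
      by have := C₁.2; simp only [NNReal.val_eq_coe] at *; linarith⟩
  set k : ℝ := (Fintype.card ι : ℝ) with hk
  have hk1 : 1 ≤ k := by
    rw [hk]; exact_mod_cast (Fintype.card_pos : 0 < Fintype.card ι)
  -- A common majorant of the chain rule constants: `k C²` for the cutoff and its derivative, and
  -- `k² C³ + 2 k C²`, to be bounded by a square, for the Lipschitz constant of the derivative.
  refine ⟨3 * k ^ 2 * C ^ 3 * Real.pi, ?_, ?_⟩
  · have h1 : 1 ≤ k ^ 2 := one_le_pow₀ hk1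
    have h2 : 1 ≤ C ^ 3 := one_le_pow₀ hC1
    have := Real.pi_gt_three
    have h3 : 1 ≤ k ^ 2 * C ^ 3 := one_le_mul_of_one_le_of_one_le h1 h2
    nlinarith
  intro h ε hh hε hε1
  set Q := Real.pi / (ε * h) with hQ
  have hQ0 : 0 < Q := by positivity
  have hlinκ : ∀ x y, |wallBump x - wallBump y| ≤ C * |x - y| := fun x y => by
    have := hκ.dist_le_mul x y
    rw [Real.dist_eq, Real.dist_eq] at this
    exact this.trans (by gcongr)
  have hlinκ' : ∀ x y, |deriv wallBump x - deriv wallBump y| ≤ C * |x - y| := fun x y => by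
    have := hκ''.dist_le_mul x y
    rw [Real.dist_eq, Real.dist_eq] at this
    exact this.trans (by gcongr)
  have hlinT : ∀ x y, |capBump x - capBump y| ≤ C * |x - y| := fun x y => by
    have := hT.dist_le_mul x y
    rw [Real.dist_eq, Real.dist_eq] at this
    exact this.trans (by gcongr)
  have hlinT' : ∀ x y, |deriv capBump x - deriv capBump y| ≤ C * |x - y| := fun x y => by
    have := hT''.dist_le_mul x y
    rw [Real.dist_eq, Real.dist_eq] at this
    exact this.trans (by gcongr)
  have harg : ∀ i x y, |Real.pi * (inner ℝ (b i) (x - w₀) / h) -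
      Real.pi * (inner ℝ (b i) (y - w₀) / h)| ≤ Real.pi / h * ‖x - y‖ := by
    intro i x y
    have h1 : Real.pi * (inner ℝ (b i) (x - w₀) / h) - Real.pi * (inner ℝ (b i) (y - w₀) / h) =
        Real.pi / h * inner ℝ (b i) (x - y) := by
      rw [← sub_sub_sub_cancel_right x y w₀, inner_sub_right (b i) (x - w₀)]; ring
    rw [h1, abs_mul, abs_of_pos (by positivity)]
    gcongr
    have := abs_real_inner_le_norm (b i) (x - y)
    rwa [b.norm_eq_one, one_mul] at this
  have hQh : Real.pi / h ≤ Q := by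
    rw [hQ]; gcongr; nlinarith
  have hsin : ∀ i x y, |Real.sin (Real.pi * (inner ℝ (b i) (x - w₀) / h)) / ε -
      Real.sin (Real.pi * (inner ℝ (b i) (y - w₀) / h)) / ε| ≤ Q * ‖x - y‖ := by
    intro i x y
    rw [← sub_div, abs_div, abs_of_pos hε, div_le_iff₀ hε]
    refine (Real.abs_sin_sub_sin_le _ _).trans ((harg i x y).trans (le_of_eq ?_))
    rw [hQ]; field_simp
  have hcos : ∀ i x y, |Real.cos (Real.pi * (inner ℝ (b i) (x - w₀) / h)) -
      Real.cos (Real.pi * (inner ℝ (b i) (y - w₀) / h))| ≤ Q * ‖x - y‖ := by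
    intro i x y
    refine (Real.abs_cos_sub_cos_le _ _).trans ((harg i x y).trans ?_)
    gcongr
  have hσ : ∀ x y, |wallSum b w₀ h ε x - wallSum b w₀ h ε y| ≤ k * C * Q * ‖x - y‖ := by
    intro x y
    rw [wallSum, wallSum, ← Finset.sum_sub_distrib]
    refine (Finset.abs_sum_le_sum_abs _ _).trans ?_
    rw [mul_assoc, mul_assoc, hk, ← nsmul_eq_mul]
    refine Finset.sum_le_card_nsmul _ _ _ fun i _ => ?_
    refine (hlinκ _ _).trans ?_
    gcongr
    exact hsin i x y
  have hDσ : ∀ x, ‖wallSumDeriv b w₀ h ε x‖ ≤ k * C * Q := by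
    intro x
    refine (norm_sum_le _ _).trans ?_
    rw [mul_assoc, hk, ← nsmul_eq_mul]
    refine Finset.sum_le_card_nsmul _ _ _ fun i _ => ?_
    rw [norm_smul, innerSL_apply_norm, b.norm_eq_one, mul_one, norm_mul, Real.norm_eq_abs]
    refine mul_le_mul ((hκ' _).trans hCκ) ?_ (norm_nonneg _) (by linarith)
    have hr : Real.cos (Real.pi * (inner ℝ (b i) (x - w₀) / h)) * (Real.pi / h) / ε =
        Real.cos (Real.pi * (inner ℝ (b i) (x - w₀) / h)) * Q := by rw [hQ]; field_simp
    rw [hr, norm_mul, Real.norm_eq_abs, Real.norm_of_nonneg hQ0.le]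
    exact mul_le_of_le_one_left hQ0.le (Real.abs_cos_le_one _)
  have hDσ' : ∀ x y, ‖wallSumDeriv b w₀ h ε x - wallSumDeriv b w₀ h ε y‖ ≤
      2 * k * C * Q ^ 2 * ‖x - y‖ := by
    intro x y
    rw [wallSumDeriv, wallSumDeriv, ← Finset.sum_sub_distrib]
    refine (norm_sum_le _ _).trans ?_
    rw [show 2 * k * C * Q ^ 2 * ‖x - y‖ = k * (2 * C * Q ^ 2 * ‖x - y‖) by ring, hk,
      ← nsmul_eq_mul]
    refine Finset.sum_le_card_nsmul _ _ _ fun i _ => ?_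
    have hsub : ∀ (r s : ℝ) (l : X →L[ℝ] ℝ), r • l - s • l = (r - s) • l := fun r s l => by
      ext z
      simp [sub_mul]
    rw [hsub, norm_smul, innerSL_apply_norm, b.norm_eq_one, mul_one, Real.norm_eq_abs]
    have h1 := (hlinκ' _ _).trans (mul_le_mul_of_nonneg_left (hsin i x y) (by linarith : 0 ≤ C))
    have h2 := hcos i x y
    have h3 := (hκ' (Real.sin (Real.pi * (inner ℝ (b i) (y - w₀) / h)) / ε)).trans hCκ
    have h4 := Real.abs_cos_le_one (Real.pi * (inner ℝ (b i) (x - w₀) / h))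
    have hr : ∀ c : ℝ, c * (Real.pi / h) / ε = c * Q := fun c => by rw [hQ]; field_simp
    rw [hr, hr]
    set cx := Real.cos (Real.pi * (inner ℝ (b i) (x - w₀) / h))
    set cy := Real.cos (Real.pi * (inner ℝ (b i) (y - w₀) / h))
    set dx := deriv wallBump (Real.sin (Real.pi * (inner ℝ (b i) (x - w₀) / h)) / ε)
    set dy := deriv wallBump (Real.sin (Real.pi * (inner ℝ (b i) (y - w₀) / h)) / ε)
    have h5 : dx * (cx * Q) - dy * (cy * Q) = ((dx - dy) * cx + dy * (cx - cy)) * Q := by ring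
    rw [h5, abs_mul, abs_of_pos hQ0]
    have h6 : |(dx - dy) * cx + dy * (cx - cy)| ≤ C * (Q * ‖x - y‖) * 1 + C * (Q * ‖x - y‖) := by
      refine (abs_add_le _ _).trans ?_
      rw [abs_mul, abs_mul]
      gcongr
    calc _ ≤ (C * (Q * ‖x - y‖) * 1 + C * (Q * ‖x - y‖)) * Q := by gcongr
      _ = _ := by ring
  have hCk : 1 ≤ k * C := one_le_mul_of_one_le_of_one_le hk1 hC1
  have hΛ : 3 * k ^ 2 * C ^ 3 * Real.pi / (ε * h) = 3 * k ^ 2 * C ^ 3 * Q := by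
    rw [hQ]; ring
  rw [hΛ]
  have hC3 : k * C * C ≤ 3 * k ^ 2 * C ^ 3 := by
    have : k * C * C * 1 ≤ k * C * C * (k * C) := by gcongr
    nlinarith [show 0 ≤ k ^ 2 * C ^ 3 by positivity]
  refine ⟨fun x y => ?_, fun x => ?_, fun x y => ?_⟩
  · calc _ ≤ C * (k * C * Q * ‖x - y‖) := (hlinT _ _).trans (by gcongr; exact hσ x y)
      _ = (k * C * C) * Q * ‖x - y‖ := by ring
      _ ≤ _ := by gcongr
  · rw [wallCutoffDeriv, norm_smul, Real.norm_eq_abs]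
    calc _ ≤ C * (k * C * Q) :=
          mul_le_mul ((hT' _).trans hCT) (hDσ x) (norm_nonneg _) (by linarith)
      _ = (k * C * C) * Q := by ring
      _ ≤ _ := by gcongr
  · rw [wallCutoffDeriv, wallCutoffDeriv]
    set tx := deriv capBump (wallSum b w₀ h ε x)
    set ty := deriv capBump (wallSum b w₀ h ε y)
    have h5 : tx • wallSumDeriv b w₀ h ε x - ty • wallSumDeriv b w₀ h ε y =
        (tx - ty) • wallSumDeriv b w₀ h ε x +
          ty • (wallSumDeriv b w₀ h ε x - wallSumDeriv b w₀ h ε y) := by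
      ext z
      simp only [sub_apply, smul_apply, add_apply, smul_eq_mul]
      ring
    have h6 : |tx - ty| ≤ C * (k * C * Q * ‖x - y‖) := (hlinT' _ _).trans (by gcongr; exact hσ x y)
    have h7 : |ty| ≤ C := (hT' _).trans hCT
    rw [h5]
    refine (norm_add_le _ _).trans ?_
    rw [norm_smul, norm_smul, Real.norm_eq_abs, Real.norm_eq_abs]
    calc _ ≤ C * (k * C * Q * ‖x - y‖) * (k * C * Q) + C * (2 * k * C * Q ^ 2 * ‖x - y‖) := by
          gcongr
          · exact hDσ x
          · exact hDσ' x y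
      _ = (k ^ 2 * C ^ 3 + 2 * k * C ^ 2) * (Q ^ 2 * ‖x - y‖) := by ring
      _ ≤ (3 * k ^ 2 * C ^ 3) ^ 2 * (Q ^ 2 * ‖x - y‖) := by
          have h8 : 1 ≤ k ^ 2 * C ^ 3 :=
            one_le_mul_of_one_le_of_one_le (one_le_pow₀ hk1) (one_le_pow₀ hC1)
          have h9 : k * C ^ 2 ≤ k ^ 2 * C ^ 3 := by
            have : k * C ^ 2 * 1 ≤ k * C ^ 2 * (k * C) := by gcongr
            nlinarith
          have h10 : k ^ 2 * C ^ 3 + 2 * k * C ^ 2 ≤ (3 * k ^ 2 * C ^ 3) ^ 2 := by nlinarith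
          gcongr
      _ = _ := by ring

end Cutoff

/-! ### Cut-off piecewise affine functions -/

section GridPiece

variable {ι X Y : Type*} [Fintype ι] [NormedAddCommGroup X] [InnerProductSpace ℝ X]
  [NormedAddCommGroup Y] [NormedSpace ℝ Y]

/-- A function which is affine with linear part `c` on each cell, cut off near the walls. -/
noncomputable def gridPiece (b : OrthonormalBasis ι ℝ X) (w₀ : X) (h ε : ℝ) (c : X → X →L[ℝ] Y)
    (w : X) : Y :=
  wallCutoff b w₀ h ε w • c w (w - gridCorner b w₀ h w)

/-- The part of the derivative of `gridPiece` which is constant on the cells away from the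
walls. -/
noncomputable def gridPieceFlat (b : OrthonormalBasis ι ℝ X) (w₀ : X) (h ε : ℝ)
    (c : X → X →L[ℝ] Y) (w : X) : X →L[ℝ] Y :=
  wallCutoff b w₀ h ε w • c w

/-- The part of the derivative of `gridPiece` which is supported near the walls. -/
noncomputable def gridPieceSteep (b : OrthonormalBasis ι ℝ X) (w₀ : X) (h ε : ℝ)
    (c : X → X →L[ℝ] Y) (w : X) : X →L[ℝ] Y :=
  (wallCutoffDeriv b w₀ h ε w).smulRight (c w (w - gridCorner b w₀ h w))

variable (b : OrthonormalBasis ι ℝ X) (w₀ : X) {h ε : ℝ}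

theorem eventually_gridCorner_eq (hh : 0 < h) {w : X}
    (hw : ∀ i, Real.sin (Real.pi * (inner ℝ (b i) (w - w₀) / h)) ≠ 0) :
    ∀ᶠ y in 𝓝 w, gridCorner b w₀ h y = gridCorner b w₀ h w := by
  have hi : ∀ i, ∀ᶠ y in 𝓝 w, ⌊inner ℝ (b i) (y - w₀) / h⌋ = ⌊inner ℝ (b i) (w - w₀) / h⌋ := by
    intro i
    have hc : Continuous fun y : X => inner ℝ (b i) (y - w₀) / h := by fun_prop
    set t := inner ℝ (b i) (w - w₀) / h with ht
    have hlt : (⌊t⌋ : ℝ) < t := by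
      refine lt_of_le_of_ne (Int.floor_le t) fun heq => hw i ?_
      rw [← ht, ← heq, mul_comm]
      exact Real.sin_int_mul_pi _
    have h1 : ∀ᶠ y in 𝓝 w, (⌊t⌋ : ℝ) < inner ℝ (b i) (y - w₀) / h :=
      continuousAt_const.eventually_lt hc.continuousAt hlt
    have h2 : ∀ᶠ y in 𝓝 w, inner ℝ (b i) (y - w₀) / h < ⌊t⌋ + 1 :=
      hc.continuousAt.eventually_lt continuousAt_const (Int.lt_floor_add_one t)
    filter_upwards [h1, h2] with y hy1 hy2
    exact Int.floor_eq_iff.2 ⟨hy1.le, hy2⟩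
  filter_upwards [eventually_all.2 hi] with y hy
  exact (gridCorner_eq_iff b w₀ h hh).2 hy

/-- The corner and `c` jump only across walls, near which the cutoff is identically zero. Elsewhere
they are locally constant and the product rule applies. -/
theorem hasFDerivAt_gridPiece (hh : 0 < h) (hε : 0 < ε) {c : X → X →L[ℝ] Y}
    (hc : ∀ w w', gridCorner b w₀ h w = gridCorner b w₀ h w' → c w = c w') (w : X) :
    HasFDerivAt (gridPiece b w₀ h ε c)
      (gridPieceFlat b w₀ h ε c w + gridPieceSteep b w₀ h ε c w) w := by
  by_cases hw : ∃ i, |Real.sin (Real.pi * (inner ℝ (b i) (w - w₀) / h))| < ε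
  · obtain ⟨i, hi⟩ := hw
    obtain ⟨h1, h2⟩ := wallCutoffDeriv_eq_zero_of_abs_sin_lt b w₀ h ε hε hi
    have h3 : gridPieceFlat b w₀ h ε c w + gridPieceSteep b w₀ h ε c w = 0 := by
      have := h1.self_of_nhds
      rw [gridPieceFlat, gridPieceSteep, h2, this]
      simp
    rw [h3]
    refine (hasFDerivAt_const (0 : Y) w).congr_of_eventuallyEq ?_
    filter_upwards [h1] with y hy
    rw [gridPiece, hy, Pi.zero_apply, zero_smul]
  · push Not at hw
    have hne : ∀ i, Real.sin (Real.pi * (inner ℝ (b i) (w - w₀) / h)) ≠ 0 := fun i hi => by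
      have := hw i
      rw [hi, abs_zero] at this
      linarith
    have hloc := eventually_gridCorner_eq b w₀ hh hne
    have hd : HasFDerivAt (fun y => wallCutoff b w₀ h ε y • c w (y - gridCorner b w₀ h w))
        (gridPieceFlat b w₀ h ε c w + gridPieceSteep b w₀ h ε c w) w := by
      have h1 : HasFDerivAt (fun y => c w (y - gridCorner b w₀ h w)) (c w) w := by
        have := ((c w).hasFDerivAt (x := w)).sub_const (c w (gridCorner b w₀ h w))
        simpa only [map_sub] using this
      exact (hasFDerivAt_wallCutoff b w₀ h ε w).smul h1
    refine hd.congr_of_eventuallyEq ?_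
    filter_upwards [hloc] with y hy
    rw [gridPiece, hy, hc y w hy]

/-- Two points in different cells are separated by a wall. -/
theorem exists_wall_between (hh : 0 < h) (hε : 0 < ε) {x y : X}
    (hxy : gridCorner b w₀ h x ≠ gridCorner b w₀ h y) :
    ∃ z, ‖x - z‖ + ‖y - z‖ = ‖x - y‖ ∧ wallCutoff b w₀ h ε z = 0 ∧
      wallCutoffDeriv b w₀ h ε z = 0 := by
  wlog hlt : ∃ i, ⌊inner ℝ (b i) (x - w₀) / h⌋ < ⌊inner ℝ (b i) (y - w₀) / h⌋ generalizing x y with H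
  · have : ∃ i, ⌊inner ℝ (b i) (y - w₀) / h⌋ < ⌊inner ℝ (b i) (x - w₀) / h⌋ := by
      by_contra hcon
      push Not at hlt hcon
      exact hxy ((gridCorner_eq_iff b w₀ h hh).2 fun i => le_antisymm (hcon i) (hlt i))
    obtain ⟨z, hz, hz'⟩ := H hxy.symm this
    exact ⟨z, by rw [add_comm, hz, norm_sub_rev], hz'⟩
  obtain ⟨i, hi⟩ := hlt
  set s : ℝ := inner ℝ (b i) (x - w₀) / h with hs
  set t : ℝ := inner ℝ (b i) (y - w₀) / h with ht
  have h1 : s < ⌊t⌋ := by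
    have := Int.lt_floor_add_one s
    have h2 : ((⌊s⌋ + 1 : ℤ) : ℝ) ≤ ⌊t⌋ := by exact_mod_cast hi
    push_cast at h2
    linarith
  have h2 : (⌊t⌋ : ℝ) ≤ t := Int.floor_le t
  -- The parameter at which the segment from `x` to `y` has `i`-th rescaled coordinate equal to the
  -- integer `⌊t⌋`, that is, meets a wall.
  set l := (⌊t⌋ - s) / (t - s) with hl
  have hts : 0 < t - s := by linarith
  have hl0 : 0 ≤ l := div_nonneg (by linarith) hts.le
  have hl1 : l ≤ 1 := (div_le_one hts).2 (by linarith)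
  have hz : inner ℝ (b i) (x + l • (y - x) - w₀) / h = ⌊t⌋ := by
    have h3 : x + l • (y - x) - w₀ = (x - w₀) + l • ((y - w₀) - (x - w₀)) := by
      rw [sub_sub_sub_cancel_right]; abel
    have h4 : s + l * (t - s) = ⌊t⌋ := by rw [hl]; field_simp; ring
    rw [h3, inner_add_right, inner_smul_right, inner_sub_right _ (y - w₀), ← h4, hs, ht]
    field_simp
  have hsin : |Real.sin (Real.pi * (inner ℝ (b i) (x + l • (y - x) - w₀) / h))| < ε := by
    rw [hz, mul_comm, Real.sin_int_mul_pi, abs_zero]; exact hε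
  obtain ⟨h5, h6⟩ := wallCutoffDeriv_eq_zero_of_abs_sin_lt b w₀ h ε hε hsin
  refine ⟨x + l • (y - x), ?_, h5.self_of_nhds, h6⟩
  have h7 : x - (x + l • (y - x)) = l • (x - y) := by rw [smul_sub, smul_sub]; abel
  have h8 : y - (x + l • (y - x)) = (1 - l) • (y - x) := by rw [sub_smul, one_smul]; abel
  rw [h7, h8, norm_smul, norm_smul, Real.norm_of_nonneg hl0, Real.norm_of_nonneg (by linarith),
    norm_sub_rev y x]
  ring

theorem norm_gridPieceFlat_le {c : X → X →L[ℝ] Y} {a : ℝ} (hca : ∀ w, ‖c w‖ ≤ a) (w : X) :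
    ‖gridPieceFlat b w₀ h ε c w‖ ≤ a := by
  rw [gridPieceFlat, norm_smul, Real.norm_of_nonneg (wallCutoff_nonneg ..)]
  exact (mul_le_of_le_one_left (norm_nonneg _) (wallCutoff_le_one ..)).trans (hca w)

theorem norm_gridPiece_le (hh : 0 < h) {c : X → X →L[ℝ] Y} {a : ℝ} (hca : ∀ w, ‖c w‖ ≤ a)
    (w : X) : ‖gridPiece b w₀ h ε c w‖ ≤ a * (Fintype.card ι * h) := by
  rw [gridPiece, norm_smul, Real.norm_of_nonneg (wallCutoff_nonneg ..)]
  refine (mul_le_of_le_one_left (norm_nonneg _) (wallCutoff_le_one ..)).trans ?_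
  exact (c w).le_of_opNorm_le_of_le (hca w) (norm_sub_gridCorner_le b w₀ h hh w)

/-- Inside a cell only the cutoff varies. For different cells one passes through a wall point `z` of
the segment, where the piece vanishes; since `‖x - z‖ + ‖y - z‖ = ‖x - y‖`, the jump of `c` costs
nothing. -/
theorem norm_gridPieceFlat_sub_le (hh : 0 < h) (hε : 0 < ε) {c : X → X →L[ℝ] Y}
    (hc : ∀ w w', gridCorner b w₀ h w = gridCorner b w₀ h w' → c w = c w') {a : ℝ}
    (hca : ∀ w, ‖c w‖ ≤ a) {K : ℝ}
    (hΘ : ∀ x y, |wallCutoff b w₀ h ε x - wallCutoff b w₀ h ε y| ≤ K * ‖x - y‖) (x y : X) :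
    ‖gridPieceFlat b w₀ h ε c x - gridPieceFlat b w₀ h ε c y‖ ≤ a * min 2 (K * ‖x - y‖) := by
  have ha : 0 ≤ a := (norm_nonneg _).trans (hca 0)
  rw [mul_min_of_nonneg _ _ ha]
  refine le_min ?_ ?_
  · refine (norm_sub_le _ _).trans ?_
    linarith [norm_gridPieceFlat_le (h := h) (ε := ε) b w₀ hca x,
      norm_gridPieceFlat_le (h := h) (ε := ε) b w₀ hca y]
  by_cases hxy : gridCorner b w₀ h x = gridCorner b w₀ h y
  · rw [gridPieceFlat, gridPieceFlat, hc x y hxy, ← sub_smul, norm_smul, mul_comm]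
    exact mul_le_mul (hca y) (hΘ x y) (norm_nonneg _) ha
  · obtain ⟨z, hz, hz0, -⟩ := exists_wall_between b w₀ hh hε hxy
    have key : ∀ w, ‖gridPieceFlat b w₀ h ε c w‖ ≤ a * (K * ‖w - z‖) := by
      intro w
      rw [gridPieceFlat, norm_smul, mul_comm]
      have := hΘ w z
      rw [hz0, sub_zero] at this
      exact mul_le_mul (hca w) this (norm_nonneg _) ha
    calc _ ≤ a * (K * ‖x - z‖) + a * (K * ‖y - z‖) :=
          (norm_sub_le _ _).trans (add_le_add (key x) (key y))
      _ = a * (K * ‖x - y‖) := by rw [← hz]; ring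

theorem norm_gridPieceSteep_le (hh : 0 < h) {c : X → X →L[ℝ] Y} {a : ℝ}
    (hca : ∀ w, ‖c w‖ ≤ a) {K : ℝ} (hDΘ : ∀ x, ‖wallCutoffDeriv b w₀ h ε x‖ ≤ K) (w : X) :
    ‖gridPieceSteep b w₀ h ε c w‖ ≤ K * (a * (Fintype.card ι * h)) := by
  rw [gridPieceSteep, ContinuousLinearMap.norm_smulRight_apply]
  exact mul_le_mul (hDΘ w)
    ((c w).le_of_opNorm_le_of_le (hca w) (norm_sub_gridCorner_le b w₀ h hh w)) (norm_nonneg _)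
    ((norm_nonneg _).trans (hDΘ w))

/-- Inside a cell, varying the derivative of the cutoff costs `K² · a · card ι · h` per unit length
and varying the affine factor costs `K · a`; together this is the amplitude times `K`. Different
cells are again joined through a wall point. -/
theorem norm_gridPieceSteep_sub_le (hh : 0 < h) (hε : 0 < ε) {c : X → X →L[ℝ] Y}
    (hc : ∀ w w', gridCorner b w₀ h w = gridCorner b w₀ h w' → c w = c w') {a : ℝ}
    (hca : ∀ w, ‖c w‖ ≤ a) {K : ℝ} (hDΘ : ∀ x, ‖wallCutoffDeriv b w₀ h ε x‖ ≤ K)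
    (hDΘ' : ∀ x y, ‖wallCutoffDeriv b w₀ h ε x - wallCutoffDeriv b w₀ h ε y‖ ≤
      K ^ 2 * ‖x - y‖) (x y : X) :
    ‖gridPieceSteep b w₀ h ε c x - gridPieceSteep b w₀ h ε c y‖ ≤
      a * (Fintype.card ι * (K * h) + 1) * min 2 (K * ‖x - y‖) := by
  have ha : 0 ≤ a := (norm_nonneg _).trans (hca 0)
  have hK : 0 ≤ K := (norm_nonneg _).trans (hDΘ 0)
  have hM : 0 ≤ a * (Fintype.card ι * (K * h) + 1) := by positivity
  rw [mul_min_of_nonneg _ _ hM]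
  refine le_min ?_ ?_
  · refine (norm_sub_le _ _).trans ?_
    have h1 := norm_gridPieceSteep_le b w₀ hh hca hDΘ x
    have h2 := norm_gridPieceSteep_le b w₀ hh hca hDΘ y
    nlinarith
  have hpt : ∀ w, ‖c w (w - gridCorner b w₀ h w)‖ ≤ a * (Fintype.card ι * h) := fun w =>
    (c w).le_of_opNorm_le_of_le (hca w) (norm_sub_gridCorner_le b w₀ h hh w)
  by_cases hxy : gridCorner b w₀ h x = gridCorner b w₀ h y
  · have h1 : gridPieceSteep b w₀ h ε c x - gridPieceSteep b w₀ h ε c y =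
        (wallCutoffDeriv b w₀ h ε x - wallCutoffDeriv b w₀ h ε y).smulRight
          (c x (x - gridCorner b w₀ h x)) +
        (wallCutoffDeriv b w₀ h ε y).smulRight (c x (x - y)) := by
      ext v
      simp only [gridPieceSteep, hc x y hxy, hxy, sub_apply,
        add_apply, ContinuousLinearMap.smulRight_apply, map_sub, smul_sub, sub_smul]
      abel
    rw [h1]
    refine (norm_add_le _ _).trans ?_
    rw [ContinuousLinearMap.norm_smulRight_apply, ContinuousLinearMap.norm_smulRight_apply]
    calc _ ≤ K ^ 2 * ‖x - y‖ * (a * (Fintype.card ι * h)) + K * (a * ‖x - y‖) := by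
          gcongr
          · exact hDΘ' x y
          · exact hpt x
          · exact hDΘ y
          · exact (c x).le_of_opNorm_le (hca x) _
      _ = _ := by ring
  · obtain ⟨z, hz, -, hz0⟩ := exists_wall_between b w₀ hh hε hxy
    have key : ∀ w, ‖gridPieceSteep b w₀ h ε c w‖ ≤
        a * (Fintype.card ι * (K * h) + 1) * (K * ‖w - z‖) := by
      intro w
      rw [gridPieceSteep, ContinuousLinearMap.norm_smulRight_apply]
      have := hDΘ' w z
      rw [hz0, sub_zero] at this
      calc _ ≤ K ^ 2 * ‖w - z‖ * (a * (Fintype.card ι * h)) :=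
            mul_le_mul this (hpt w) (norm_nonneg _) (by positivity)
        _ = a * (Fintype.card ι * (K * h)) * (K * ‖w - z‖) := by ring
        _ ≤ _ := by gcongr; linarith
    calc _ ≤ _ := (norm_sub_le _ _).trans (add_le_add (key x) (key y))
      _ = _ := by rw [← hz]; ring

end GridPiece

/-! ### The smoothed scheme and its limit -/

section Solution

variable {ι X Y : Type*} [Fintype ι] [NormedAddCommGroup X] [InnerProductSpace ℝ X]
  [NormedAddCommGroup Y] [NormedSpace ℝ Y]

/-- The nested grids of mesh `δ / 2 ^ j`. -/
noncomputable def dyadicCorner (b : OrthonormalBasis ι ℝ X) (w₀ : X) (δ : ℝ) (j : ℕ) : X → X :=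
  gridCorner b w₀ (δ * (1 / 2) ^ j)

/-- The half-open cube of side `δ` with corner `w₀`. -/
def gridCube (b : OrthonormalBasis ι ℝ X) (w₀ : X) (δ : ℝ) : Set X :=
  {w | ∀ i, inner ℝ (b i) (w - w₀) ∈ Ico 0 δ}

open Classical in
/-- The gradient corrections of the approximation scheme, restricted to a cube. -/
noncomputable def cellCorr (b : OrthonormalBasis ι ℝ X) (w₀ : X) (δ : ℝ) (G : X × Y → X →L[ℝ] Y)
    (j : ℕ) (w : X) : X →L[ℝ] Y :=
  if w ∈ gridCube b w₀ δ then stepCorr (dyadicCorner b w₀ δ) G j w else 0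

/-- The smooth corrections of the approximation scheme. -/
noncomputable def solPiece (b : OrthonormalBasis ι ℝ X) (w₀ : X) (δ e₀ θ : ℝ)
    (G : X × Y → X →L[ℝ] Y) (j : ℕ) : X → Y :=
  gridPiece b w₀ (δ * (1 / 2) ^ j) (e₀ * θ ^ j) (cellCorr b w₀ δ G j)

/-- The limit of the approximation scheme. -/
noncomputable def approxSol (b : OrthonormalBasis ι ℝ X) (w₀ : X) (δ e₀ θ : ℝ)
    (G : X × Y → X →L[ℝ] Y) (w : X) : Y :=
  ∑' j, solPiece b w₀ δ e₀ θ G j w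

/-- The flat part of the gradient of `approxSol`. -/
noncomputable def flatGrad (b : OrthonormalBasis ι ℝ X) (w₀ : X) (δ e₀ θ : ℝ)
    (G : X × Y → X →L[ℝ] Y) (w : X) : X →L[ℝ] Y :=
  ∑' j, gridPieceFlat b w₀ (δ * (1 / 2) ^ j) (e₀ * θ ^ j) (cellCorr b w₀ δ G j) w

/-- The steep part of the gradient of `approxSol`. -/
noncomputable def steepGrad (b : OrthonormalBasis ι ℝ X) (w₀ : X) (δ e₀ θ : ℝ)
    (G : X × Y → X →L[ℝ] Y) (w : X) : X →L[ℝ] Y :=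
  ∑' j, gridPieceSteep b w₀ (δ * (1 / 2) ^ j) (e₀ * θ ^ j) (cellCorr b w₀ δ G j) w

variable (b : OrthonormalBasis ι ℝ X) (w₀ : X) {δ e₀ θ : ℝ} {G : X × Y → X →L[ℝ] Y}

theorem dyadicCorner_idem (hδ : 0 < δ) (j : ℕ) (w : X) :
    dyadicCorner b w₀ δ j (dyadicCorner b w₀ δ j w) = dyadicCorner b w₀ δ j w :=
  gridCorner_idem b w₀ _ (by positivity) w

theorem dyadicCorner_refine (hδ : 0 < δ) (j : ℕ) (w w' : X)
    (h : dyadicCorner b w₀ δ (j + 1) w = dyadicCorner b w₀ δ (j + 1) w') :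
    dyadicCorner b w₀ δ j w = dyadicCorner b w₀ δ j w' := by
  refine gridCorner_eq_of_half b w₀ _ (by positivity) ?_
  rwa [show δ * (1 / 2) ^ j / 2 = δ * (1 / 2) ^ (j + 1) by rw [pow_succ]; ring]

theorem dyadicCorner_dist (hδ : 0 < δ) (j : ℕ) (w : X) :
    ‖w - dyadicCorner b w₀ δ j w‖ ≤ Fintype.card ι * δ * (1 / 2) ^ j := by
  rw [mul_assoc]
  exact norm_sub_gridCorner_le b w₀ _ (by positivity) w

theorem mem_gridCube_iff (hδ : 0 < δ) {w : X} :
    w ∈ gridCube b w₀ δ ↔ ∀ i, ⌊inner ℝ (b i) (w - w₀) / δ⌋ = 0 := by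
  simp only [gridCube, mem_ofPred_eq, Int.floor_eq_zero_iff, mem_Ico]
  refine forall_congr' fun i => ?_
  rw [div_lt_one hδ, le_div_iff₀ hδ, zero_mul]

theorem mem_gridCube_congr (hδ : 0 < δ) {j : ℕ} {w w' : X}
    (h : dyadicCorner b w₀ δ j w = dyadicCorner b w₀ δ j w') :
    w ∈ gridCube b w₀ δ ↔ w' ∈ gridCube b w₀ δ := by
  induction j with
  | zero =>
    have h0 : gridCorner b w₀ δ w = gridCorner b w₀ δ w' := by simpa [dyadicCorner] using h
    rw [gridCorner_eq_iff b w₀ δ hδ] at h0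
    rw [mem_gridCube_iff b w₀ hδ, mem_gridCube_iff b w₀ hδ]
    simp only [h0]
  | succ j ih => exact ih (dyadicCorner_refine b w₀ hδ j w w' h)

theorem norm_sub_le_of_mem_gridCube (hδ : 0 < δ) {w : X} (hw : w ∈ gridCube b w₀ δ) :
    ‖w - w₀‖ ≤ Fintype.card ι * δ := by
  have h := norm_sub_gridCorner_le b w₀ δ hδ w
  have h0 : gridCorner b w₀ δ w = w₀ := by
    rw [mem_gridCube_iff b w₀ hδ] at hw
    simp [gridCorner, hw]
  rwa [h0] at h

/-- The cube is a union of cells of every level, so truncating to it keeps the corrections constant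
on cells. -/
theorem cellCorr_congr (hδ : 0 < δ) (j : ℕ) (w w' : X)
    (h : gridCorner b w₀ (δ * (1 / 2) ^ j) w = gridCorner b w₀ (δ * (1 / 2) ^ j) w') :
    cellCorr b w₀ δ G j w = cellCorr b w₀ δ G j w' := by
  have h' : dyadicCorner b w₀ δ j w = dyadicCorner b w₀ δ j w' := h
  rw [cellCorr, cellCorr, stepCorr_congr (dyadicCorner_refine b w₀ hδ) h']
  have hiff := mem_gridCube_congr b w₀ hδ h'
  by_cases hw : w ∈ gridCube b w₀ δ
  · rw [if_pos hw, if_pos (hiff.1 hw)]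
  · rw [if_neg hw, if_neg (mt hiff.2 hw)]

theorem cellCorr_of_notMem {j : ℕ} {w : X} (hw : w ∉ gridCube b w₀ δ) :
    cellCorr b w₀ δ G j w = 0 := if_neg hw

theorem norm_cellCorr_le (hδ : 0 < δ) (hδ1 : δ ≤ 1) {B : ℝ} (hB : ∀ z, ‖G z‖ ≤ B) {L : ℝ≥0}
    (hL : LipschitzWith L G) (j : ℕ) (w : X) :
    ‖cellCorr b w₀ δ G j w‖ ≤ (B + 2 * L * (1 + B) * Fintype.card ι) * (1 / 2) ^ j := by
  have hB0 : 0 ≤ B := (norm_nonneg _).trans (hB 0)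
  unfold cellCorr
  split_ifs with hw
  · refine (norm_stepCorr_le (dyadicCorner_idem b w₀ hδ) (dyadicCorner_refine b w₀ hδ)
      (dyadicCorner_dist b w₀ hδ) hB hL j w).trans ?_
    gcongr
    exact mul_le_of_le_one_right (Nat.cast_nonneg _) hδ1
  · rw [norm_zero]; positivity

/-- The bounds on the pieces of the scheme, with constants independent of the step. -/
theorem exists_piece_bounds [Nonempty ι] (hδ : 0 < δ) (hδ1 : δ ≤ 1) (he₀ : 0 < e₀) (he₁ : e₀ ≤ 1)
    (hθ0 : 0 < θ) (hθ1 : θ ≤ 1) {B : ℝ} (hB : ∀ z, ‖G z‖ ≤ B) {L : ℝ≥0} (hL : LipschitzWith L G) :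
    ∃ C g₀ : ℝ, 0 < C ∧ 0 < g₀ ∧
      (∀ j w, ‖gridPieceFlat b w₀ (δ * (1 / 2) ^ j) (e₀ * θ ^ j) (cellCorr b w₀ δ G j) w‖ ≤
        C * (1 / 2) ^ j) ∧
      (∀ j w, ‖gridPieceSteep b w₀ (δ * (1 / 2) ^ j) (e₀ * θ ^ j) (cellCorr b w₀ δ G j) w‖ ≤
        C * (1 / (2 * θ)) ^ j) ∧
      (∀ j x y, ‖gridPieceFlat b w₀ (δ * (1 / 2) ^ j) (e₀ * θ ^ j) (cellCorr b w₀ δ G j) x -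
        gridPieceFlat b w₀ (δ * (1 / 2) ^ j) (e₀ * θ ^ j) (cellCorr b w₀ δ G j) y‖ ≤
          C * (1 / 2) ^ j * min 2 (‖x - y‖ / (g₀ * (θ / 2) ^ j))) ∧
      (∀ j x y, ‖gridPieceSteep b w₀ (δ * (1 / 2) ^ j) (e₀ * θ ^ j) (cellCorr b w₀ δ G j) x -
        gridPieceSteep b w₀ (δ * (1 / 2) ^ j) (e₀ * θ ^ j) (cellCorr b w₀ δ G j) y‖ ≤
          C * (1 / (2 * θ)) ^ j * min 2 (‖x - y‖ / (g₀ * (θ / 2) ^ j))) := by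
  obtain ⟨Λ, hΛ1, hΛ⟩ := exists_wallCutoff_bounds b w₀
  have hB0 : 0 ≤ B := (norm_nonneg _).trans (hB 0)
  set k : ℝ := (Fintype.card ι : ℝ) with hk
  have hk0 : 0 ≤ k := Nat.cast_nonneg _
  set C₁ : ℝ := B + 2 * L * (1 + B) * k with hC₁
  have hC₁0 : 0 ≤ C₁ := by positivity
  have hC₂ : C₁ ≤ (C₁ + 1) * (k * Λ + 1) / e₀ := by
    rw [le_div_iff₀ he₀]
    have : C₁ * e₀ ≤ C₁ * 1 := by gcongr
    have : 0 ≤ (C₁ + 1) * (k * Λ) := by positivity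
    nlinarith
  have hε : ∀ j : ℕ, e₀ * θ ^ j ≤ 1 := fun j => by
    have : θ ^ j ≤ 1 := pow_le_one₀ hθ0.le hθ1
    nlinarith [pow_pos hθ0 j]
  have hbd := fun j : ℕ => hΛ (δ * (1 / 2) ^ j) (e₀ * θ ^ j) (by positivity) (by positivity) (hε j)
  have hc := cellCorr_congr (G := G) b w₀ hδ
  have hca := norm_cellCorr_le b w₀ hδ hδ1 hB hL
  rw [← hk, ← hC₁] at hca
  -- The cutoff of level `j` varies at scale `g₀ (θ / 2) ^ j` with `g₀ = e₀ δ / Λ`. Multiplying its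
  -- slope by the mesh leaves `Λ / (e₀ θ ^ j)`, so the steep amplitude is of order `(1/2) ^ j / θ ^
  -- j = (1 / (2θ)) ^ j`.
  have hKeq : ∀ j : ℕ, Λ / (e₀ * θ ^ j * (δ * (1 / 2) ^ j)) =
      1 / ((e₀ * δ / Λ) * (θ / 2) ^ j) := by
    intro j
    rw [div_pow, div_pow, one_pow]
    field_simp
  have hsteep : ∀ j : ℕ, C₁ * (1 / 2) ^ j *
      (k * (Λ / (e₀ * θ ^ j * (δ * (1 / 2) ^ j)) * (δ * (1 / 2) ^ j)) + 1) ≤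
      (C₁ + 1) * (k * Λ + 1) / e₀ * (1 / (2 * θ)) ^ j := by
    intro j
    have h1 : Λ / (e₀ * θ ^ j * (δ * (1 / 2) ^ j)) * (δ * (1 / 2) ^ j) = Λ / (e₀ * θ ^ j) := by
      field_simp
    have h2 : (1 / (2 * θ)) ^ j = (1 / 2) ^ j / θ ^ j := by
      rw [← div_pow]; congr 1; field_simp
    rw [h1, h2]
    have h3 : k * (Λ / (e₀ * θ ^ j)) + 1 ≤ (k * Λ + 1) / (e₀ * θ ^ j) := by
      rw [add_div, mul_div_assoc]
      gcongr
      exact (one_le_div (by positivity)).2 (hε j)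
    calc _ ≤ (C₁ + 1) * (1 / 2) ^ j * ((k * Λ + 1) / (e₀ * θ ^ j)) := by
          gcongr; linarith
      _ = _ := by field_simp
  refine ⟨(C₁ + 1) * (k * Λ + 1) / e₀, e₀ * δ / Λ, by positivity, by positivity, ?_, ?_, ?_, ?_⟩
  · intro j w
    refine (norm_gridPieceFlat_le b w₀ (hca j) w).trans ?_
    gcongr
  · intro j w
    refine le_trans ?_ (hsteep j)
    refine (norm_gridPieceSteep_le b w₀ (by positivity) (hca j) (hbd j).2.1 w).trans ?_
    rw [← hk]
    have : 0 ≤ C₁ * (1 / 2) ^ j := by positivity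
    nlinarith
  · intro j x y
    refine (norm_gridPieceFlat_sub_le b w₀ (by positivity) (by positivity) (hc j) (hca j)
      (hbd j).1 x y).trans ?_
    rw [hKeq, one_div_mul_eq_div]
    gcongr
  · intro j x y
    refine (norm_gridPieceSteep_sub_le b w₀ (by positivity) (by positivity) (hc j) (hca j)
      (hbd j).2.1 (hbd j).2.2 x y).trans ?_
    rw [← hk]
    refine mul_le_mul (hsteep j) ?_ (by positivity) (by positivity)
    rw [hKeq, one_div_mul_eq_div]

theorem summable_solPiece_bound (hδ : 0 < δ) (hδ1 : δ ≤ 1) {B : ℝ} (hB : ∀ z, ‖G z‖ ≤ B)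
    {L : ℝ≥0} (hL : LipschitzWith L G) (j : ℕ) (w : X) :
    ‖solPiece b w₀ δ e₀ θ G j w‖ ≤
      (B + 2 * L * (1 + B) * Fintype.card ι) * (Fintype.card ι * δ) * (1 / 2) ^ j := by
  have hB0 : 0 ≤ B := (norm_nonneg _).trans (hB 0)
  refine (norm_gridPiece_le b w₀ (by positivity) (norm_cellCorr_le b w₀ hδ hδ1 hB hL j) w).trans ?_
  have h1 : ((1 / 2 : ℝ)) ^ j ≤ 1 := pow_le_one₀ (by norm_num) (by norm_num)
  calc _ = (B + 2 * L * (1 + B) * Fintype.card ι) * (Fintype.card ι * δ) * (1 / 2) ^ j *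
        (1 / 2) ^ j := by ring
    _ ≤ _ := mul_le_of_le_one_right (by positivity) h1

theorem norm_approxSol_le (hδ : 0 < δ) (hδ1 : δ ≤ 1) {B : ℝ} (hB : ∀ z, ‖G z‖ ≤ B)
    {L : ℝ≥0} (hL : LipschitzWith L G) (w : X) :
    ‖approxSol b w₀ δ e₀ θ G w‖ ≤
      (B + 2 * L * (1 + B) * Fintype.card ι) * (Fintype.card ι * δ) * 2 := by
  refine tsum_of_norm_bounded ?_ (summable_solPiece_bound b w₀ hδ hδ1 hB hL · w)
  exact hasSum_geometric_two.mul_left _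

theorem approxSol_of_notMem {w : X} (hw : w ∉ gridCube b w₀ δ) :
    approxSol b w₀ δ e₀ θ G w = 0 := by
  simp [approxSol, solPiece, gridPiece, cellCorr_of_notMem b w₀ hw]

section Complete

variable [CompleteSpace Y] [Nonempty ι]

theorem hasSum_flatGrad (hδ : 0 < δ) (hδ1 : δ ≤ 1) (he₀ : 0 < e₀) (he₁ : e₀ ≤ 1)
    (hθ0 : 1 / 2 < θ) (hθ1 : θ ≤ 1) {B : ℝ} (hB : ∀ z, ‖G z‖ ≤ B) {L : ℝ≥0}
    (hL : LipschitzWith L G) (w : X) :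
    HasSum (fun j => gridPieceFlat b w₀ (δ * (1 / 2) ^ j) (e₀ * θ ^ j) (cellCorr b w₀ δ G j) w)
      (flatGrad b w₀ δ e₀ θ G w) := by
  obtain ⟨C, g₀, -, -, h1, -⟩ :=
    exists_piece_bounds b w₀ hδ hδ1 he₀ he₁ (by linarith) hθ1 hB hL
  exact (Summable.of_norm_bounded (summable_geometric_two.mul_left C) (h1 · w)).hasSum

/-- The amplitudes `(1 / (2θ)) ^ j` are summable because `θ > 1/2`: the walls may not shrink as fast
as the mesh. -/
theorem hasSum_steepGrad (hδ : 0 < δ) (hδ1 : δ ≤ 1) (he₀ : 0 < e₀) (he₁ : e₀ ≤ 1)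
    (hθ0 : 1 / 2 < θ) (hθ1 : θ ≤ 1) {B : ℝ} (hB : ∀ z, ‖G z‖ ≤ B) {L : ℝ≥0}
    (hL : LipschitzWith L G) (w : X) :
    HasSum (fun j => gridPieceSteep b w₀ (δ * (1 / 2) ^ j) (e₀ * θ ^ j) (cellCorr b w₀ δ G j) w)
      (steepGrad b w₀ δ e₀ θ G w) := by
  obtain ⟨C, g₀, -, -, -, h1, -⟩ :=
    exists_piece_bounds b w₀ hδ hδ1 he₀ he₁ (by linarith) hθ1 hB hL
  have hs : Summable fun j : ℕ => C * (1 / (2 * θ)) ^ j :=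
    (summable_geometric_of_lt_one (by positivity)
      ((div_lt_one (by linarith)).2 (by linarith))).mul_left C
  exact (Summable.of_norm_bounded hs (h1 · w)).hasSum

theorem continuous_of_min_bound {X F : Type*} [NormedAddCommGroup X] [NormedAddCommGroup F]
    {f : X → F} {M g : ℝ} (hM : 0 ≤ M)
    (h : ∀ x y, ‖f x - f y‖ ≤ M * min 2 (‖x - y‖ / g)) : Continuous f := by
  refine (LipschitzWith.of_dist_le_mul (K := (M / |g|).toNNReal) fun x y => ?_).continuous
  rw [dist_eq_norm, dist_eq_norm, Real.coe_toNNReal _ (by positivity)]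
  refine (h x y).trans ?_
  have h1 : ‖x - y‖ / g ≤ ‖x - y‖ / |g| := by
    refine (le_abs_self _).trans (le_of_eq ?_)
    rw [abs_div, abs_norm]
  calc M * min 2 (‖x - y‖ / g) ≤ M * (‖x - y‖ / |g|) := by
        gcongr; exact (min_le_right _ _).trans h1
    _ = _ := by ring

theorem continuous_flatGrad (hδ : 0 < δ) (hδ1 : δ ≤ 1) (he₀ : 0 < e₀) (he₁ : e₀ ≤ 1)
    (hθ0 : 1 / 2 < θ) (hθ1 : θ ≤ 1) {B : ℝ} (hB : ∀ z, ‖G z‖ ≤ B) {L : ℝ≥0}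
    (hL : LipschitzWith L G) : Continuous (flatGrad b w₀ δ e₀ θ G) := by
  obtain ⟨C, g₀, hC, hg₀, h1, -, h3, -⟩ :=
    exists_piece_bounds b w₀ hδ hδ1 he₀ he₁ (by linarith) hθ1 hB hL
  exact continuous_tsum (fun j => continuous_of_min_bound (by positivity) (h3 j))
    (summable_geometric_two.mul_left C) h1

theorem continuous_steepGrad (hδ : 0 < δ) (hδ1 : δ ≤ 1) (he₀ : 0 < e₀) (he₁ : e₀ ≤ 1)
    (hθ0 : 1 / 2 < θ) (hθ1 : θ ≤ 1) {B : ℝ} (hB : ∀ z, ‖G z‖ ≤ B) {L : ℝ≥0}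
    (hL : LipschitzWith L G) : Continuous (steepGrad b w₀ δ e₀ θ G) := by
  obtain ⟨C, g₀, hC, hg₀, -, h1, -, h3⟩ :=
    exists_piece_bounds b w₀ hδ hδ1 he₀ he₁ (by linarith) hθ1 hB hL
  have hs : Summable fun j : ℕ => C * (1 / (2 * θ)) ^ j :=
    (summable_geometric_of_lt_one (by positivity)
      ((div_lt_one (by linarith)).2 (by linarith))).mul_left C
  exact continuous_tsum (fun j => continuous_of_min_bound (by positivity) (h3 j)) hs h1

theorem hasFDerivAt_approxSol (hδ : 0 < δ) (hδ1 : δ ≤ 1) (he₀ : 0 < e₀) (he₁ : e₀ ≤ 1)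
    (hθ0 : 1 / 2 < θ) (hθ1 : θ ≤ 1) {B : ℝ} (hB : ∀ z, ‖G z‖ ≤ B) {L : ℝ≥0}
    (hL : LipschitzWith L G) (w : X) :
    HasFDerivAt (approxSol b w₀ δ e₀ θ G)
      (flatGrad b w₀ δ e₀ θ G w + steepGrad b w₀ δ e₀ θ G w) w := by
  obtain ⟨C, g₀, hC, hg₀, h1, h2, -, -⟩ :=
    exists_piece_bounds b w₀ hδ hδ1 he₀ he₁ (by linarith) hθ1 hB hL
  have hs : Summable fun j : ℕ => C * (1 / (2 * θ)) ^ j :=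
    (summable_geometric_of_lt_one (by positivity)
      ((div_lt_one (by linarith)).2 (by linarith))).mul_left C
  have hsum := (hasSum_flatGrad b w₀ hδ hδ1 he₀ he₁ hθ0 hθ1 hB hL w).add
    (hasSum_steepGrad b w₀ hδ hδ1 he₀ he₁ hθ0 hθ1 hB hL w)
  rw [← hsum.tsum_eq]
  refine hasFDerivAt_tsum ((summable_geometric_two.mul_left C).add hs)
    (fun j x => hasFDerivAt_gridPiece b w₀ (by positivity) (by positivity)
      (cellCorr_congr b w₀ hδ j) x)
    (fun j x => (norm_add_le _ _).trans (add_le_add (h1 j x) (h2 j x))) (x₀ := w) ?_ w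
  exact Summable.of_norm_bounded (summable_geometric_two.mul_left _)
    (summable_solPiece_bound b w₀ hδ hδ1 hB hL · w)

theorem contDiff_approxSol (hδ : 0 < δ) (hδ1 : δ ≤ 1) (he₀ : 0 < e₀) (he₁ : e₀ ≤ 1)
    (hθ0 : 1 / 2 < θ) (hθ1 : θ ≤ 1) {B : ℝ} (hB : ∀ z, ‖G z‖ ≤ B) {L : ℝ≥0}
    (hL : LipschitzWith L G) : ContDiff ℝ 1 (approxSol b w₀ δ e₀ θ G) := by
  have hd := hasFDerivAt_approxSol b w₀ hδ hδ1 he₀ he₁ hθ0 hθ1 hB hL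
  refine contDiff_one_iff_fderiv.2 ⟨fun w => (hd w).differentiableAt, ?_⟩
  have : fderiv ℝ (approxSol b w₀ δ e₀ θ G) =
      fun w => flatGrad b w₀ δ e₀ θ G w + steepGrad b w₀ δ e₀ θ G w :=
    funext fun w => (hd w).fderiv
  rw [this]
  exact (continuous_flatGrad b w₀ hδ hδ1 he₀ he₁ hθ0 hθ1 hB hL).add
    (continuous_steepGrad b w₀ hδ hδ1 he₀ he₁ hθ0 hθ1 hB hL)

/-- On the points of the cube that stay away from all the walls, the limit of the scheme solves
`Du = G(w, u)`. -/
theorem fderiv_approxSol_eq (hδ : 0 < δ) (hδ1 : δ ≤ 1) (he₀ : 0 < e₀) (he₁ : e₀ ≤ 1)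
    (hθ0 : 1 / 2 < θ) (hθ1 : θ ≤ 1) {B : ℝ} (hB : ∀ z, ‖G z‖ ≤ B) {L : ℝ≥0}
    (hL : LipschitzWith L G) {w : X} (hw : w ∈ gridCube b w₀ δ)
    (hgood : ∀ (j : ℕ) i, 2 * (e₀ * θ ^ j) ≤
      |Real.sin (Real.pi * (inner ℝ (b i) (w - w₀) / (δ * (1 / 2) ^ j)))|) :
    fderiv ℝ (approxSol b w₀ δ e₀ θ G) w = G (w, approxSol b w₀ δ e₀ θ G w) := by
  have hone := fun j : ℕ => wallCutoff_eq_one b w₀ (δ * (1 / 2) ^ j) (e₀ * θ ^ j)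
    (by positivity) (hgood j)
  have hflat := hasSum_flatGrad b w₀ hδ hδ1 he₀ he₁ hθ0 hθ1 hB hL w
  -- At such a point every cutoff is `1` with zero derivative: the steep part drops out and the
  -- other two series are those of the unsmoothed scheme.
  have hsteep : steepGrad b w₀ δ e₀ θ G w = 0 := by
    simp only [steepGrad, gridPieceSteep, (hone _).2]
    simp
  rw [(hasFDerivAt_approxSol b w₀ hδ hδ1 he₀ he₁ hθ0 hθ1 hB hL w).fderiv, hsteep, add_zero]
  refine eq_of_hasSum_stepCorr (p := dyadicCorner b w₀ δ) (dyadicCorner_idem b w₀ hδ)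
    (dyadicCorner_refine b w₀ hδ) (dyadicCorner_dist b w₀ hδ) hB hL.continuous ?_ ?_
  · have hs : Summable fun j => solPiece b w₀ δ e₀ θ G j w :=
      Summable.of_norm_bounded (summable_geometric_two.mul_left _)
        (summable_solPiece_bound b w₀ hδ hδ1 hB hL · w)
    refine hs.hasSum.congr_fun ?_
    intro j
    simp only [solPiece, gridPiece, (hone _).1, one_smul, cellCorr, if_pos hw]
    rfl
  · refine hflat.congr_fun ?_
    intro j
    simp only [gridPieceFlat, (hone _).1, one_smul, cellCorr, if_pos hw]

end Complete

end Solution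

/-! ### Fat Cantor sets on the line -/

section Walls

theorem lintegral_sum_strips {h r : ℝ} (N : ℕ) {H : ℝ → ℝ≥0∞} (hH : Measurable H) :
    ∫⁻ t, ∑ m ∈ Finset.range (N + 1), (Ioo (-r) r).indicator H (t - m * h) =
      (N + 1) * ∫⁻ t in Ioo (-r) r, H t := by
  have hm : Measurable ((Ioo (-r) r).indicator H) := hH.indicator measurableSet_Ioo
  rw [lintegral_finsetSum (f := fun m t => (Ioo (-r) r).indicator H (t - (m : ℕ) * h)) _
    fun m _ => hm.comp (measurable_id.sub_const ((m : ℝ) * h))]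
  simp_rw [lintegral_sub_right_eq_self ((Ioo (-r) r).indicator H)]
  rw [lintegral_indicator measurableSet_Ioo]
  simp

/-- Only walls centred at `0, 1, …, 2 ^ j` times the mesh reach `[0, δ)`, both end faces included;
hence the count `2 ^ j + 1` below. -/
theorem exists_nat_of_abs_sub_lt {δ r : ℝ} (hδ : 0 < δ) {j : ℕ} (hr : r ≤ δ * (1 / 2) ^ j) {t : ℝ}
    (ht : t ∈ Ico 0 δ) {m : ℤ} (hm : |t - m * (δ * (1 / 2) ^ j)| < r) :
    ∃ m' ∈ Finset.range (2 ^ j + 1), ((m' : ℕ) : ℝ) = m := by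
  have hh : 0 < δ * (1 / 2 : ℝ) ^ j := by positivity
  rw [abs_lt] at hm
  have h2 : (2 : ℝ) ^ j * (1 / 2) ^ j = 1 := by rw [← mul_pow]; norm_num
  have hlo : -1 < (m : ℝ) := by
    by_contra hcon
    push Not at hcon
    nlinarith [ht.1, mul_le_mul_of_nonneg_right hcon hh.le]
  have hhi : (m : ℝ) < 2 ^ j + 1 := by
    by_contra hcon
    push Not at hcon
    have := mul_le_mul_of_nonneg_right hcon hh.le
    have h3 : ((2 : ℝ) ^ j + 1) * (δ * (1 / 2) ^ j) = δ + δ * (1 / 2) ^ j := by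
      rw [add_mul, one_mul, mul_left_comm, h2, mul_one]
    linarith [ht.2]
  have hlo' : -1 < m := by exact_mod_cast hlo
  have hhi' : m < 2 ^ j + 1 := by exact_mod_cast hhi
  lift m to ℕ using by omega
  refine ⟨m, Finset.mem_range.2 ?_, by simp⟩
  exact_mod_cast hhi'

/-- Jordan's inequality `|sin x| ≥ (2/π) |x|`, applied after subtracting the nearest integer. It
translates distance from the walls into the sine condition of the cutoffs. -/
theorem two_mul_le_abs_sin {ε h t : ℝ} (hh : 0 < h) (ht : ∀ m : ℤ, ε * h ≤ |t - m * h|) :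
    2 * ε ≤ |Real.sin (Real.pi * (t / h))| := by
  set z := t / h with hz
  have h1 : |Real.sin (Real.pi * z)| = |Real.sin (Real.pi * (z - round z))| := by
    rw [mul_sub, mul_comm Real.pi (round z : ℝ), Real.sin_sub_int_mul_pi, abs_mul,
      abs_zpow, abs_neg, abs_one, one_zpow, one_mul]
  have h2 : |Real.pi * (z - round z)| ≤ Real.pi / 2 := by
    rw [abs_mul, abs_of_pos Real.pi_pos]
    have := abs_sub_round z
    nlinarith [Real.pi_pos]
  have h3 : ε ≤ |z - round z| := by
    have h4 := ht (round z)
    have h5 : t - round z * h = (z - round z) * h := by rw [hz]; field_simp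
    rw [h5, abs_mul, abs_of_pos hh] at h4
    exact le_of_mul_le_mul_right h4 hh
  rw [h1]
  refine le_trans ?_ (Real.mul_abs_le_abs_sin h2)
  rw [abs_mul, abs_of_pos Real.pi_pos, ← mul_assoc, div_mul_cancel₀ _ Real.pi_pos.ne']
  linarith

/-- The measure of the `j`-th system of walls in an interval of length `δ`. -/
theorem volume_walls_le {δ e₀ θ : ℝ} (hδ : 0 < δ) (he₀ : 0 < e₀) (he₁ : e₀ ≤ 1) (hθ0 : 0 < θ)
    (hθ1 : θ ≤ 1) (j : ℕ) :
    volume (Ico 0 δ ∩ {t | ∃ m : ℤ, |t - m * (δ * (1 / 2) ^ j)| <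
      e₀ * θ ^ j * (δ * (1 / 2) ^ j)}) ≤ ENNReal.ofReal (4 * e₀ * δ * θ ^ j) := by
  set h := δ * (1 / 2) ^ j with hh
  set r := e₀ * θ ^ j * h with hr
  have hh0 : 0 < h := by positivity
  have hrh : r ≤ h := by
    have : θ ^ j ≤ 1 := pow_le_one₀ hθ0.le hθ1
    have : e₀ * θ ^ j ≤ 1 := by nlinarith [pow_pos hθ0 j]
    nlinarith
  set A := Ico 0 δ ∩ {t | ∃ m : ℤ, |t - m * h| < r} with hA
  have hle : ∀ t, A.indicator 1 t ≤
      ∑ m ∈ Finset.range (2 ^ j + 1), (Ioo (-r) r).indicator (1 : ℝ → ℝ≥0∞) (t - m * h) := by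
    intro t
    by_cases ht : t ∈ A
    · obtain ⟨ht1, m, hm⟩ := ht
      obtain ⟨m', hm', hmm⟩ := exists_nat_of_abs_sub_lt hδ hrh ht1 hm
      refine (indicator_le_self' (fun _ _ => zero_le_one) t).trans ?_
      refine le_trans (le_of_eq ?_) (Finset.single_le_sum (f := fun m : ℕ =>
        (Ioo (-r) r).indicator (1 : ℝ → ℝ≥0∞) (t - m * h)) (fun _ _ => zero_le) hm')
      rw [indicator_of_mem, Pi.one_apply]
      rw [hmm, mem_Ioo, ← abs_lt]; exact hm
    · rw [indicator_of_notMem ht]; exact zero_le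
  calc volume A ≤ ∫⁻ t, A.indicator 1 t := by
        have hopen : IsOpen {t : ℝ | ∃ m : ℤ, |t - m * h| < r} := by
          simp only [ofPred_exists]
          exact isOpen_iUnion fun m => isOpen_lt (by fun_prop) continuous_const
        exact (lintegral_indicator_one (measurableSet_Ico.inter hopen.measurableSet)).ge
    _ ≤ _ := lintegral_mono hle
    _ = ((2 ^ j : ℕ) + 1) * ENNReal.ofReal (2 * r) := by
        rw [lintegral_sum_strips _ measurable_one]
        simp [two_mul]
    _ = ENNReal.ofReal ((2 ^ j + 1) * (2 * r)) := by
        rw [ENNReal.ofReal_mul (p := 2 ^ j + 1) (by positivity),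
          ENNReal.ofReal_add (by positivity) (by norm_num)]
        simp [ENNReal.ofReal_pow]
    _ ≤ _ := by
        refine ENNReal.ofReal_le_ofReal ?_
        have h1 : (1 : ℝ) ≤ 2 ^ j := one_le_pow₀ (by norm_num)
        have h2 : (2 : ℝ) ^ j * (1 / 2) ^ j = 1 := by rw [← mul_pow]; norm_num
        have hr0 : 0 < r := by positivity
        calc ((2 : ℝ) ^ j + 1) * (2 * r) ≤ (2 ^ j + 2 ^ j) * (2 * r) := by gcongr
          _ = 4 * e₀ * δ * θ ^ j * (2 ^ j * (1 / 2) ^ j) := by rw [hr, hh]; ring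
          _ = _ := by rw [h2, mul_one]

/-- A fat Cantor set: the points of `[0, δ)` outside all the walls. -/
def fatCantor (δ e₀ θ : ℝ) : Set ℝ :=
  {t | t ∈ Icc 0 δ ∧ ∀ (j : ℕ) (m : ℤ),
    e₀ * θ ^ j * (δ * (1 / 2) ^ j) ≤ |t - m * (δ * (1 / 2) ^ j)|}

theorem isClosed_fatCantor (δ e₀ θ : ℝ) : IsClosed (fatCantor δ e₀ θ) := by
  have : fatCantor δ e₀ θ = Icc 0 δ ∩ ⋂ (j : ℕ) (m : ℤ),
      {t | e₀ * θ ^ j * (δ * (1 / 2) ^ j) ≤ |t - m * (δ * (1 / 2) ^ j)|} := by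
    ext t; simp [fatCantor]
  rw [this]
  refine isClosed_Icc.inter (isClosed_iInter fun j => isClosed_iInter fun m => ?_)
  exact isClosed_le continuous_const (by fun_prop)

/-- The walls of level `0` with `m = 0` and `m = 1` sit at the endpoints of the interval. The
resulting margin later separates `K` from the complement of the cube. -/
theorem fatCantor_subset_Icc {δ e₀ θ : ℝ} :
    fatCantor δ e₀ θ ⊆ Icc (e₀ * δ) (δ - e₀ * δ) := by
  rintro t ⟨ht, hj⟩
  have h0 := hj 0 0
  have h1 := hj 0 1
  simp only [pow_zero, mul_one, Int.cast_zero, zero_mul, sub_zero, Int.cast_one, one_mul] at h0 h1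
  rw [abs_of_nonneg ht.1] at h0
  rw [abs_of_nonpos (by linarith [ht.2])] at h1
  exact ⟨h0, by linarith⟩

theorem fatCantor_subset_Ico {δ e₀ θ : ℝ} (hδ : 0 < δ) (he₀ : 0 < e₀) :
    fatCantor δ e₀ θ ⊆ Ico 0 δ := fun t ht => by
  have := fatCantor_subset_Icc ht
  have h2 : 0 < e₀ * δ := by positivity
  exact ⟨by linarith [this.1], by linarith [this.2]⟩

theorem volume_fatCantor_pos {δ e₀ θ : ℝ} (hδ : 0 < δ) (he₀ : 0 < e₀) (hθ0 : 0 < θ)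
    (hθ1 : θ < 1) (heθ : 4 * e₀ < 1 - θ) : 0 < volume (fatCantor δ e₀ θ) := by
  by_contra hcon
  have h0 : volume (fatCantor δ e₀ θ) = 0 := by simpa using hcon
  have hsub : Ico 0 δ ⊆ fatCantor δ e₀ θ ∪ ⋃ j : ℕ, (Ico 0 δ ∩ {t | ∃ m : ℤ,
      |t - m * (δ * (1 / 2) ^ j)| < e₀ * θ ^ j * (δ * (1 / 2) ^ j)}) := by
    intro t ht
    by_cases htC : t ∈ fatCantor δ e₀ θ
    · exact Or.inl htC
    · right
      have : ¬ ∀ (j : ℕ) (m : ℤ),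
          e₀ * θ ^ j * (δ * (1 / 2) ^ j) ≤ |t - m * (δ * (1 / 2) ^ j)| :=
        fun h => htC ⟨Ico_subset_Icc_self ht, h⟩
      push Not at this
      obtain ⟨j, m, hm⟩ := this
      exact mem_iUnion.2 ⟨j, ht, m, hm⟩
  -- If the Cantor set were null, the walls alone would carry the full length `δ`; but their total
  -- length is at most `4 e₀ δ / (1 - θ) < δ`.
  have h1 : volume (Ico 0 δ) ≤ ENNReal.ofReal (4 * e₀ * δ * (1 - θ)⁻¹) := by
    refine (measure_mono hsub).trans ((measure_union_le _ _).trans ?_)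
    rw [h0, zero_add]
    refine (measure_iUnion_le _).trans ?_
    refine (ENNReal.tsum_le_tsum fun j => volume_walls_le hδ he₀ (by linarith) hθ0 hθ1.le j).trans ?_
    rw [← ENNReal.ofReal_tsum_of_nonneg (fun j => by positivity)
      ((summable_geometric_of_lt_one hθ0.le hθ1).mul_left _), tsum_mul_left,
      tsum_geometric_of_lt_one hθ0.le hθ1]
  rw [Real.volume_Ico, sub_zero, ENNReal.ofReal_le_ofReal_iff (by
    have : 0 < 1 - θ := by linarith
    positivity), ← div_eq_mul_inv,
    le_div_iff₀ (by linarith)] at h1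
  nlinarith

/-- The quantity `r - |t|` is the distance to the ends of the gap; its power `-s` is integrable
because `s < 1`. -/
theorem setLIntegral_gap_le {s r : ℝ} (hs1 : s < 1) (hr : 0 < r) :
    ∫⁻ t in Ioo (-r) r, ENNReal.ofReal (r - |t|) ^ (-s) ≤
      ENNReal.ofReal (2 / (1 - s) * r ^ (1 - s)) := by
  set g : ℝ → ℝ≥0∞ := (Ioc 0 r).indicator fun y => ENNReal.ofReal y ^ (-s) with hg
  have hgm : Measurable g := (by fun_prop : Measurable fun y : ℝ =>
    ENNReal.ofReal y ^ (-s)).indicator measurableSet_Ioc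
  have hgint : ∫⁻ y, g y = ENNReal.ofReal (1 / (1 - s) * r ^ (1 - s)) := by
    rw [hg, lintegral_indicator measurableSet_Ioc]
    have h1 : ∫⁻ y in Ioc 0 r, ENNReal.ofReal y ^ (-s) =
        ∫⁻ y in Ioc 0 r, ENNReal.ofReal (y ^ (-s)) :=
      setLIntegral_congr_fun measurableSet_Ioc fun y hy => ENNReal.ofReal_rpow_of_pos hy.1
    have hint : IntegrableOn (fun y : ℝ => y ^ (-s)) (Ioc 0 r) :=
      (intervalIntegrable_iff_integrableOn_Ioc_of_le hr.le).1
        (intervalIntegral.intervalIntegrable_rpow' (by linarith))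
    rw [h1, ← ofReal_integral_eq_lintegral_ofReal hint
      ((ae_restrict_iff' measurableSet_Ioc).2 (Eventually.of_forall fun y hy =>
        Real.rpow_nonneg hy.1.le _)), ← intervalIntegral.integral_of_le hr.le,
      integral_rpow (Or.inl (by linarith)), Real.zero_rpow (by linarith)]
    congr 1
    rw [show -s + 1 = 1 - s by ring]
    ring
  calc _ ≤ ∫⁻ t in Ioo (-r) r, (g (r - t) + g (r + t)) := by
        refine setLIntegral_mono' measurableSet_Ioo fun t ht => ?_
        rcases le_total 0 t with h0 | h0
        · refine le_trans (le_of_eq ?_) le_self_add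
          rw [hg, indicator_of_mem (by constructor <;> linarith [ht.2]), abs_of_nonneg h0]
        · refine le_trans (le_of_eq ?_) le_add_self
          rw [hg, indicator_of_mem (by constructor <;> linarith [ht.1]), abs_of_nonpos h0,
            sub_neg_eq_add]
    _ ≤ ∫⁻ t : ℝ, (g (r - t) + g (r + t)) := setLIntegral_le_lintegral _ _
    _ = (∫⁻ t : ℝ, g (r - t)) + ∫⁻ t : ℝ, g (r + t) :=
        lintegral_add_left (f := fun t => g (r - t))
          (hgm.comp (measurable_id.const_sub r)) _
    _ = _ := by
        rw [lintegral_sub_left_eq_self (μ := volume) g r,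
          lintegral_add_left_eq_self g r, hgint,
          ← ENNReal.ofReal_add (by have : 0 < 1 - s := by linarith
                                   positivity) (by have : 0 < 1 - s := by linarith
                                                   positivity)]
        congr 1; ring

/-- The distance to the fat Cantor set is integrable to the power `-s` on its complement. -/
theorem setLIntegral_infEDist_fatCantor_lt_top {δ e₀ θ s : ℝ} (hδ : 0 < δ) (he₀ : 0 < e₀)
    (he₁ : e₀ ≤ 1) (hθ0 : 0 < θ) (hθ1 : θ ≤ 1) (hs0 : 0 ≤ s) (hs1 : s < 1)
    (hsθ : 2 * (θ / 2) ^ (1 - s) < 1) :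
    ∫⁻ t in Ico 0 δ \ fatCantor δ e₀ θ, Metric.infEDist t (fatCantor δ e₀ θ) ^ (-s) < ∞ := by
  set h : ℕ → ℝ := fun j => δ * (1 / 2) ^ j with hh
  set r : ℕ → ℝ := fun j => e₀ * θ ^ j * h j with hr
  have hh0 : ∀ j, 0 < h j := fun j => by positivity
  have hr0 : ∀ j, 0 < r j := fun j => by have := hh0 j; positivity
  have hrh : ∀ j, r j ≤ h j := fun j => by
    have : θ ^ j ≤ 1 := pow_le_one₀ hθ0.le hθ1
    have : e₀ * θ ^ j ≤ 1 := by nlinarith [pow_pos hθ0 j]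
    have := hh0 j
    simp only [hr]; nlinarith
  set H : ℕ → ℝ → ℝ≥0∞ := fun j t => ENNReal.ofReal (r j - |t|) ^ (-s) with hH
  have hHm : ∀ j, Measurable (H j) := fun j => by
    refine Measurable.pow_const (Measurable.ennreal_ofReal ?_) _
    fun_prop
  -- A point off the Cantor set lies in some wall. The Cantor set avoids that wall, so it stays at
  -- distance at least `r j - |t - m * h j|`. Summing over all walls avoids selecting one.
  have hle : ∀ t ∈ Ico 0 δ \ fatCantor δ e₀ θ, Metric.infEDist t (fatCantor δ e₀ θ) ^ (-s) ≤
      ∑' j, ∑ m ∈ Finset.range (2 ^ j + 1), (Ioo (-(r j)) (r j)).indicator (H j) (t - m * h j) := by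
    rintro t ⟨ht, htC⟩
    have : ¬ ∀ (j : ℕ) (m : ℤ),
        e₀ * θ ^ j * (δ * (1 / 2) ^ j) ≤ |t - m * (δ * (1 / 2) ^ j)| :=
      fun h => htC ⟨Ico_subset_Icc_self ht, h⟩
    push Not at this
    obtain ⟨j, m, hm⟩ := this
    obtain ⟨m', hm', hmm⟩ := exists_nat_of_abs_sub_lt hδ (hrh j) ht hm
    refine le_trans ?_ (ENNReal.le_tsum j)
    refine le_trans ?_ (Finset.single_le_sum (f := fun m : ℕ =>
        (Ioo (-(r j)) (r j)).indicator (H j) (t - m * h j)) (fun _ _ => zero_le) hm')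
    simp only [hmm]
    rw [indicator_of_mem (by rw [mem_Ioo, ← abs_lt]; exact hm)]
    simp only [hH]
    rw [ENNReal.rpow_neg, ENNReal.rpow_neg, ENNReal.inv_le_inv]
    refine ENNReal.rpow_le_rpow ?_ hs0
    rw [Metric.le_infEDist]
    intro y hy
    rw [edist_dist, Real.dist_eq]
    refine ENNReal.ofReal_le_ofReal ?_
    have h1 := hy.2 j m
    have h2 : |y - m * h j| ≤ |t - y| + |t - m * h j| := by
      have : y - m * h j = -(t - y) + (t - m * h j) := by ring
      rw [this]
      exact (abs_add_le _ _).trans (by rw [abs_neg])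
    linarith
  calc _ ≤ ∫⁻ t in Ico 0 δ \ fatCantor δ e₀ θ, ∑' j, ∑ m ∈ Finset.range (2 ^ j + 1),
          (Ioo (-(r j)) (r j)).indicator (H j) (t - m * h j) :=
        setLIntegral_mono' (measurableSet_Ico.diff (isClosed_fatCantor _ _ _).measurableSet) hle
    _ ≤ ∫⁻ t, ∑' j, ∑ m ∈ Finset.range (2 ^ j + 1),
          (Ioo (-(r j)) (r j)).indicator (H j) (t - m * h j) := setLIntegral_le_lintegral _ _
    _ = ∑' j, (((2 ^ j : ℕ) : ℝ≥0∞) + 1) * ∫⁻ t in Ioo (-(r j)) (r j), H j t := by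
        rw [lintegral_tsum]
        · exact tsum_congr fun j => lintegral_sum_strips _ (hHm j)
        · intro j
          refine (Finset.measurable_sum _ fun m _ => ?_).aemeasurable
          exact ((hHm j).indicator measurableSet_Ioo).comp (measurable_id.sub_const _)
    -- Level `j` has at most `2 · 2 ^ j` relevant gaps, each contributing a multiple of `r j ^ (1 -
    -- s)` with `r j = e₀ δ (θ / 2) ^ j`.
    _ ≤ ∑' j, ENNReal.ofReal
          (4 / (1 - s) * (e₀ * δ) ^ (1 - s) * (2 * (θ / 2) ^ (1 - s)) ^ j) := by
        refine ENNReal.tsum_le_tsum fun j => ?_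
        have h1s : 0 < 1 - s := by linarith
        calc _ ≤ ENNReal.ofReal (2 ^ j + 1) * ENNReal.ofReal (2 / (1 - s) * r j ^ (1 - s)) := by
              refine mul_le_mul' (le_of_eq ?_) (setLIntegral_gap_le hs1 (hr0 j))
              rw [ENNReal.ofReal_add (by positivity) (by norm_num)]
              simp [ENNReal.ofReal_pow]
          _ ≤ _ := by
              rw [← ENNReal.ofReal_mul (by positivity)]
              refine ENNReal.ofReal_le_ofReal ?_
              have h1 : (1 : ℝ) ≤ 2 ^ j := one_le_pow₀ (by norm_num)
              have h2 : r j = (e₀ * δ) * (θ / 2) ^ j := by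
                simp only [hr, hh]; rw [div_pow, div_pow, one_pow]; ring
              have h3 : r j ^ (1 - s) = (e₀ * δ) ^ (1 - s) * ((θ / 2) ^ (1 - s)) ^ j := by
                rw [h2, Real.mul_rpow (by positivity) (by positivity), ← Real.rpow_natCast,
                  ← Real.rpow_natCast, ← Real.rpow_mul (by positivity),
                  ← Real.rpow_mul (by positivity), mul_comm (j : ℝ)]
              rw [h3, mul_pow]
              calc ((2 : ℝ) ^ j + 1) * (2 / (1 - s) * ((e₀ * δ) ^ (1 - s) *
                    ((θ / 2) ^ (1 - s)) ^ j)) ≤ ((2 : ℝ) ^ j + 2 ^ j) * (2 / (1 - s) *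
                    ((e₀ * δ) ^ (1 - s) * ((θ / 2) ^ (1 - s)) ^ j)) := by gcongr
                _ = _ := by ring
    _ < ∞ := ((summable_geometric_of_lt_one (by positivity) hsθ).mul_left _).tsum_ofReal_lt_top

end Walls

/-! ### Products of fat Cantor sets in a cube -/

section Box

variable {ι X : Type*} [Fintype ι] [NormedAddCommGroup X] [InnerProductSpace ℝ X]
  (b : OrthonormalBasis ι ℝ X) (w₀ : X)

/-- The walls of the `j`-th grid in the cube. -/
def wallSet (δ e₀ θ : ℝ) (j : ℕ) : Set X :=
  {w | w ∈ gridCube b w₀ δ ∧ ∃ i, ∃ m : ℤ, |inner ℝ (b i) (w - w₀) - m * (δ * (1 / 2) ^ j)| <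
    e₀ * θ ^ j * (δ * (1 / 2) ^ j)}

theorem isOpen_strips (h r : ℝ) : IsOpen {t : ℝ | ∃ m : ℤ, |t - m * h| < r} := by
  simp only [ofPred_exists]
  exact isOpen_iUnion fun m => isOpen_lt (by fun_prop) continuous_const

theorem wallSet_eq (δ e₀ θ : ℝ) (j : ℕ) : wallSet b w₀ δ e₀ θ j =
    ⋃ i, gridCube b w₀ δ ∩ (fun w : X => inner ℝ (b i) (w - w₀)) ⁻¹'
      {t : ℝ | ∃ m : ℤ, |t - m * (δ * (1 / 2) ^ j)| < e₀ * θ ^ j * (δ * (1 / 2) ^ j)} := by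
  ext w
  simp [wallSet]

/-- The product of fat Cantor sets in a cube. -/
def cantorCube (δ e₀ θ : ℝ) : Set X := {w | ∀ i, inner ℝ (b i) (w - w₀) ∈ fatCantor δ e₀ θ}

variable {δ e₀ θ : ℝ}

theorem isClosed_cantorCube : IsClosed (cantorCube b w₀ δ e₀ θ) := by
  have : cantorCube b w₀ δ e₀ θ =
      ⋂ i, (fun w : X => inner ℝ (b i) (w - w₀)) ⁻¹' fatCantor δ e₀ θ := by
    ext w; simp [cantorCube]
  rw [this]
  exact isClosed_iInter fun i => (isClosed_fatCantor _ _ _).preimage (by fun_prop)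

theorem cantorCube_subset_gridCube (hδ : 0 < δ) (he₀ : 0 < e₀) :
    cantorCube b w₀ δ e₀ θ ⊆ gridCube b w₀ δ :=
  fun _ hw i => fatCantor_subset_Ico hδ he₀ (hw i)

theorem cantorCube_far_from_walls (hδ : 0 < δ) {w : X} (hw : w ∈ cantorCube b w₀ δ e₀ θ)
    (j : ℕ) (i : ι) : 2 * (e₀ * θ ^ j) ≤
      |Real.sin (Real.pi * (inner ℝ (b i) (w - w₀) / (δ * (1 / 2) ^ j)))| :=
  two_mul_le_abs_sin (by positivity) ((hw i).2 j)

/-- A coordinate is `1`-Lipschitz and maps the Cantor cube into the Cantor set; this reduces the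
integrability of the distance to dimension one. -/
theorem infEDist_fatCantor_le (i : ι) (w : X) :
    Metric.infEDist (inner ℝ (b i) (w - w₀)) (fatCantor δ e₀ θ) ≤
      Metric.infEDist w (cantorCube b w₀ δ e₀ θ) := by
  rw [Metric.le_infEDist]
  intro v hv
  refine (Metric.infEDist_le_edist_of_mem (hv i)).trans ?_
  rw [edist_dist, edist_dist, Real.dist_eq, dist_eq_norm]
  refine ENNReal.ofReal_le_ofReal ?_
  rw [← inner_sub_right, sub_sub_sub_cancel_right]
  have := abs_real_inner_le_norm (b i) (w - v)
  rwa [b.norm_eq_one, one_mul] at this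

variable [FiniteDimensional ℝ X] [MeasurableSpace X] [BorelSpace X]

theorem volume_coordBox {T : ι → Set ℝ} (hT : ∀ i, MeasurableSet (T i)) :
    volume {w : X | ∀ i, inner ℝ (b i) (w - w₀) ∈ T i} = ∏ i, volume (T i) := by
  have h1 : MeasurePreserving (fun w : X => WithLp.ofLp (b.repr (w - w₀))) volume volume :=
    (PiLp.volume_preserving_ofLp ι).comp
      (b.measurePreserving_repr.comp (measurePreserving_sub_right volume w₀))
  rw [← volume_pi_pi, ← h1.measure_preimage (MeasurableSet.univ_pi hT).nullMeasurableSet]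
  congr 1
  ext w
  simp only [mem_ofPred_eq, mem_preimage, mem_univ_pi, b.repr_apply_apply]

theorem measurable_inner_sub (i : ι) : Measurable fun w : X => inner ℝ (b i) (w - w₀) := by
  fun_prop

theorem measurableSet_gridCube (δ : ℝ) : MeasurableSet (gridCube b w₀ δ) := by
  have : gridCube b w₀ δ = ⋂ i, (fun w : X => inner ℝ (b i) (w - w₀)) ⁻¹' Ico 0 δ := by
    ext w; simp [gridCube]
  rw [this]
  exact MeasurableSet.iInter fun i => measurable_inner_sub b w₀ i measurableSet_Ico

/-- The marginals of Lebesgue measure on a cube. -/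
theorem map_inner_restrict_gridCube (δ : ℝ) (i : ι) :
    (volume.restrict (gridCube b w₀ δ)).map (fun w : X => inner ℝ (b i) (w - w₀)) =
      ENNReal.ofReal δ ^ (Fintype.card ι - 1) • volume.restrict (Ico 0 δ) := by
  classical
  ext T hT
  rw [Measure.map_apply (measurable_inner_sub b w₀ i) hT,
    Measure.restrict_apply (measurable_inner_sub b w₀ i hT)]
  have hset : (fun w : X => inner ℝ (b i) (w - w₀)) ⁻¹' T ∩ gridCube b w₀ δ =
      {w : X | ∀ l, inner ℝ (b l) (w - w₀) ∈ if l = i then T ∩ Ico 0 δ else Ico 0 δ} := by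
    ext w
    simp only [gridCube, mem_inter_iff, mem_preimage, mem_ofPred_eq]
    constructor
    · rintro ⟨h1, h2⟩ l
      split_ifs with hl
      · subst hl; exact ⟨h1, h2 l⟩
      · exact h2 l
    · intro h
      refine ⟨?_, fun l => ?_⟩
      · have := h i
        rw [if_pos rfl] at this
        exact this.1
      · have := h l
        split_ifs at this with hl
        · exact this.2
        · exact this
  rw [hset, volume_coordBox b w₀ fun l => by
    split_ifs
    · exact hT.inter measurableSet_Ico
    · exact measurableSet_Ico]
  rw [← Finset.mul_prod_erase _ _ (Finset.mem_univ i), if_pos rfl,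
    Finset.prod_congr rfl (g := fun _ => ENNReal.ofReal δ) (fun l hl => by
      rw [if_neg (Finset.ne_of_mem_erase hl), Real.volume_Ico, sub_zero])]
  rw [Finset.prod_const, Finset.card_erase_of_mem (Finset.mem_univ i), Finset.card_univ,
    Measure.smul_apply, Measure.restrict_apply hT, smul_eq_mul, mul_comm]

theorem volume_gridCube (δ : ℝ) :
    volume (gridCube b w₀ δ) = ENNReal.ofReal δ ^ Fintype.card ι := by
  have h := volume_coordBox b w₀ (T := fun _ => Ico 0 δ) fun _ => measurableSet_Ico
  rw [show gridCube b w₀ δ = {w : X | ∀ i, inner ℝ (b i) (w - w₀) ∈ Ico 0 δ} from rfl, h]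
  simp

theorem measurableSet_wallSet (δ e₀ θ : ℝ) (j : ℕ) :
    MeasurableSet (wallSet b w₀ δ e₀ θ j) := by
  rw [wallSet_eq]
  exact MeasurableSet.iUnion fun i => (measurableSet_gridCube b w₀ δ).inter
    (measurable_inner_sub b w₀ i (isOpen_strips _ _).measurableSet)

/-- Each direction contributes at most the one-dimensional length of its walls: the marginals of the
cube carry the extra factor `δ ^ (card ι - 1) ≤ 1`. -/
theorem volume_wallSet_le {δ e₀ θ : ℝ} (hδ : 0 < δ) (hδ1 : δ ≤ 1) (he₀ : 0 < e₀) (he₁ : e₀ ≤ 1)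
    (hθ0 : 0 < θ) (hθ1 : θ ≤ 1) (j : ℕ) :
    volume (wallSet b w₀ δ e₀ θ j) ≤ ENNReal.ofReal (Fintype.card ι * 4 * θ ^ j) := by
  rw [wallSet_eq]
  refine (measure_iUnion_le _).trans ?_
  rw [tsum_fintype, mul_assoc (Fintype.card ι : ℝ), ENNReal.ofReal_mul (by positivity), ENNReal.ofReal_natCast,
    ← nsmul_eq_mul]
  refine Finset.sum_le_card_nsmul _ _ _ fun i _ => ?_
  rw [inter_comm, ← Measure.restrict_apply
    (measurable_inner_sub b w₀ i (isOpen_strips _ _).measurableSet),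
    ← Measure.map_apply (measurable_inner_sub b w₀ i) (isOpen_strips _ _).measurableSet,
    map_inner_restrict_gridCube, Measure.smul_apply,
    Measure.restrict_apply (isOpen_strips _ _).measurableSet, inter_comm, smul_eq_mul]
  refine (mul_le_of_le_one_left' (pow_le_one' ?_ _)).trans
    ((volume_walls_le hδ he₀ he₁ hθ0 hθ1 j).trans ?_)
  · rw [← ENNReal.ofReal_one]; exact ENNReal.ofReal_le_ofReal hδ1
  · refine ENNReal.ofReal_le_ofReal ?_
    gcongr
    nlinarith

theorem volume_cantorCube_pos (hδ : 0 < δ) (he₀ : 0 < e₀) (hθ0 : 0 < θ)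
    (hθ1 : θ < 1) (heθ : 4 * e₀ < 1 - θ) : 0 < volume (cantorCube b w₀ δ e₀ θ) := by
  have h := volume_coordBox b w₀ (T := fun _ => fatCantor δ e₀ θ)
    fun _ => (isClosed_fatCantor _ _ _).measurableSet
  rw [cantorCube, h, Finset.prod_const]
  exact pos_iff_ne_zero.2 (pow_ne_zero _ (volume_fatCantor_pos hδ he₀ hθ0 hθ1 heθ).ne')

/-- The distance to the Cantor cube is integrable to the power `-s` in the cube, off the Cantor
cube. -/
theorem setLIntegral_infEDist_cantorCube_lt_top {s : ℝ} (hδ : 0 < δ)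
    (he₀ : 0 < e₀) (he₁ : e₀ ≤ 1) (hθ0 : 0 < θ) (hθ1 : θ ≤ 1) (hs0 : 0 ≤ s) (hs1 : s < 1)
    (hsθ : 2 * (θ / 2) ^ (1 - s) < 1) :
    ∫⁻ w in gridCube b w₀ δ \ cantorCube b w₀ δ e₀ θ,
      Metric.infEDist w (cantorCube b w₀ δ e₀ θ) ^ (-s) < ∞ := by
  set C := fatCantor δ e₀ θ with hC
  set Q := gridCube b w₀ δ with hQ
  set f : ℝ → ℝ≥0∞ := (Cᶜ).indicator fun t => Metric.infEDist t C ^ (-s) with hf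
  have hfm : Measurable f :=
    (measurable_infEDist.pow_const _).indicator (isClosed_fatCantor _ _ _).measurableSet.compl
  -- Some coordinate of `w` misses the Cantor set, and its distance to that set bounds the distance
  -- of `w` to the Cantor cube from below.
  have hle : ∀ w ∈ Q \ cantorCube b w₀ δ e₀ θ, Metric.infEDist w (cantorCube b w₀ δ e₀ θ) ^ (-s) ≤
      ∑ i, f (inner ℝ (b i) (w - w₀)) := by
    rintro w ⟨-, hw⟩
    have : ∃ i, inner ℝ (b i) (w - w₀) ∉ C := by
      by_contra hcon
      push Not at hcon
      exact hw hcon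
    obtain ⟨i, hi⟩ := this
    refine le_trans ?_ (Finset.single_le_sum (f := fun i => f (inner ℝ (b i) (w - w₀)))
      (fun _ _ => zero_le) (Finset.mem_univ i))
    simp only [hf]
    rw [indicator_of_mem (by exact hi), ENNReal.rpow_neg, ENNReal.rpow_neg, ENNReal.inv_le_inv]
    exact ENNReal.rpow_le_rpow (infEDist_fatCantor_le b w₀ i w) hs0
  calc _ ≤ ∫⁻ w in Q \ cantorCube b w₀ δ e₀ θ, ∑ i, f (inner ℝ (b i) (w - w₀)) :=
        setLIntegral_mono' ((measurableSet_gridCube b w₀ δ).diff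
          (isClosed_cantorCube b w₀).measurableSet) hle
    _ ≤ ∫⁻ w in Q, ∑ i, f (inner ℝ (b i) (w - w₀)) := lintegral_mono_set sdiff_subset
    _ = ∑ i, ∫⁻ w in Q, f (inner ℝ (b i) (w - w₀)) :=
        lintegral_finsetSum _ fun i _ => hfm.comp (measurable_inner_sub b w₀ i)
    _ = ∑ i : ι, ENNReal.ofReal δ ^ (Fintype.card ι - 1) * ∫⁻ t in Ico 0 δ, f t := by
        refine Finset.sum_congr rfl fun i _ => ?_
        rw [← lintegral_map hfm (measurable_inner_sub b w₀ i), map_inner_restrict_gridCube,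
          lintegral_smul_measure, smul_eq_mul]
    _ < ∞ := by
        refine ENNReal.sum_lt_top.2 fun i _ => ENNReal.mul_lt_top
          (ENNReal.pow_lt_top ENNReal.ofReal_lt_top) ?_
        rw [hf, setLIntegral_indicator (isClosed_fatCantor _ _ _).measurableSet.compl,
          inter_comm, ← sdiff_eq]
        exact setLIntegral_infEDist_fatCantor_lt_top hδ he₀ he₁ hθ0 hθ1 hs0 hs1 hsθ

end Box

/-- The `j`-th term contributes amplitude times scale to the power `-α` times measure of the support
to the power `1/p`; `hdecay` makes this product geometric. For `p = ∞` the exponent `(1 / p).toReal`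
is `0`, the supports play no role, and the estimate is the Hölder one. -/
theorem memFracSobolev_of_geometric_series {X F : Type*} [NormedAddCommGroup X] [NormedSpace ℝ X]
    [FiniteDimensional ℝ X] [MeasurableSpace X] [BorelSpace X] [NormedAddCommGroup F]
    (μ : Measure X) [μ.IsAddHaarMeasure] (hX : 1 ≤ Module.finrank ℝ X) {α : ℝ} (hα0 : 0 < α)
    (hα1 : α < 1) {p : ℝ≥0∞} (hp1 : 1 ≤ p) {f : ℕ → X → F} {v : X → F}
    (hsum : ∀ x, HasSum (fun j => f j x) (v x)) (hv : Continuous v) (hvc : HasCompactSupport v)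
    {A : ℕ → Set X} (hA : ∀ j, MeasurableSet (A j)) (hfA : ∀ j, ∀ x ∉ A j, f j x = 0)
    {C g₀ r η : ℝ} (hC : 0 < C) (hg₀ : 0 < g₀) (hr : 0 < r) (hη : 0 < η)
    (hf : ∀ j x y, ‖f j x - f j y‖ ≤ C * r ^ j * min 2 (‖x - y‖ / (g₀ * η ^ j)))
    {V σ : ℝ} (hσ : 0 < σ) (hAσ : ∀ j, μ (A j) ≤ ENNReal.ofReal (V * σ ^ j))
    (hdecay : σ ^ (1 / p).toReal * (r * η ^ (-α)) < 1) :
    MemFracSobolev (Module.finrank ℝ X) α p μ univ v := by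
  have hMg : ∀ j : ℕ, C * r ^ j * (g₀ * η ^ j) ^ (-α) = C * g₀ ^ (-α) * (r * η ^ (-α)) ^ j := by
    intro j
    rw [Real.mul_rpow hg₀.le (by positivity), mul_pow, ← Real.rpow_natCast η j,
      ← Real.rpow_natCast (η ^ (-α)) j, ← Real.rpow_mul hη.le, ← Real.rpow_mul hη.le,
      mul_comm (j : ℝ)]
    ring
  unfold MemFracSobolev
  split_ifs with hp
  · obtain ⟨B, hB⟩ := hv.bounded_above_of_compact_support hvc
    refine ⟨⟨B, fun x _ => hB x⟩, ?_⟩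
    have hd : r * η ^ (-α) < 1 := by
      rw [hp] at hdecay
      simpa using hdecay
    obtain ⟨D, hD⟩ := exists_holderWith_of_hasSum hα0 hα1 hsum (M := fun j => C * r ^ j)
      (g := fun j => g₀ * η ^ j) (fun j => by positivity) (fun j => by positivity) hf
      (C := C * g₀ ^ (-α)) (by positivity) hd fun j => (hMg j).le
    exact ⟨D, hD.holderOnWith univ⟩
  · have hq : 1 ≤ p.toReal := by
      rw [← ENNReal.toReal_one]; exact ENNReal.toReal_mono hp hp1
    set q := p.toReal with hqdef
    have hq0 : 0 < q := by linarith
    have hpq : (1 / p).toReal = 1 / q := by simp [hqdef]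
    rw [hpq] at hdecay
    rw [Measure.restrict_univ]
    refine ⟨hv.memLp_of_hasCompactSupport hvc, ?_⟩
    refine gagliardo_lt_top_of_hasSum μ hX hα0 hα1 hq hsum (M := fun j => C * r ^ j)
      (g := fun j => g₀ * η ^ j) (fun j => by positivity) (fun j => by positivity) hA hfA hf
      (C := (C * g₀ ^ (-α)) ^ q * V) (ρ := (r * η ^ (-α)) ^ q * σ) (by positivity) ?_ fun j => ?_
    · have h1 : (σ ^ (1 / q) * (r * η ^ (-α))) ^ q = (r * η ^ (-α)) ^ q * σ := by
        rw [Real.mul_rpow (by positivity) (by positivity), ← Real.rpow_mul hσ.le,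
          one_div_mul_cancel hq0.ne', Real.rpow_one, mul_comm]
      rw [← h1]
      exact Real.rpow_lt_one (by positivity) hdecay hq0
    · refine (mul_le_mul' le_rfl (hAσ j)).trans ?_
      rw [← ENNReal.ofReal_mul (by positivity)]
      refine ENNReal.ofReal_le_ofReal (le_of_eq ?_)
      have h2 : (C * r ^ j) ^ q * (g₀ * η ^ j) ^ (-(α * q)) =
          (C * r ^ j * (g₀ * η ^ j) ^ (-α)) ^ q := by
        rw [Real.mul_rpow (x := C * r ^ j) (by positivity) (by positivity), ← Real.rpow_mul
          (x := g₀ * η ^ j) (by positivity), neg_mul]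
      rw [h2, hMg, Real.mul_rpow (by positivity) (by positivity), mul_pow (_ ^ q) σ,
        ← Real.rpow_natCast (r * η ^ (-α)) j, ← Real.rpow_natCast ((r * η ^ (-α)) ^ q) j,
        ← Real.rpow_mul (by positivity), ← Real.rpow_mul (by positivity), mul_comm (j : ℝ)]
      ring

/-- The thickness ratio of the walls. -/
theorem exists_thickness_ratio {s α c : ℝ} (hs0 : 0 < s) (hs : s < 1 / 2) (hα0 : 0 < α)
    (hc1 : c ≤ 1) (hα : α < 1 - (2 - c) * s) :
    ∃ θ : ℝ, 1 / 2 < θ ∧ θ < 1 ∧ 2 * (θ / 2) ^ (1 - s) < 1 ∧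
      θ ^ c * (1 / (2 * θ) * (θ / 2) ^ (-α)) < 1 ∧ 1 / 2 * (θ / 2) ^ (-α) < 1 := by
  have h1s : 0 < 1 - s := by linarith
  have hD : 0 < 1 - c + α := by linarith
  -- With `θ = 2 ^ (-γ)`, the lower bound on `γ` is integrability of the distance, `γ < 1` is `θ >
  -- 1/2`, and the last bound is the steep condition. The interval is nonempty by `s < 1/2` and,
  -- after clearing denominators, by `α < 1 - (2 - c) s`.
  obtain ⟨γ, hγ1, hγ2⟩ : ∃ γ, s / (1 - s) < γ ∧ γ < min 1 ((1 - α) / (1 - c + α)) := by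
    refine exists_between (lt_min ?_ ?_)
    · rw [div_lt_one h1s]; linarith
    · rw [div_lt_div_iff₀ h1s hD]; nlinarith
  have hγ0 : 0 < γ := lt_trans (by positivity) hγ1
  have hγlt1 : γ < 1 := hγ2.trans_le (min_le_left _ _)
  have hγ3 : γ * (1 - c + α) < 1 - α := (lt_div_iff₀ hD).1 (hγ2.trans_le (min_le_right _ _))
  rw [div_lt_iff₀ h1s] at hγ1
  have h2 : (0 : ℝ) < 2 := two_pos
  have hθ2 : (2 : ℝ) ^ (-γ) / 2 = 2 ^ (-γ - 1) := by
    rw [Real.rpow_sub h2, Real.rpow_one]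
  have hlt1 : ∀ x : ℝ, x < 0 → (2 : ℝ) ^ x < 1 := fun x hx =>
    Real.rpow_lt_one_of_one_lt_of_neg one_lt_two hx
  have hhalf : (1 / 2 : ℝ) = 2 ^ (-1 : ℝ) := by rw [Real.rpow_neg_one]; norm_num
  have hsteep : (2 ^ (-γ)) ^ c * (1 / (2 * 2 ^ (-γ)) * ((2 : ℝ) ^ (-γ) / 2) ^ (-α)) =
      2 ^ (γ * (1 - c + α) - (1 - α)) := by
    have : 1 / (2 * (2 : ℝ) ^ (-γ)) = 2 ^ (γ - 1) := by
      rw [Real.rpow_sub h2, Real.rpow_one, Real.rpow_neg h2.le]; field_simp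
    rw [this, hθ2, ← Real.rpow_mul h2.le, ← Real.rpow_mul h2.le, ← Real.rpow_add h2,
      ← Real.rpow_add h2]
    congr 1; ring
  refine ⟨2 ^ (-γ), ?_, hlt1 _ (by linarith), ?_, ?_, ?_⟩
  · rw [hhalf]
    exact Real.rpow_lt_rpow_of_exponent_lt one_lt_two (by linarith)
  · rw [hθ2, ← Real.rpow_mul h2.le]
    nth_rewrite 1 [← Real.rpow_one 2]
    rw [← Real.rpow_add h2]
    refine hlt1 _ ?_
    nlinarith
  · rw [hsteep]
    exact hlt1 _ (by linarith)
  -- The flat condition is `α (1 + γ) < 1`; it follows from the steep one because `c ≤ 1`.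
  · rw [hθ2, ← Real.rpow_mul h2.le, hhalf, ← Real.rpow_add h2]
    refine hlt1 _ ?_
    nlinarith

/-! ### The Lusin-type theorem -/

section Core

variable {ι X Y : Type*} [Fintype ι] [Nonempty ι] [NormedAddCommGroup X] [InnerProductSpace ℝ X]
  [FiniteDimensional ℝ X] [MeasurableSpace X] [BorelSpace X] [NormedAddCommGroup Y]
  [NormedSpace ℝ Y] [CompleteSpace Y]

/-- The parts of the gradient trade size against support: the flat one is smaller but fills the cube
(`σ = 1`), while the steep one is larger but lives on the walls (`σ = θ`). -/
theorem memFracSobolev_fderiv_approxSol (b : OrthonormalBasis ι ℝ X) (w₀ : X) {δ e₀ θ : ℝ}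
    {G : X × Y → X →L[ℝ] Y} (hδ : 0 < δ) (hδ1 : δ ≤ 1) (he₀ : 0 < e₀) (he₁ : e₀ ≤ 1)
    (hθ0 : 1 / 2 < θ) (hθ1 : θ ≤ 1) {B : ℝ} (hB : ∀ z, ‖G z‖ ≤ B) {L : ℝ≥0}
    (hL : LipschitzWith L G) {α : ℝ} (hα0 : 0 < α) (hα1 : α < 1) {p : ℝ≥0∞} (hp1 : 1 ≤ p)
    (hsteep : θ ^ (1 / p).toReal * (1 / (2 * θ) * (θ / 2) ^ (-α)) < 1)
    (hflat : 1 / 2 * (θ / 2) ^ (-α) < 1) :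
    MemFracSobolev (Module.finrank ℝ X) α p volume univ (fderiv ℝ (approxSol b w₀ δ e₀ θ G)) := by
  have hX : 1 ≤ Module.finrank ℝ X := by
    rw [Module.finrank_eq_card_basis b.toBasis]; exact Fintype.card_pos
  have hθ : 0 < θ := by linarith
  obtain ⟨C, g₀, hC, hg₀, -, -, h3, h4⟩ :=
    exists_piece_bounds b w₀ hδ hδ1 he₀ he₁ hθ hθ1 hB hL
  have hball : ∀ w ∉ Metric.closedBall w₀ (Fintype.card ι * δ), w ∉ gridCube b w₀ δ := by
    intro w hw hw'
    exact hw (by rw [mem_closedBall_iff_norm]; exact norm_sub_le_of_mem_gridCube b w₀ hδ hw')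
  have hf : fderiv ℝ (approxSol b w₀ δ e₀ θ G) =
      flatGrad b w₀ δ e₀ θ G + steepGrad b w₀ δ e₀ θ G :=
    funext fun w => (hasFDerivAt_approxSol b w₀ hδ hδ1 he₀ he₁ hθ0 hθ1 hB hL w).fderiv
  rw [hf]
  refine MemFracSobolev.add hp1 ?_ ?_ (continuous_steepGrad b w₀ hδ hδ1 he₀ he₁ hθ0 hθ1 hB hL)
  · refine memFracSobolev_of_geometric_series volume hX hα0 hα1 hp1
      (hasSum_flatGrad b w₀ hδ hδ1 he₀ he₁ hθ0 hθ1 hB hL)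
      (continuous_flatGrad b w₀ hδ hδ1 he₀ he₁ hθ0 hθ1 hB hL) ?_
      (A := fun _ => gridCube b w₀ δ) (fun _ => measurableSet_gridCube b w₀ δ) (fun j w hw => ?_)
      hC hg₀ (by norm_num) (by positivity) h3 (V := 1) (σ := 1) one_pos (fun j => ?_)
      (by simpa using hflat)
    · refine HasCompactSupport.intro (isCompact_closedBall w₀ (Fintype.card ι * δ)) fun w hw => ?_
      simp [flatGrad, gridPieceFlat, cellCorr_of_notMem b w₀ (hball w hw)]
    · simp [gridPieceFlat, cellCorr_of_notMem b w₀ hw]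
    · rw [volume_gridCube, one_pow, mul_one, ENNReal.ofReal_one]
      exact pow_le_one' (by rw [← ENNReal.ofReal_one]; exact ENNReal.ofReal_le_ofReal hδ1) _
  · refine memFracSobolev_of_geometric_series volume hX hα0 hα1 hp1
      (hasSum_steepGrad b w₀ hδ hδ1 he₀ he₁ hθ0 hθ1 hB hL)
      (continuous_steepGrad b w₀ hδ hδ1 he₀ he₁ hθ0 hθ1 hB hL) ?_
      (A := wallSet b w₀ δ e₀ θ) (measurableSet_wallSet b w₀ δ e₀ θ) (fun j w hw => ?_)
      hC hg₀ (by positivity) (by positivity) h4 (V := Fintype.card ι * 4) (σ := θ)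
      hθ (volume_wallSet_le b w₀ hδ hδ1 he₀ he₁ hθ hθ1) hsteep
    · refine HasCompactSupport.intro (isCompact_closedBall w₀ (Fintype.card ι * δ)) fun w hw => ?_
      simp only [steepGrad, gridPieceSteep, cellCorr_of_notMem b w₀ (hball w hw)]
      simp
    · by_cases hwQ : w ∈ gridCube b w₀ δ
      · have hfar : ∀ i, 2 * (e₀ * θ ^ j) ≤
            |Real.sin (Real.pi * (inner ℝ (b i) (w - w₀) / (δ * (1 / 2) ^ j)))| := by
          intro i
          refine two_mul_le_abs_sin (by positivity) fun m => ?_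
          by_contra hcon
          exact hw ⟨hwQ, i, m, not_le.1 hcon⟩
        simp only [gridPieceSteep, (wallCutoff_eq_one b w₀ _ _ (by positivity) hfar).2]
        simp
      · simp only [gridPieceSteep, cellCorr_of_notMem b w₀ hwQ]
        simp

end Core

/-- **A Lusin-type theorem for nonlinear first order systems.** There is a small `C¹` function `u`
with `Du ∈ W^{α,p}` solving `Du = G(w, u)` on a closed set `K` of positive measure, contained in a
small cube `Q` outside of which `u` vanishes, such that the distance to `K` is integrable to the
power `-s` on `Q \ K`. -/
theorem exists_contDiff_fderiv_eq {X Y : Type*} [NormedAddCommGroup X] [InnerProductSpace ℝ X]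
    [FiniteDimensional ℝ X] [MeasurableSpace X] [BorelSpace X] [NormedAddCommGroup Y]
    [NormedSpace ℝ Y] [CompleteSpace Y] (hX : 1 ≤ Module.finrank ℝ X) {p : ℝ≥0∞} (hp : 1 ≤ p)
    {s α : ℝ} (hs0 : 0 < s) (hs : s < 1 / 2) (hα0 : 0 < α) (hα1 : α < 1)
    (hα : α < 1 - (2 - (1 / p).toReal) * s) {G : X × Y → X →L[ℝ] Y} {B : ℝ} (hB : ∀ z, ‖G z‖ ≤ B)
    {L : ℝ≥0} (hL : LipschitzWith L G) (w₀ : X) {ρ : ℝ} (hρ : 0 < ρ) :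
    ∃ (u : X → Y) (Q K : Set X), ContDiff ℝ 1 u ∧ (∀ w, ‖u w‖ ≤ ρ) ∧
      Q ⊆ Metric.closedBall w₀ ρ ∧ MeasurableSet Q ∧ IsClosed K ∧ K ⊆ Q ∧ (∀ w ∉ Q, u w = 0) ∧
      0 < volume K ∧ (∀ w ∈ K, fderiv ℝ u w = G (w, u w)) ∧
      MemFracSobolev (Module.finrank ℝ X) α p volume univ (fderiv ℝ u) ∧
      ∫⁻ w in Q \ K, Metric.infEDist w K ^ (-s) < ∞ ∧
      ∃ c > 0, ∀ w ∉ Q, ∀ v ∈ K, c ≤ ‖w - v‖ := by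
  obtain ⟨θ, hθ0, hθ1, hθs, hsteep, hflat⟩ := exists_thickness_ratio (c := (1 / p).toReal)
    hs0 hs hα0 (by
      rw [← ENNReal.toReal_one]
      refine ENNReal.toReal_mono ENNReal.one_ne_top ?_
      rw [one_div]; exact ENNReal.inv_le_one.2 hp) hα
  have : Nontrivial X := Module.nontrivial_of_finrank_pos (R := ℝ) (by omega)
  let b := stdOrthonormalBasis ℝ X
  have : Nonempty (Fin (Module.finrank ℝ X)) := ⟨⟨0, by omega⟩⟩
  have hB0 : 0 ≤ B := (norm_nonneg _).trans (hB 0)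
  set k : ℝ := (Fintype.card (Fin (Module.finrank ℝ X)) : ℝ) with hk
  have hk0 : 0 < k := by rw [hk]; exact_mod_cast Fintype.card_pos
  -- Any positive value below `(1 - θ) / 4` leaves a Cantor set of positive measure.
  set e₀ := (1 - θ) / 8 with he
  have he₀ : 0 < e₀ := by rw [he]; linarith
  have he₁ : e₀ ≤ 1 := by rw [he]; linarith
  have heθ : 4 * e₀ < 1 - θ := by rw [he]; linarith
  -- The product `D * δ` bounds both the sup norm of the solution and the distance of points of the
  -- cube from `w₀`; a small `δ` brings both below `ρ`.
  set D := (B + 2 * L * (1 + B) * k) * k * 2 + k + 1 with hD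
  have hD0 : 0 < D := by positivity
  have hDk : k ≤ D := by
    have : 0 ≤ (B + 2 * L * (1 + B) * k) * k * 2 := by positivity
    linarith
  set δ := min 1 (ρ / D) with hδdef
  have hδ : 0 < δ := lt_min one_pos (by positivity)
  have hδ1 : δ ≤ 1 := min_le_left _ _
  have hδD : D * δ ≤ ρ := by
    have : δ ≤ ρ / D := min_le_right _ _
    rw [le_div_iff₀ hD0] at this
    linarith
  refine ⟨approxSol b w₀ δ e₀ θ G, gridCube b w₀ δ, cantorCube b w₀ δ e₀ θ,
    contDiff_approxSol b w₀ hδ hδ1 he₀ he₁ hθ0 hθ1.le hB hL, fun w => ?_, fun w hw => ?_,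
    measurableSet_gridCube b w₀ δ, isClosed_cantorCube b w₀,
    cantorCube_subset_gridCube b w₀ hδ he₀, fun w hw => approxSol_of_notMem b w₀ hw,
    volume_cantorCube_pos b w₀ hδ he₀ (by linarith) hθ1 heθ, fun w hw => ?_,
    memFracSobolev_fderiv_approxSol b w₀ hδ hδ1 he₀ he₁ hθ0 hθ1.le hB hL hα0 hα1 hp hsteep hflat,
    setLIntegral_infEDist_cantorCube_lt_top b w₀ hδ he₀ he₁ (by linarith) hθ1.le hs0.le
      (by linarith) hθs, e₀ * δ, by positivity, fun w hw v hv => ?_⟩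
  · refine (norm_approxSol_le b w₀ hδ hδ1 hB hL w).trans (le_trans ?_ hδD)
    rw [← hk]
    calc _ = (B + 2 * L * (1 + B) * k) * k * 2 * δ := by ring
      _ ≤ D * δ := by gcongr; rw [hD]; linarith
  · rw [mem_closedBall_iff_norm]
    refine (norm_sub_le_of_mem_gridCube b w₀ hδ hw).trans (le_trans ?_ hδD)
    rw [← hk]; gcongr
  · exact fderiv_approxSol_eq b w₀ hδ hδ1 he₀ he₁ hθ0 hθ1.le hB hL
      (cantorCube_subset_gridCube b w₀ hδ he₀ hw) fun j i =>
        cantorCube_far_from_walls b w₀ hδ hw j i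
  · have : ∃ i, inner ℝ (b i) (w - w₀) ∉ Ico 0 δ := by
      by_contra hcon
      push Not at hcon
      exact hw hcon
    obtain ⟨i, hi⟩ := this
    have hvi := fatCantor_subset_Icc (hv i)
    have h1 := abs_real_inner_le_norm (b i) (w - v)
    rw [b.norm_eq_one, one_mul, ← sub_sub_sub_cancel_right w v w₀, inner_sub_right,
      sub_sub_sub_cancel_right] at h1
    refine le_trans ?_ h1
    rw [mem_Ico, not_and_or, not_le, not_lt] at hi
    rcases hi with hi | hi
    · rw [abs_sub_comm]
      refine le_trans ?_ (le_abs_self _)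
      linarith [hvi.1]
    · refine le_trans ?_ (le_abs_self _)
      linarith [hvi.2]

/-- A `C²` function has a locally Lipschitz gradient. This settles the round parts of the manifold.
-/
theorem exists_ball_memFracSobolev_fderiv {X Y : Type*} [NormedAddCommGroup X]
    [InnerProductSpace ℝ X] [FiniteDimensional ℝ X] [MeasurableSpace X] [BorelSpace X]
    [NormedAddCommGroup Y] [NormedSpace ℝ Y] (hX : 1 ≤ Module.finrank ℝ X)
    {α : ℝ} (hα0 : 0 < α) (hα1 : α < 1) {p : ℝ≥0∞} (hp : 1 ≤ p) {f : X → Y} {w : X}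
    (hf : ContDiffAt ℝ 2 f w) :
    ∃ r > 0, MemFracSobolev (Module.finrank ℝ X) α p volume (Metric.ball w r) (fderiv ℝ f) := by
  have hf' : ContDiffAt ℝ 1 (fderiv ℝ f) w := hf.fderiv_right (by norm_num)
  obtain ⟨L, t, ht, hL⟩ := hf'.exists_lipschitzOnWith
  obtain ⟨r, hr, hrt⟩ := Metric.mem_nhds_iff.1 ht
  have hL' := hL.mono hrt
  refine ⟨r, hr, memFracSobolev_of_lipschitzOnWith volume hX hα0 hα1 hp measurableSet_ball
    measure_ball_lt_top.ne (M := ‖fderiv ℝ f w‖ + L * r) (fun x hx => ?_) hL' ?_⟩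
  · have h1 := hL'.dist_le_mul x hx w (Metric.mem_ball_self hr)
    have h2 : (L : ℝ) * dist x w ≤ L * r := by
      gcongr; exact (Metric.mem_ball.1 hx).le
    have h3 := norm_le_norm_add_norm_sub' (fderiv ℝ f x) (fderiv ℝ f w)
    rw [dist_eq_norm] at h1
    linarith
  · exact hL'.continuousOn.aestronglyMeasurable measurableSet_ball

/-! ### Graph charts and tangent cones -/

section GraphChart

variable {n k : ℕ} {P : Submodule ℝ (EuclideanSpace ℝ (Fin n))} {U : Set P} {φ : P → Pᗮ}
  {S S' : Set (EuclideanSpace ℝ (Fin n))}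

theorem orthogonalProjectionOnto_coe_add_coe (w : P) (v : Pᗮ) :
    P.orthogonalProjectionOnto ((w : EuclideanSpace ℝ (Fin n)) + v) = w := by
  rw [map_add, P.orthogonalProjectionOnto_mem_subspace_eq_self,
    P.orthogonalProjectionOnto_apply_of_mem_orthogonal v.2, add_zero]

theorem orthogonalProjectionOnto_orthogonal_coe_add_coe (w : P) (v : Pᗮ) :
    Pᗮ.orthogonalProjectionOnto ((w : EuclideanSpace ℝ (Fin n)) + v) = v := by
  rw [map_add, Pᗮ.orthogonalProjectionOnto_mem_subspace_eq_self,
    Pᗮ.orthogonalProjectionOnto_apply_of_mem_orthogonal (P.le_orthogonal_orthogonal w.2), zero_add]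

theorem coe_orthogonalProjectionOnto_add (P : Submodule ℝ (EuclideanSpace ℝ (Fin n)))
    (y : EuclideanSpace ℝ (Fin n)) :
    (P.orthogonalProjectionOnto y : EuclideanSpace ℝ (Fin n)) + Pᗮ.orthogonalProjectionOnto y = y :=
  P.starProjection_add_starProjection_orthogonal y

theorem mem_graphOver_iff {y : EuclideanSpace ℝ (Fin n)} :
    y ∈ graphOver P U φ ↔ P.orthogonalProjectionOnto y ∈ U ∧
      Pᗮ.orthogonalProjectionOnto y = φ (P.orthogonalProjectionOnto y) := by
  constructor
  · rintro ⟨w, hw, rfl⟩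
    simp only [orthogonalProjectionOnto_coe_add_coe,
      orthogonalProjectionOnto_orthogonal_coe_add_coe]
    exact ⟨hw, trivial⟩
  · rintro ⟨h1, h2⟩
    refine ⟨_, h1, ?_⟩
    simp only [← h2, coe_orthogonalProjectionOnto_add]

theorem coe_add_coe_mem_graphOver {w : P} (hw : w ∈ U) :
    (w : EuclideanSpace ℝ (Fin n)) + φ w ∈ graphOver P U φ := ⟨w, hw, rfl⟩

/-- Charts are local objects; this carries those of the round sphere over to the perturbed one where
the two sets agree. -/
theorem IsC1GraphChart.transfer (h : IsC1GraphChart k S P U φ)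
    {O : Set (EuclideanSpace ℝ (Fin n))} (hO : IsOpen O) (hS : S ∩ O = S' ∩ O) :
    IsC1GraphChart k S' P
      (U ∩ (fun w : P => (w : EuclideanSpace ℝ (Fin n)) + φ w) ⁻¹' O) φ := by
  obtain ⟨O₁, hO₁, hg⟩ := h.graph_eq
  have hc : ContinuousOn (fun w : P => (w : EuclideanSpace ℝ (Fin n)) + φ w) U :=
    continuous_subtype_val.continuousOn.add
      (continuous_subtype_val.comp_continuousOn h.contDiffOn.continuousOn)
  refine ⟨h.finrank_eq, hc.isOpen_inter_preimage h.isOpen hO,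
    h.contDiffOn.mono inter_subset_left, O₁ ∩ O, hO₁.inter hO, ?_⟩
  have h1 : graphOver P (U ∩ (fun w : P => (w : EuclideanSpace ℝ (Fin n)) + φ w) ⁻¹' O) φ
      = graphOver P U φ ∩ O := image_inter_preimage _ _ _
  rw [h1, ← hg, inter_comm O₁ O, ← inter_assoc, ← hS, inter_assoc, inter_assoc, inter_comm O O₁]

theorem IsC1GraphChart.restrict (h : IsC1GraphChart k S P U φ) {U' : Set P} (hU' : IsOpen U')
    (hUU : U' ⊆ U) : IsC1GraphChart k S P U' φ := by
  have h1 := h.transfer (hU'.preimage P.orthogonalProjectionOnto.continuous) (S' := S) rfl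
  convert h1 using 1
  ext w
  simp only [mem_inter_iff, mem_preimage, orthogonalProjectionOnto_coe_add_coe]
  exact ⟨fun hw => ⟨hUU hw, hw⟩, fun hw => hw.2⟩

/-- The defining function `y ↦ y_{Pᗮ} - φ(y_P)` vanishes on the graph, so its derivative kills
tangent vectors. Conversely, the derivative of the parametrization sends all of `P` into the tangent
cone. -/
theorem tangentConeAt_of_inter_eq_graphOver {O : Set (EuclideanSpace ℝ (Fin n))} (hO : IsOpen O)
    (hS : S ∩ O = graphOver P U φ) (hU : IsOpen U) {w : P} (hw : w ∈ U)
    (hφ : DifferentiableAt ℝ φ w) :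
    tangentConeAt ℝ S ((w : EuclideanSpace ℝ (Fin n)) + φ w) =
      range fun v : P => (v : EuclideanSpace ℝ (Fin n)) + fderiv ℝ φ w v := by
  have hx : (w : EuclideanSpace ℝ (Fin n)) + φ w ∈ O :=
    (hS.symm.subset (coe_add_coe_mem_graphOver hw)).2
  rw [← tangentConeAt_inter_nhds (hO.mem_nhds hx), hS]
  apply Subset.antisymm
  · intro v hv
    set h : EuclideanSpace ℝ (Fin n) → Pᗮ :=
      fun y => Pᗮ.orthogonalProjectionOnto y - φ (P.orthogonalProjectionOnto y) with hh
    have hφ' : HasFDerivAt φ (fderiv ℝ φ w)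
        (P.orthogonalProjectionOnto ((w : EuclideanSpace ℝ (Fin n)) + φ w)) := by
      rw [orthogonalProjectionOnto_coe_add_coe]; exact hφ.hasFDerivAt
    have hd : HasFDerivAt h (Pᗮ.orthogonalProjectionOnto -
        (fderiv ℝ φ w).comp P.orthogonalProjectionOnto)
        ((w : EuclideanSpace ℝ (Fin n)) + φ w) :=
      Pᗮ.orthogonalProjectionOnto.hasFDerivAt.sub
        (hφ'.comp _ P.orthogonalProjectionOnto.hasFDerivAt)
    have h1 := (hd.hasFDerivWithinAt (s := graphOver P U φ)).mapsTo_tangent_cone hv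
    have h2 : tangentConeAt ℝ (h '' graphOver P U φ) (h ((w : EuclideanSpace ℝ (Fin n)) + φ w))
        ⊆ {0} := by
      refine tangentConeAt_subset_zero fun hacc => ?_
      have h3 : h '' graphOver P U φ ⊆ {0} := by
        rintro _ ⟨y, hy, rfl⟩
        exact sub_eq_zero.2 (mem_graphOver_iff.1 hy).2
      exact Set.Infinite.of_accPt hacc ((finite_singleton _).subset h3)
    have h4 := h2 h1
    rw [mem_singleton_iff, sub_apply, sub_eq_zero] at h4
    refine ⟨P.orthogonalProjectionOnto v, ?_⟩
    have h5 := coe_orthogonalProjectionOnto_add P v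
    rw [h4] at h5
    exact h5
  · rintro _ ⟨v, rfl⟩
    have hd : HasFDerivAt (fun w : P => (w : EuclideanSpace ℝ (Fin n)) + φ w)
        (P.subtypeL + Pᗮ.subtypeL.comp (fderiv ℝ φ w)) w :=
      P.subtypeL.hasFDerivAt.add (Pᗮ.subtypeL.hasFDerivAt.comp w hφ.hasFDerivAt)
    have h1 := (hd.hasFDerivWithinAt (s := U)).mapsTo_tangent_cone
    rw [tangentConeAt_of_mem_nhds (hU.mem_nhds hw)] at h1
    exact h1 (mem_univ v)

end GraphChart

/-- Multiplication by a bump supported where `f` is `C¹` yields the global bounds that the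
correction scheme requires, without changing `f` near `z₀`. -/
theorem exists_lipschitzWith_eventuallyEq {Z F : Type*} [NormedAddCommGroup Z] [NormedSpace ℝ Z]
    [FiniteDimensional ℝ Z] [NormedAddCommGroup F] [NormedSpace ℝ F] {f : Z → F} {z₀ : Z}
    (hf : ContDiffAt ℝ 1 f z₀) :
    ∃ (G : Z → F) (B : ℝ) (L : ℝ≥0), (∀ z, ‖G z‖ ≤ B) ∧ LipschitzWith L G ∧ G =ᶠ[𝓝 z₀] f := by
  obtain ⟨r, hr, hrf⟩ := Metric.eventually_nhds_iff.1 (hf.eventually (by simp))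
  let χ : ContDiffBump z₀ := ⟨r / 4, r / 2, by positivity, by linarith⟩
  have hsupp : tsupport (fun z => χ z • f z) ⊆ Metric.closedBall z₀ (r / 2) :=
    (tsupport_smul_subset_left _ _).trans χ.tsupport_eq.subset
  have hcs : HasCompactSupport (fun z => χ z • f z) := χ.hasCompactSupport.smul_right
  have hcd : ContDiff ℝ 1 (fun z => χ z • f z) := by
    rw [contDiff_iff_contDiffAt]
    intro z
    by_cases hz : z ∈ tsupport (fun z => χ z • f z)
    · refine χ.contDiff.contDiffAt.smul (hrf ?_)
      have := Metric.mem_closedBall.1 (hsupp hz)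
      linarith
    · refine (contDiffAt_const (c := (0 : F))).congr_of_eventuallyEq ?_
      exact notMem_tsupport_iff_eventuallyEq.1 hz
  obtain ⟨L, hL⟩ := hcd.lipschitzWith_of_hasCompactSupport hcs (by simp)
  obtain ⟨B, hB⟩ := hcs.exists_bound_of_continuous hcd.continuous
  refine ⟨_, B, L, hB, hL, ?_⟩
  filter_upwards [χ.eventuallyEq_one] with z hz
  simp [hz]

/-! ### The distribution as a field of graphs -/

section Distribution

variable {n k : ℕ} {Ω : Set (EuclideanSpace ℝ (Fin n))}
  {V : EuclideanSpace ℝ (Fin n) → Submodule ℝ (EuclideanSpace ℝ (Fin n))}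

/-- The map `A y` sending the basis `X i x₀` of `V x₀` to `X i y` has range `V y`. Its component `T
y` in `V x₀` is the identity at `x₀`, hence invertible nearby, and reparametrizing by its inverse
exhibits `V y` as a graph. -/
theorem IsC1Distribution.exists_graph (hV : IsC1Distribution k Ω V)
    {x₀ : EuclideanSpace ℝ (Fin n)} (hx₀ : x₀ ∈ Ω) :
    ∃ F : EuclideanSpace ℝ (Fin n) → (V x₀ →L[ℝ] (V x₀)ᗮ), ContDiffAt ℝ 1 F x₀ ∧
      ∀ᶠ y in 𝓝 x₀, (V y : Set (EuclideanSpace ℝ (Fin n))) =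
        range fun v : V x₀ => (v : EuclideanSpace ℝ (Fin n)) + F y v := by
  obtain ⟨O, hO, hxO, -, X, hX, hVX⟩ := hV.locally_spanned x₀ hx₀
  set P := V x₀ with hP
  have hmem : ∀ i, X i x₀ ∈ P := fun i => by
    rw [hP, hVX x₀ hxO]; exact Submodule.subset_span ⟨i, rfl⟩
  have hspan : ⊤ ≤ Submodule.span ℝ (range fun i => (⟨X i x₀, hmem i⟩ : P)) := by
    rintro ⟨v, hv⟩ -
    have hv' := hv
    rw [hP, hVX x₀ hxO] at hv'
    have hmap : v ∈ (Submodule.span ℝ (range fun i => (⟨X i x₀, hmem i⟩ : P))).map P.subtype := by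
      rw [Submodule.map_span, ← range_comp]
      exact hv'
    obtain ⟨u, hu, rfl⟩ := hmap
    exact hu
  have hcard : Fintype.card (Fin k) = Module.finrank ℝ P := by
    rw [Fintype.card_fin, hV.finrank_eq x₀ hx₀]
  let b : Module.Basis (Fin k) ℝ P := basisOfTopLeSpanOfCardEqFinrank _ hspan hcard
  have hb : ∀ i, b i = ⟨X i x₀, hmem i⟩ := fun i => by
    simp only [b, coe_basisOfTopLeSpanOfCardEqFinrank]
  let A : EuclideanSpace ℝ (Fin n) → (P →L[ℝ] EuclideanSpace ℝ (Fin n)) := fun y =>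
    ∑ i, (LinearMap.toContinuousLinearMap (b.coord i)).smulRight (X i y)
  have hAapp : ∀ y v, A y v = ∑ i, b.repr v i • X i y := fun y v => by
    simp [A]
  have hA : ContDiffAt ℝ 1 A x₀ := by
    refine ContDiffAt.sum fun i _ => ?_
    have hl : ContDiff ℝ 1 fun z : EuclideanSpace ℝ (Fin n) =>
        (LinearMap.toContinuousLinearMap (b.coord i)).smulRight z :=
      IsBoundedLinearMap.contDiff ⟨⟨fun x y => by ext; simp, fun c x => by
        ext; simp [smul_comm c]⟩, ‖LinearMap.toContinuousLinearMap (b.coord i)‖ + 1, by positivity,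
        fun x => by
          rw [ContinuousLinearMap.norm_smulRight_apply]; gcongr; linarith⟩
    exact hl.contDiffAt.comp x₀ ((hX i).contDiffAt (hO.mem_nhds hxO))
  have hAV : ∀ y ∈ O, (V y : Set (EuclideanSpace ℝ (Fin n))) = range (A y) := by
    intro y hy
    ext z
    rw [SetLike.mem_coe, hVX y hy, Submodule.mem_span_range_iff_exists_fun]
    constructor
    · rintro ⟨a, rfl⟩
      exact ⟨b.equivFun.symm a, by
        rw [hAapp]; simp only [← b.equivFun_apply, LinearEquiv.apply_symm_apply]⟩
    · rintro ⟨v, rfl⟩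
      exact ⟨b.repr v, (hAapp y v).symm⟩
  let T : EuclideanSpace ℝ (Fin n) → (P →L[ℝ] P) := fun y => P.orthogonalProjectionOnto.comp (A y)
  have hT : ContDiffAt ℝ 1 T x₀ := contDiffAt_const.clm_comp hA
  have hT1 : T x₀ = 1 := by
    ext1 v
    have : A x₀ v = v := by
      rw [hAapp]
      conv_rhs => rw [← b.sum_repr v]
      simp [hb]
    simp [T, this]
  have hT1' : IsUnit (T x₀) := by rw [hT1]; exact isUnit_one
  have hopen : {x : P →L[ℝ] P | IsUnit x} ∈ 𝓝 (T x₀) :=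
    (Units.isOpen (R := P →L[ℝ] P)).mem_nhds hT1'
  have hunit : ∀ᶠ y in 𝓝 x₀, IsUnit (T y) := hT.continuousAt hopen
  refine ⟨fun y => (Pᗮ.orthogonalProjectionOnto.comp (A y)).comp (Ring.inverse (T y)), ?_, ?_⟩
  · have hinv : ContDiffAt ℝ 1 Ring.inverse (T x₀) := by
      rw [hT1]
      exact contDiffAt_ringInverse ℝ (R := P →L[ℝ] P) 1
    exact (contDiffAt_const.clm_comp hA).clm_comp (hinv.comp x₀ hT)
  · filter_upwards [hunit, hO.mem_nhds hxO] with y hy hyO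
    have hTi : ∀ v, T y (Ring.inverse (T y) v) = v := fun v =>
      DFunLike.congr_fun (Ring.mul_inverse_cancel _ hy) v
    have hTi' : ∀ v, Ring.inverse (T y) (T y v) = v := fun v =>
      DFunLike.congr_fun (Ring.inverse_mul_cancel _ hy) v
    have key : ∀ v : P, (v : EuclideanSpace ℝ (Fin n)) +
        Pᗮ.orthogonalProjectionOnto (A y (Ring.inverse (T y) v)) = A y (Ring.inverse (T y) v) := by
      intro v
      conv_rhs => rw [← coe_orthogonalProjectionOnto_add P (A y (Ring.inverse (T y) v))]
      congr 2
      exact (hTi v).symm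
    rw [hAV y hyO]
    ext z
    constructor
    · rintro ⟨v, rfl⟩
      exact ⟨T y v, by simpa [hTi'] using key (T y v)⟩
    · rintro ⟨v, rfl⟩
      exact ⟨_, (key v).symm⟩

end Distribution

/-! ### Round spheres as unions of graphs -/

section RoundSphere

variable {n k : ℕ}

/-- The sphere of radius `R` centred at `c` in the affine space `c + W`. -/
def sphereIn (W : Submodule ℝ (EuclideanSpace ℝ (Fin n))) (c : EuclideanSpace ℝ (Fin n)) (R : ℝ) :
    Set (EuclideanSpace ℝ (Fin n)) :=
  {y | y - c ∈ W ∧ ‖y - c‖ = R}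

/-- The upper half of the sphere of radius `R` centred at `c` in `c + (P ⊕ ℝ η)`, as a graph over
the ball in `P`. -/
noncomputable def capFun (P : Submodule ℝ (EuclideanSpace ℝ (Fin n))) (η : Pᗮ) (c : EuclideanSpace ℝ (Fin n))
    (R : ℝ) (w : P) : Pᗮ :=
  Pᗮ.orthogonalProjectionOnto c + √(R ^ 2 - ‖w - P.orthogonalProjectionOnto c‖ ^ 2) • η

theorem isClosed_sphereIn (W : Submodule ℝ (EuclideanSpace ℝ (Fin n)))
    (c : EuclideanSpace ℝ (Fin n)) (R : ℝ) : IsClosed (sphereIn W c R) := by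
  refine IsClosed.inter ?_ ?_
  · exact W.closed_of_finiteDimensional.preimage (continuous_id.sub continuous_const)
  · exact isClosed_eq (continuous_id.sub continuous_const).norm continuous_const

variable {P : Submodule ℝ (EuclideanSpace ℝ (Fin n))} {η : Pᗮ} {c : EuclideanSpace ℝ (Fin n)}
  {R : ℝ}

theorem sq_sub_sq_pos_of_mem_ball {w w₀ : P} (hw : w ∈ Metric.ball w₀ R) :
    0 < R ^ 2 - ‖w - w₀‖ ^ 2 := by
  rw [mem_ball_iff_norm] at hw
  nlinarith [norm_nonneg (w - w₀)]

theorem contDiffAt_capFun {m : WithTop ℕ∞} {w : P}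
    (hw : w ∈ Metric.ball (P.orthogonalProjectionOnto c) R) :
    ContDiffAt ℝ m (capFun P η c R) w := by
  have h : ContDiffAt ℝ m
      (fun w : P => R ^ 2 - ‖w - P.orthogonalProjectionOnto c‖ ^ 2) w :=
    contDiffAt_const.sub ((contDiff_norm_sq ℝ).contDiffAt.comp w
      (contDiffAt_id.sub contDiffAt_const))
  exact contDiffAt_const.add
    ((h.sqrt (sq_sub_sq_pos_of_mem_ball hw).ne').smul contDiffAt_const)

theorem inner_coe_add_coe_sub (w : P) (v : Pᗮ) :
    inner ℝ (η : EuclideanSpace ℝ (Fin n)) ((w : EuclideanSpace ℝ (Fin n)) + v - c) =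
      inner ℝ η (v - Pᗮ.orthogonalProjectionOnto c) := by
  have hc := coe_orthogonalProjectionOnto_add P c
  have h1 : (w : EuclideanSpace ℝ (Fin n)) + v - c =
      ((w - P.orthogonalProjectionOnto c : P) : EuclideanSpace ℝ (Fin n)) +
        ((v - Pᗮ.orthogonalProjectionOnto c : Pᗮ) : EuclideanSpace ℝ (Fin n)) := by
    conv_lhs => rw [← hc]
    push_cast
    abel
  rw [h1, inner_add_right, Submodule.inner_left_of_mem_orthogonal (SetLike.coe_mem _) η.2, zero_add]
  rfl

theorem inner_graph_capFun_add (hη : ‖η‖ = 1) (w : P) (v : Pᗮ) :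
    inner ℝ (η : EuclideanSpace ℝ (Fin n))
      ((w : EuclideanSpace ℝ (Fin n)) + (capFun P η c R w + v : Pᗮ) - c) =
      √(R ^ 2 - ‖w - P.orthogonalProjectionOnto c‖ ^ 2) + inner ℝ η v := by
  rw [inner_coe_add_coe_sub, capFun, add_assoc, add_sub_cancel_left, inner_add_right,
    inner_smul_right, real_inner_self_eq_norm_sq, hη]
  ring

theorem mem_sphereIn_iff {W : Submodule ℝ (EuclideanSpace ℝ (Fin n))} (hη : ‖η‖ = 1)
    (hW : W = P ⊔ Submodule.span ℝ {(η : EuclideanSpace ℝ (Fin n))}) (hR : 0 ≤ R)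
    {y : EuclideanSpace ℝ (Fin n)} :
    y ∈ sphereIn W c R ↔ ∃ t : ℝ,
      Pᗮ.orthogonalProjectionOnto y = Pᗮ.orthogonalProjectionOnto c + t • η ∧
      ‖P.orthogonalProjectionOnto y - P.orthogonalProjectionOnto c‖ ^ 2 + t ^ 2 = R ^ 2 := by
  have hnorm : ‖y - c‖ ^ 2 = ‖P.orthogonalProjectionOnto y - P.orthogonalProjectionOnto c‖ ^ 2 +
      ‖Pᗮ.orthogonalProjectionOnto y - Pᗮ.orthogonalProjectionOnto c‖ ^ 2 := by
    rw [← map_sub, ← map_sub]; exact Submodule.norm_sq_eq_add_norm_sq_projection _ _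
  have hnt : ∀ t : ℝ, ‖t • η‖ ^ 2 = t ^ 2 := fun t => by
    rw [norm_smul, hη, mul_one, Real.norm_eq_abs, sq_abs]
  constructor
  · rintro ⟨h1, h2⟩
    rw [hW, Submodule.mem_sup] at h1
    obtain ⟨p, hp, z, hz, hpz⟩ := h1
    obtain ⟨t, rfl⟩ := Submodule.mem_span_singleton.1 hz
    have h3 : Pᗮ.orthogonalProjectionOnto (y - c) = t • η := by
      rw [← hpz]
      exact orthogonalProjectionOnto_orthogonal_coe_add_coe (⟨p, hp⟩ : P) (t • η)
    rw [map_sub] at h3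
    refine ⟨t, by rw [← h3]; abel, ?_⟩
    rw [← hnt t, ← h3, ← hnorm, h2]
  · rintro ⟨t, h1, h2⟩
    have h3 : Pᗮ.orthogonalProjectionOnto (y - c) = t • η := by rw [map_sub, h1]; abel
    constructor
    · rw [hW, ← coe_orthogonalProjectionOnto_add P (y - c), h3]
      exact Submodule.add_mem_sup (SetLike.coe_mem _)
        (Submodule.smul_mem _ _ (Submodule.mem_span_singleton_self _))
    · rw [map_sub] at h3
      rw [h3, hnt, h2] at hnorm
      exact (sq_eq_sq₀ (norm_nonneg _) hR).1 hnorm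

theorem sphereIn_inter_halfSpace {W : Submodule ℝ (EuclideanSpace ℝ (Fin n))} (hη : ‖η‖ = 1)
    (hW : W = P ⊔ Submodule.span ℝ {(η : EuclideanSpace ℝ (Fin n))}) (hR : 0 ≤ R) :
    sphereIn W c R ∩ {y | 0 < inner ℝ (η : EuclideanSpace ℝ (Fin n)) (y - c)} =
      graphOver P (Metric.ball (P.orthogonalProjectionOnto c) R) (capFun P η c R) := by
  ext y
  have hin : inner ℝ (η : EuclideanSpace ℝ (Fin n)) (y - c) =
      inner ℝ η (Pᗮ.orthogonalProjectionOnto y - Pᗮ.orthogonalProjectionOnto c) := by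
    conv_lhs => rw [← coe_orthogonalProjectionOnto_add P y]
    exact inner_coe_add_coe_sub _ _
  have hit : ∀ t : ℝ, inner ℝ η (t • η) = t := fun t => by
    rw [inner_smul_right, real_inner_self_eq_norm_sq, hη]; ring
  rw [mem_inter_iff, mem_sphereIn_iff hη hW hR, mem_graphOver_iff, Set.mem_ofPred_eq, hin]
  constructor
  · rintro ⟨⟨t, h1, h2⟩, h3⟩
    rw [h1, add_sub_cancel_left, hit] at h3
    refine ⟨?_, ?_⟩
    · rw [mem_ball_iff_norm]
      exact lt_of_pow_lt_pow_left₀ 2 hR (by nlinarith)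
    · rw [h1, capFun, ← h2, add_sub_cancel_left, Real.sqrt_sq h3.le]
  · rintro ⟨h1, h2⟩
    have h3 := sq_sub_sq_pos_of_mem_ball h1
    refine ⟨⟨_, h2, ?_⟩, ?_⟩
    · rw [Real.sq_sqrt h3.le]; ring
    · rw [h2, capFun, add_sub_cancel_left, hit]
      exact Real.sqrt_pos.2 h3

/-- The radial unit vector at `y` serves as pole: `y` is then the top of its own hemisphere, a graph
over the orthogonal complement of that vector in `W`. -/
theorem exists_smooth_chart_sphereIn {W : Submodule ℝ (EuclideanSpace ℝ (Fin n))}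
    (hWk : Module.finrank ℝ W = k + 1) (hR : 0 < R) {y : EuclideanSpace ℝ (Fin n)}
    (hy : y ∈ sphereIn W c R) :
    ∃ (P : Submodule ℝ (EuclideanSpace ℝ (Fin n))) (U : Set P) (φ : P → Pᗮ),
      IsC1GraphChart k (sphereIn W c R) P U φ ∧ y ∈ graphOver P U φ ∧
        ∀ w ∈ U, ContDiffAt ℝ 2 φ w := by
  obtain ⟨hyW, hyR⟩ := hy
  set η : EuclideanSpace ℝ (Fin n) := R⁻¹ • (y - c) with hη
  have hη1 : ‖η‖ = 1 := by
    rw [hη, norm_smul, hyR, Real.norm_eq_abs, abs_of_pos (inv_pos.2 hR), inv_mul_cancel₀ hR.ne']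
  have hηW : Submodule.span ℝ {η} ≤ W := by
    rw [Submodule.span_singleton_le_iff_mem]; exact W.smul_mem _ hyW
  set P := (Submodule.span ℝ {η})ᗮ ⊓ W with hP
  have hηP : η ∈ Pᗮ := Submodule.orthogonal_le inf_le_left
    (Submodule.le_orthogonal_orthogonal _ (Submodule.mem_span_singleton_self η))
  have hW : W = P ⊔ Submodule.span ℝ {((⟨η, hηP⟩ : Pᗮ) : EuclideanSpace ℝ (Fin n))} := by
    rw [sup_comm]
    exact (Submodule.sup_orthogonal_inf_of_hasOrthogonalProjection hηW).symm
  have hPk : Module.finrank ℝ P = k := by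
    have h1 := Submodule.finrank_add_inf_finrank_orthogonal hηW
    have h2 : Module.finrank ℝ (Submodule.span ℝ {η}) = 1 :=
      finrank_span_singleton (by rintro h; simp [h] at hη1)
    rw [h2, hWk] at h1
    rw [hP]
    omega
  have hη1' : ‖(⟨η, hηP⟩ : Pᗮ)‖ = 1 := hη1
  have key := sphereIn_inter_halfSpace (c := c) hη1' hW hR.le
  refine ⟨P, _, _, ⟨hPk, Metric.isOpen_ball,
    fun w hw => (contDiffAt_capFun hw).contDiffWithinAt, _, ?_, key⟩, ?_,
    fun w hw => contDiffAt_capFun hw⟩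
  · exact isOpen_lt continuous_const (by fun_prop)
  · rw [← key]
    refine ⟨⟨hyW, hyR⟩, ?_⟩
    change 0 < inner ℝ η (y - c)
    rw [hη, real_inner_smul_left, real_inner_self_eq_norm_sq, hyR]
    positivity

end RoundSphere

/-! ### Hausdorff measure of Lipschitz images and indicators in `W^{s,1}` -/

theorem setLIntegral_image_hausdorffMeasure_le {X Y : Type*} [EMetricSpace X] [MeasurableSpace X]
    [BorelSpace X] [EMetricSpace Y] [MeasurableSpace Y] [BorelSpace Y] {g : X → Y} {A : Set X}
    {L : ℝ≥0} (hg : LipschitzOnWith L g A) (hA : MeasurableSet A) {d : ℝ} (hd : 0 ≤ d)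
    {f : Y → ℝ≥0∞} (hf : Measurable f) :
    ∫⁻ y in g '' A, f y ∂μH[d] ≤ (L : ℝ≥0∞) ^ d * ∫⁻ x in A, f (g x) ∂μH[d] := by
  have hgm : AEMeasurable g (μH[d].restrict A) := hg.continuousOn.aemeasurable hA
  -- A one-sided substitute for the area formula, which is all that upper bounds need.
  have hle : μH[d].restrict (g '' A) ≤ ((L : ℝ≥0∞) ^ d) • (μH[d].restrict A).map g := by
    refine Measure.le_iff.2 fun T hT => ?_
    rw [Measure.restrict_apply hT, Measure.smul_apply, Measure.map_apply_of_aemeasurable hgm hT,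
      smul_eq_mul, inter_comm, ← image_inter_preimage]
    refine ((hg.mono inter_subset_left).hausdorffMeasure_image_le hd).trans ?_
    rw [inter_comm]
    exact mul_le_mul_right (Measure.le_restrict_apply _ _) _
  refine (lintegral_mono' hle le_rfl).trans_eq ?_
  rw [lintegral_smul_measure, lintegral_map' hf.aemeasurable hgm, smul_eq_mul]

/-- On `K` the distance to `w` is at least `dist(w, K)`, so the kernel coincides with its truncation
at that radius, whose integral over the whole space is known. -/
theorem exists_setLIntegral_inv_edist_rpow_le {X : Type*} [NormedAddCommGroup X]
    [NormedSpace ℝ X] [FiniteDimensional ℝ X] [MeasurableSpace X] [BorelSpace X] (μ : Measure X)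
    [μ.IsAddHaarMeasure] {s : ℝ} (hs : 0 < s) :
    ∃ C : ℝ≥0∞, C < ∞ ∧ ∀ K : Set X, IsClosed K → ∀ w ∉ K,
      ∫⁻ v in K, (edist v w ^ (s + Module.finrank ℝ X))⁻¹ ∂μ ≤ C * Metric.infEDist w K ^ (-s) := by
  obtain ⟨C, hC, h⟩ := exists_lintegral_max_rpow_le μ hs
  refine ⟨C, hC, fun K hK w hw => ?_⟩
  rcases K.eq_empty_or_nonempty with rfl | hne
  · simp
  have hr : 0 < Metric.infDist w K := (hK.notMem_iff_infDist_pos hne).1 hw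
  have hd : 0 ≤ s + Module.finrank ℝ X := by positivity
  have hr' : Metric.infEDist w K = ENNReal.ofReal (Metric.infDist w K) :=
    (ENNReal.ofReal_toReal (Metric.infEDist_ne_top hne)).symm
  calc ∫⁻ v in K, (edist v w ^ (s + Module.finrank ℝ X))⁻¹ ∂μ
      ≤ ∫⁻ v in K, ENNReal.ofReal
          ((max ‖v - w‖ (Metric.infDist w K)) ^ (-(s + Module.finrank ℝ X))) ∂μ := by
        refine setLIntegral_mono' hK.measurableSet fun v hv => ?_
        have h1 : Metric.infDist w K ≤ ‖v - w‖ := by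
          rw [← dist_eq_norm, dist_comm]; exact Metric.infDist_le_dist_of_mem hv
        rw [max_eq_left h1, ← ENNReal.rpow_neg, edist_dist, dist_eq_norm,
          ENNReal.ofReal_rpow_of_pos (hr.trans_le h1)]
    _ ≤ ∫⁻ v, ENNReal.ofReal
          ((max ‖v - w‖ (Metric.infDist w K)) ^ (-(s + Module.finrank ℝ X))) ∂μ :=
        setLIntegral_le_lintegral _ _
    _ = ∫⁻ v, ENNReal.ofReal
          ((max ‖v‖ (Metric.infDist w K)) ^ (-(s + Module.finrank ℝ X))) ∂μ :=
        lintegral_sub_right_eq_self (μ := μ) (fun v => ENNReal.ofReal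
          ((max ‖v‖ (Metric.infDist w K)) ^ (-(s + Module.finrank ℝ X)))) w
    _ ≤ C * ENNReal.ofReal (Metric.infDist w K ^ (-s)) := h _ hr
    _ = C * Metric.infEDist w K ^ (-s) := by
        rw [hr', ENNReal.ofReal_rpow_of_pos hr]

/-- Only pairs with exactly one point in `A` contribute; by symmetry and Tonelli the seminorm is
controlled by one mixed integral. -/
theorem memFracSobolev_one_indicator {X : Type*} [MetricSpace X] [MeasurableSpace X] [BorelSpace X]
    [SecondCountableTopology X] {d : ℕ} {s : ℝ} {μ : Measure X} {S A : Set X}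
    (hA : MeasurableSet A) (hAS : A ⊆ S) (hμA : μ A ≠ ∞)
    [SFinite (μ.restrict S)]
    (h : ∫⁻ y in S \ A, ∫⁻ x in A, (edist x y ^ (s + d))⁻¹ ∂μ ∂μ < ∞) :
    MemFracSobolev d s 1 μ S (A.indicator fun _ => (1 : ℝ)) := by
  rw [MemFracSobolev, if_neg ENNReal.one_ne_top]
  refine ⟨memLp_indicator_const 1 hA 1 (Or.inr
    ((Measure.restrict_apply_le _ _).trans_lt hμA.lt_top).ne), ?_⟩
  simp only [ENNReal.toReal_one, ENNReal.rpow_one, mul_one]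
  have hrestr : ∀ B : Set X, MeasurableSet B → ∀ f : X → ℝ≥0∞,
      ∫⁻ y in S, B.indicator f y ∂μ = ∫⁻ y in B ∩ S, f y ∂μ := fun B hB f => by
    rw [lintegral_indicator hB, Measure.restrict_restrict hB]
  have hAS' : A ∩ S = A := inter_eq_left.2 hAS
  have hcS : Aᶜ ∩ S = S \ A := by rw [inter_comm, Set.sdiff_eq]
  have hin : ∀ x ∈ A, ∫⁻ y in S, ‖A.indicator (fun _ => (1 : ℝ)) x -
      A.indicator (fun _ => (1 : ℝ)) y‖ₑ / edist x y ^ (s + d) ∂μ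
      = ∫⁻ y in S \ A, (edist x y ^ (s + d))⁻¹ ∂μ := by
    intro x hx
    rw [← hcS, ← hrestr _ hA.compl]
    refine lintegral_congr fun y => ?_
    by_cases hy : y ∈ A <;> simp [hx, hy]
  have hout : ∀ x ∉ A, ∫⁻ y in S, ‖A.indicator (fun _ => (1 : ℝ)) x -
      A.indicator (fun _ => (1 : ℝ)) y‖ₑ / edist x y ^ (s + d) ∂μ
      = ∫⁻ y in A, (edist y x ^ (s + d))⁻¹ ∂μ := by
    intro x hx
    have h1 := hrestr _ hA fun y => (edist y x ^ (s + d))⁻¹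
    rw [hAS'] at h1
    rw [← h1]
    refine lintegral_congr fun y => ?_
    by_cases hy : y ∈ A <;> simp [hx, hy, edist_comm]
  have : SFinite (μ.restrict A) := by
    rw [← hAS', ← Measure.restrict_restrict hA]; infer_instance
  have : SFinite (μ.restrict (S \ A)) := by
    rw [← hcS, ← Measure.restrict_restrict hA.compl]; infer_instance
  rw [← lintegral_add_compl _ hA, Measure.restrict_restrict hA, Measure.restrict_restrict hA.compl,
    hAS', hcS, setLIntegral_congr_fun hA hin]
  have h2 : ∫⁻ x in S \ A, ∫⁻ y in S, ‖A.indicator (fun _ => (1 : ℝ)) x -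
      A.indicator (fun _ => (1 : ℝ)) y‖ₑ / edist x y ^ (s + d) ∂μ ∂μ
      ≤ ∫⁻ x in S \ A, ∫⁻ y in A, (edist y x ^ (s + d))⁻¹ ∂μ ∂μ := by
    rw [← hcS, ← Measure.restrict_restrict hA.compl]
    exact (setLIntegral_congr_fun hA.compl hout).le
  have hswap : ∫⁻ x in A, ∫⁻ y in S \ A, (edist x y ^ (s + d))⁻¹ ∂μ ∂μ
      = ∫⁻ y in S \ A, ∫⁻ x in A, (edist x y ^ (s + d))⁻¹ ∂μ ∂μ := by
    refine lintegral_lintegral_swap (Measurable.aemeasurable ?_)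
    exact ((measurable_edist).pow_const _).inv
  rw [hswap]
  exact ENNReal.add_lt_top.2 ⟨h, h2.trans_lt h⟩

/-- Locally `S` is a Lipschitz image of a ball of a `k`-plane, and compactness makes local
finiteness global. -/
theorem IsCompact.hausdorffMeasure_lt_top_of_isC1Submanifold {n k : ℕ}
    {S : Set (EuclideanSpace ℝ (Fin n))} (hS : IsCompact S) (hS' : IsC1Submanifold k S) :
    μH[(k : ℝ)] S < ∞ := by
  refine hS.measure_lt_top_of_nhdsWithin fun x hx => ?_
  obtain ⟨P, U, φ, hc, w, hw, rfl⟩ := hS' x hx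
  obtain ⟨L, t, ht, hL⟩ := ((hc.contDiffOn.contDiffAt (hc.isOpen.mem_nhds hw)).continuousLinearMap_comp
    Pᗮ.subtypeL |> (P.subtypeL.contDiff.contDiffAt.add)).exists_lipschitzOnWith
  obtain ⟨r, hr, hrt⟩ := Metric.mem_nhds_iff.1 (Filter.inter_mem ht (hc.isOpen.mem_nhds hw))
  obtain ⟨O, hO, hg⟩ := (hc.restrict Metric.isOpen_ball (hrt.trans inter_subset_right)).graph_eq
  have hxO : (w : EuclideanSpace ℝ (Fin n)) + φ w ∈ S ∩ O := by
    rw [hg]; exact coe_add_coe_mem_graphOver (Metric.mem_ball_self hr)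
  refine ⟨S ∩ O, inter_mem self_mem_nhdsWithin (mem_nhdsWithin_of_mem_nhds (hO.mem_nhds hxO.2)), ?_⟩
  rw [hg]
  refine ((hL.mono (hrt.trans inter_subset_left)).hausdorffMeasure_image_le
    (Nat.cast_nonneg k)).trans_lt ?_
  refine ENNReal.mul_lt_top (ENNReal.rpow_lt_top_of_nonneg (by positivity) ENNReal.coe_ne_top) ?_
  rw [← hc.finrank_eq]
  exact measure_ball_lt_top

theorem exists_hausdorffMeasure_finrank_eq_smul_volume (X : Type*) [NormedAddCommGroup X]
    [InnerProductSpace ℝ X] [FiniteDimensional ℝ X] [MeasurableSpace X] [BorelSpace X] :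
    ∃ c : ℝ≥0, c ≠ 0 ∧ (μH[(Module.finrank ℝ X : ℝ)] : Measure X) = c • volume :=
  ⟨_, (Measure.addHaarScalarFactor_pos_of_isAddHaarMeasure _ _).ne',
    Measure.isAddLeftInvariant_eq_smul _ _⟩

section HausdorffImage

variable {X Y : Type*} [NormedAddCommGroup X] [InnerProductSpace ℝ X] [FiniteDimensional ℝ X]
  [MeasurableSpace X] [BorelSpace X] [MetricSpace Y] [MeasurableSpace Y] [BorelSpace Y] {k : ℕ} {s : ℝ} {g : X → Y} {L : ℝ≥0} {Q K : Set X}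

/-- The inverse of `g` on `g '' K` is `1`-Lipschitz, so the image has at least the Hausdorff measure
of `K`. -/
theorem hausdorffMeasure_image_pos (hk : Module.finrank ℝ X = k)
    (hgi : ∀ v ∈ K, ∀ w ∈ K, edist v w ≤ edist (g v) (g w)) (hK : 0 < volume K) :
    0 < μH[(k : ℝ)] (g '' K) := by
  subst hk
  obtain ⟨c, hc, hμ⟩ := exists_hausdorffMeasure_finrank_eq_smul_volume X
  have h1 : 0 < μH[(Module.finrank ℝ X : ℝ)] K := by
    rw [hμ, Measure.smul_apply]
    exact ENNReal.mul_pos (by simpa using hc) hK.ne'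
  have hinj : InjOn g K := fun v hv w hw h => by
    have := hgi v hv w hw
    rw [h, edist_self] at this
    exact edist_le_zero.1 this
  have hL : LipschitzOnWith 1 (Function.invFunOn g K) (g '' K) := by
    rintro _ ⟨v, hv, rfl⟩ _ ⟨w, hw, rfl⟩
    rw [hinj.leftInvOn_invFunOn hv, hinj.leftInvOn_invFunOn hw, ENNReal.coe_one, one_mul]
    exact hgi v hv w hw
  have h2 := hL.hausdorffMeasure_image_le (d := (Module.finrank ℝ X : ℝ)) (Nat.cast_nonneg _)
  rw [hinj.leftInvOn_invFunOn.image_image] at h2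
  simpa using h1.trans_le h2

/-- The complement of `g '' K` in `S` splits into `g '' (Q \ K)` and the far part. On the first, `g`
does not decrease distances, so the kernel is at most the one on `X` and its inner integral is at
most a multiple of `dist(w, K) ^ (-s)`. -/
theorem memFracSobolev_one_indicator_image [SecondCountableTopology Y] (hk : Module.finrank ℝ X = k) (hs : 0 < s)
    (hg : LipschitzOnWith L g Q) (hgi : ∀ v ∈ Q, ∀ w ∈ Q, edist v w ≤ edist (g v) (g w))
    (hQ : MeasurableSet Q) (hK : IsCompact K) (hKQ : K ⊆ Q)
    (hfin : ∫⁻ w in Q \ K, Metric.infEDist w K ^ (-s) < ∞)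
    {S : Set Y} (hQS : g '' Q ⊆ S) [SFinite ((μH[(k : ℝ)] : Measure Y).restrict S)]
    (hfar : ∫⁻ y in S \ g '' Q, ∫⁻ x in g '' K, (edist x y ^ (s + k))⁻¹ ∂μH[(k : ℝ)] ∂μH[(k : ℝ)]
      < ∞) :
    MemFracSobolev k s 1 μH[(k : ℝ)] S ((g '' K).indicator fun _ => (1 : ℝ)) := by
  subst hk
  set d := Module.finrank ℝ X with hd
  have hL' : (L : ℝ≥0∞) ^ (d : ℝ) ≠ ∞ := by simp
  have hgK : IsCompact (g '' K) := hK.image_of_continuousOn (hg.mono hKQ).continuousOn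
  have hμK : (μH[(d : ℝ)] : Measure Y) (g '' K) ≠ ∞ :=
    (((hg.mono hKQ).hausdorffMeasure_image_le (Nat.cast_nonneg d)).trans_lt
      (ENNReal.mul_lt_top hL'.lt_top hK.measure_lt_top)).ne
  refine memFracSobolev_one_indicator hgK.measurableSet ((image_mono hKQ).trans hQS) hμK ?_
  have hsub : S \ g '' K ⊆ g '' (Q \ K) ∪ S \ g '' Q := by
    rintro y ⟨hyS, hyK⟩
    by_cases hy : y ∈ g '' Q
    · obtain ⟨w, hw, rfl⟩ := hy
      exact Or.inl ⟨w, ⟨hw, fun h => hyK ⟨w, h, rfl⟩⟩, rfl⟩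
    · exact Or.inr ⟨hyS, hy⟩
  refine (lintegral_mono_set hsub).trans_lt ((lintegral_union_le _ _ _).trans_lt
    (ENNReal.add_lt_top.2 ⟨?_, hfar⟩))
  have : IsFiniteMeasure ((μH[(d : ℝ)] : Measure Y).restrict (g '' K)) :=
    ⟨by rw [Measure.restrict_apply_univ]; exact hμK.lt_top⟩
  have hkm : Measurable fun z : Y × Y => (edist z.1 z.2 ^ (s + d))⁻¹ :=
    (measurable_edist.pow_const _).inv
  obtain ⟨C, hC, hCK⟩ := exists_setLIntegral_inv_edist_rpow_le (μH[(d : ℝ)] : Measure X) hs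
  obtain ⟨c, -, hμ⟩ := exists_hausdorffMeasure_finrank_eq_smul_volume X
  have hinner : ∀ w ∈ Q \ K, ∫⁻ x in g '' K, (edist x (g w) ^ (s + d))⁻¹ ∂μH[(d : ℝ)] ≤
      (L : ℝ≥0∞) ^ (d : ℝ) * (C * Metric.infEDist w K ^ (-s)) := by
    intro w hw
    refine (setLIntegral_image_hausdorffMeasure_le (hg.mono hKQ) hK.measurableSet
      (Nat.cast_nonneg d) (hkm.comp measurable_prodMk_right)).trans ?_
    gcongr
    refine le_trans (setLIntegral_mono' hK.measurableSet fun v hv => ?_)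
      (hCK K hK.isClosed w hw.2)
    have := hgi v (hKQ hv) w hw.1
    have hsd : 0 ≤ s + d := by positivity
    exact ENNReal.inv_le_inv.2 (ENNReal.rpow_le_rpow this hsd)
  refine (setLIntegral_image_hausdorffMeasure_le (hg.mono sdiff_subset) (hQ.diff hK.measurableSet)
    (Nat.cast_nonneg d) hkm.lintegral_prod_left').trans_lt ?_
  refine ENNReal.mul_lt_top hL'.lt_top ?_
  refine (setLIntegral_mono' (hQ.diff hK.measurableSet) hinner).trans_lt ?_
  have hm : Measurable fun w => Metric.infEDist w K ^ (-s) :=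
    (Metric.continuous_infEDist.measurable).pow_const _
  rw [lintegral_const_mul _ (hm.const_mul _), lintegral_const_mul _ hm, hμ, Measure.restrict_smul,
    lintegral_smul_measure]
  exact ENNReal.mul_lt_top hL'.lt_top (ENNReal.mul_lt_top hC
    (ENNReal.mul_lt_top ENNReal.coe_lt_top hfin))

end HausdorffImage

/-! ### Gluing the graph into a round sphere -/

section PerturbedSphere

variable {n k : ℕ} {P : Submodule ℝ (EuclideanSpace ℝ (Fin n))} {η : Pᗮ}
  {c : EuclideanSpace ℝ (Fin n)} {R ρ : ℝ} {u : P → Pᗮ}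

/-- The round sphere of radius `R` centred at `c` in `c + (P ⊕ ℝ η)`, with its upper half replaced
by the graph of `capFun P η c R + u`. -/
def perturbedSphere (P : Submodule ℝ (EuclideanSpace ℝ (Fin n))) (η : Pᗮ)
    (c : EuclideanSpace ℝ (Fin n)) (R : ℝ) (u : P → Pᗮ) : Set (EuclideanSpace ℝ (Fin n)) :=
  graphOver P (Metric.ball (P.orthogonalProjectionOnto c) R) (capFun P η c R + u) ∪
    (sphereIn (P ⊔ Submodule.span ℝ {(η : EuclideanSpace ℝ (Fin n))}) c R ∩
      {y | inner ℝ (η : EuclideanSpace ℝ (Fin n)) (y - c) ≤ 0})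

theorem isOpen_upperHalf (η : Pᗮ) (c : EuclideanSpace ℝ (Fin n)) :
    IsOpen {y | 0 < inner ℝ (η : EuclideanSpace ℝ (Fin n)) (y - c)} :=
  isOpen_lt continuous_const (by fun_prop)

/-- Over the ball of radius `ρ < R/2` the cap has height at least `√(R² - ρ²) > ρ`, so the
perturbation cannot reach the equatorial hyperplane. -/
theorem graphOver_capFun_add_subset_upperHalf (hη : ‖η‖ = 1) (hρ : 0 < ρ) (hρR : ρ < R / 2)
    (hu : ∀ w, ‖u w‖ ≤ ρ)
    (hu0 : ∀ w ∉ Metric.closedBall (P.orthogonalProjectionOnto c) ρ, u w = 0) :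
    graphOver P (Metric.ball (P.orthogonalProjectionOnto c) R) (capFun P η c R + u) ⊆
      {y | 0 < inner ℝ (η : EuclideanSpace ℝ (Fin n)) (y - c)} := by
  rintro _ ⟨w, hw, rfl⟩
  change 0 < inner ℝ (η : EuclideanSpace ℝ (Fin n))
    ((w : EuclideanSpace ℝ (Fin n)) + (capFun P η c R w + u w : Pᗮ) - c)
  rw [inner_graph_capFun_add hη]
  by_cases hwρ : w ∈ Metric.closedBall (P.orthogonalProjectionOnto c) ρ
  · have h1 : ρ < √(R ^ 2 - ‖w - P.orthogonalProjectionOnto c‖ ^ 2) := by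
      rw [mem_closedBall_iff_norm] at hwρ
      refine Real.lt_sqrt_of_sq_lt ?_
      nlinarith [norm_nonneg (w - P.orthogonalProjectionOnto c)]
    have h2 := abs_real_inner_le_norm η (u w)
    rw [hη, one_mul] at h2
    linarith [hu w, neg_abs_le (inner ℝ η (u w))]
  · rw [hu0 w hwρ, inner_zero_right, add_zero]
    exact Real.sqrt_pos.2 (sq_sub_sq_pos_of_mem_ball hw)

theorem perturbedSphere_inter_upperHalf (hη : ‖η‖ = 1) (hρ : 0 < ρ) (hρR : ρ < R / 2)
    (hu : ∀ w, ‖u w‖ ≤ ρ)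
    (hu0 : ∀ w ∉ Metric.closedBall (P.orthogonalProjectionOnto c) ρ, u w = 0) :
    perturbedSphere P η c R u ∩ {y | 0 < inner ℝ (η : EuclideanSpace ℝ (Fin n)) (y - c)} =
      graphOver P (Metric.ball (P.orthogonalProjectionOnto c) R) (capFun P η c R + u) := by
  apply Subset.antisymm
  · rintro y ⟨hy | hy, hyH⟩
    · exact hy
    · exact absurd (show 0 < inner ℝ (η : EuclideanSpace ℝ (Fin n)) (y - c) from hyH) (not_lt.2 hy.2)
  · exact fun y hy => ⟨Or.inl hy, graphOver_capFun_add_subset_upperHalf hη hρ hρR hu hu0 hy⟩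

theorem mem_perturbedSphere_iff_of_upperHalf (hη : ‖η‖ = 1) (hρ : 0 < ρ) (hρR : ρ < R / 2)
    (hu : ∀ w, ‖u w‖ ≤ ρ)
    (hu0 : ∀ w ∉ Metric.closedBall (P.orthogonalProjectionOnto c) ρ, u w = 0)
    {y : EuclideanSpace ℝ (Fin n)}
    (hy : 0 < inner ℝ (η : EuclideanSpace ℝ (Fin n)) (y - c))
    (hyu : u (P.orthogonalProjectionOnto y) = 0) :
    y ∈ perturbedSphere P η c R u ↔
      y ∈ sphereIn (P ⊔ Submodule.span ℝ {(η : EuclideanSpace ℝ (Fin n))}) c R := by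
  have h1 : y ∈ perturbedSphere P η c R u ↔ y ∈ perturbedSphere P η c R u ∩
      {y | 0 < inner ℝ (η : EuclideanSpace ℝ (Fin n)) (y - c)} := ⟨fun h => ⟨h, hy⟩, fun h => h.1⟩
  have h2 : y ∈ sphereIn (P ⊔ Submodule.span ℝ {(η : EuclideanSpace ℝ (Fin n))}) c R ↔
      y ∈ sphereIn (P ⊔ Submodule.span ℝ {(η : EuclideanSpace ℝ (Fin n))}) c R ∩
      {y | 0 < inner ℝ (η : EuclideanSpace ℝ (Fin n)) (y - c)} := ⟨fun h => ⟨h, hy⟩, fun h => h.1⟩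
  rw [h1, h2, perturbedSphere_inter_upperHalf hη hρ hρR hu hu0,
    sphereIn_inter_halfSpace hη rfl (by linarith), mem_graphOver_iff, mem_graphOver_iff,
    Pi.add_apply, hyu, add_zero]

theorem mem_perturbedSphere_iff_of_not_upperHalf (hη : ‖η‖ = 1) (hρ : 0 < ρ) (hρR : ρ < R / 2)
    (hu : ∀ w, ‖u w‖ ≤ ρ)
    (hu0 : ∀ w ∉ Metric.closedBall (P.orthogonalProjectionOnto c) ρ, u w = 0)
    {y : EuclideanSpace ℝ (Fin n)}
    (hy : ¬ 0 < inner ℝ (η : EuclideanSpace ℝ (Fin n)) (y - c)) :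
    y ∈ perturbedSphere P η c R u ↔
      y ∈ sphereIn (P ⊔ Submodule.span ℝ {(η : EuclideanSpace ℝ (Fin n))}) c R := by
  refine ⟨fun h => ?_, fun h => Or.inr ⟨h, not_lt.1 hy⟩⟩
  rcases h with h | h
  · exact absurd (graphOver_capFun_add_subset_upperHalf hη hρ hρR hu hu0 h) hy
  · exact h.1

/-- Where the perturbed sphere agrees with the round one. -/
def unperturbedRegion (P : Submodule ℝ (EuclideanSpace ℝ (Fin n))) (η : Pᗮ)
    (c : EuclideanSpace ℝ (Fin n)) (ρ : ℝ) : Set (EuclideanSpace ℝ (Fin n)) :=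
  {y | P.orthogonalProjectionOnto y ∉ Metric.closedBall (P.orthogonalProjectionOnto c) ρ} ∪
    {y | inner ℝ (η : EuclideanSpace ℝ (Fin n)) (y - c) < 0}

theorem isOpen_unperturbedRegion : IsOpen (unperturbedRegion P η c ρ) :=
  (Metric.isClosed_closedBall.isOpen_compl.preimage P.orthogonalProjectionOnto.continuous).union
    (isOpen_lt (by fun_prop) continuous_const)

theorem perturbedSphere_inter_unperturbedRegion (hη : ‖η‖ = 1) (hρ : 0 < ρ) (hρR : ρ < R / 2)
    (hu : ∀ w, ‖u w‖ ≤ ρ)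
    (hu0 : ∀ w ∉ Metric.closedBall (P.orthogonalProjectionOnto c) ρ, u w = 0) :
    perturbedSphere P η c R u ∩ unperturbedRegion P η c ρ =
      sphereIn (P ⊔ Submodule.span ℝ {(η : EuclideanSpace ℝ (Fin n))}) c R ∩
        unperturbedRegion P η c ρ := by
  ext y
  refine and_congr_left fun hyO => ?_
  by_cases hy : 0 < inner ℝ (η : EuclideanSpace ℝ (Fin n)) (y - c)
  · refine mem_perturbedSphere_iff_of_upperHalf hη hρ hρR hu hu0 hy (hu0 _ ?_)
    rcases hyO with h | h
    · exact h
    · exact absurd hy (not_lt.2 (le_of_lt h))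
  · exact mem_perturbedSphere_iff_of_not_upperHalf hη hρ hρR hu hu0 hy

/-- On the equator the projection to `P` is at distance `R > ρ` from that of the centre. So two open
sets cover the surface: one where it is a single graph and one where it is round. -/
theorem mem_upperHalf_or_mem_unperturbedRegion (hη : ‖η‖ = 1) (hρ : 0 < ρ) (hρR : ρ < R / 2)
    (hu : ∀ w, ‖u w‖ ≤ ρ)
    (hu0 : ∀ w ∉ Metric.closedBall (P.orthogonalProjectionOnto c) ρ, u w = 0)
    {y : EuclideanSpace ℝ (Fin n)} (hy : y ∈ perturbedSphere P η c R u) :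
    0 < inner ℝ (η : EuclideanSpace ℝ (Fin n)) (y - c) ∨ y ∈ unperturbedRegion P η c ρ := by
  by_contra hcon
  obtain ⟨h1, h2⟩ := not_or.1 hcon
  have h3 : ¬ inner ℝ (η : EuclideanSpace ℝ (Fin n)) (y - c) < 0 := fun h => h2 (Or.inr h)
  have h4 : P.orthogonalProjectionOnto y ∈ Metric.closedBall (P.orthogonalProjectionOnto c) ρ := by
    by_contra h; exact h2 (Or.inl h)
  obtain ⟨t, ht, htR⟩ := (mem_sphereIn_iff hη rfl (by linarith)).1
    ((mem_perturbedSphere_iff_of_not_upperHalf hη hρ hρR hu hu0 h1).1 hy)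
  have h5 : inner ℝ (η : EuclideanSpace ℝ (Fin n)) (y - c) = t := by
    conv_lhs => rw [← coe_orthogonalProjectionOnto_add P y]
    rw [inner_coe_add_coe_sub, ht, add_sub_cancel_left, inner_smul_right,
      real_inner_self_eq_norm_sq, hη]
    ring
  rw [h5] at h1 h3
  rw [mem_closedBall_iff_norm] at h4
  have h6 : t = 0 := le_antisymm (not_lt.1 h1) (not_lt.1 h3)
  rw [h6] at htR
  nlinarith [norm_nonneg (P.orthogonalProjectionOnto y - P.orthogonalProjectionOnto c)]

/-- The defining union contains a graph over an open ball. Since the perturbation vanishes outside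
radius `R / 2`, the surface is also the graph over the closed ball of that radius together with the
round sphere minus an open set, both compact. -/
theorem isCompact_perturbedSphere (hη : ‖η‖ = 1) (hρ : 0 < ρ) (hρR : ρ < R / 2)
    (hu : ∀ w, ‖u w‖ ≤ ρ)
    (hu0 : ∀ w ∉ Metric.closedBall (P.orthogonalProjectionOnto c) ρ, u w = 0)
    (huc : Continuous u) : IsCompact (perturbedSphere P η c R u) := by
  have hR : 0 < R := by linarith
  set w₀ := P.orthogonalProjectionOnto c with hw₀
  set W := P ⊔ Submodule.span ℝ {(η : EuclideanSpace ℝ (Fin n))} with hW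
  set H := {y | 0 < inner ℝ (η : EuclideanSpace ℝ (Fin n)) (y - c)} with hH
  set T := H ∩ P.orthogonalProjectionOnto ⁻¹' Metric.ball w₀ (R / 2) with hT
  have hball : Metric.closedBall w₀ (R / 2) ⊆ Metric.ball w₀ R :=
    Metric.closedBall_subset_ball (by linarith)
  have hu0' : ∀ w ∉ Metric.ball w₀ (R / 2), u w = 0 := fun w hw =>
    hu0 w fun h => hw (Metric.closedBall_subset_ball hρR h)
  have key : perturbedSphere P η c R u =
      graphOver P (Metric.closedBall w₀ (R / 2)) (capFun P η c R + u) ∪ (sphereIn W c R ∩ Tᶜ) := by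
    apply Subset.antisymm
    · rintro y hy
      by_cases hyT : y ∈ T
      · have h1 : y ∈ perturbedSphere P η c R u ∩ H := ⟨hy, hyT.1⟩
        rw [perturbedSphere_inter_upperHalf hη hρ hρR hu hu0, mem_graphOver_iff] at h1
        exact Or.inl (mem_graphOver_iff.2 ⟨Metric.ball_subset_closedBall hyT.2, h1.2⟩)
      · refine Or.inr ⟨?_, hyT⟩
        by_cases hyH : y ∈ H
        · exact (mem_perturbedSphere_iff_of_upperHalf hη hρ hρR hu hu0 hyH
            (hu0' _ fun h => hyT ⟨hyH, h⟩)).1 hy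
        · exact (mem_perturbedSphere_iff_of_not_upperHalf hη hρ hρR hu hu0 hyH).1 hy
    · rintro y (hy | ⟨hy, hyT⟩)
      · exact Or.inl (image_mono hball hy)
      · by_cases hyH : y ∈ H
        · exact (mem_perturbedSphere_iff_of_upperHalf hη hρ hρR hu hu0 hyH
            (hu0' _ fun h => hyT ⟨hyH, h⟩)).2 hy
        · exact (mem_perturbedSphere_iff_of_not_upperHalf hη hρ hρR hu hu0 hyH).2 hy
  rw [key]
  refine IsCompact.union ?_ ?_
  · refine (isCompact_closedBall _ _).image_of_continuousOn
      (continuous_subtype_val.continuousOn.add (continuous_subtype_val.comp_continuousOn ?_))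
    exact ContinuousOn.add (fun w hw =>
      (contDiffAt_capFun (m := 0) (hball hw)).continuousAt.continuousWithinAt) huc.continuousOn
  · refine Metric.isCompact_of_isClosed_isBounded ((isClosed_sphereIn W c R).inter
      (((isOpen_upperHalf η c).inter (Metric.isOpen_ball.preimage
        P.orthogonalProjectionOnto.continuous)).isClosed_compl)) ?_
    refine (Metric.isBounded_closedBall (x := c) (r := R)).subset ?_
    rintro y ⟨⟨-, hy⟩, -⟩
    rw [mem_closedBall_iff_norm, hy]

theorem perturbedSphere_subset_closedBall (hη : ‖η‖ = 1) (hR : 0 < R) (hu : ∀ w, ‖u w‖ ≤ ρ)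
    (hρ : 0 ≤ ρ) :
    perturbedSphere P η c R u ⊆ Metric.closedBall c (R + ρ) := by
  rintro y (⟨w, hw, rfl⟩ | ⟨⟨-, hy⟩, -⟩)
  · have h1 : (w : EuclideanSpace ℝ (Fin n)) + capFun P η c R w ∈
        sphereIn (P ⊔ Submodule.span ℝ {(η : EuclideanSpace ℝ (Fin n))}) c R := by
      have h2 := sphereIn_inter_halfSpace (c := c) hη rfl hR.le
      exact (h2.symm.subset (coe_add_coe_mem_graphOver hw)).1
    rw [mem_closedBall_iff_norm]
    calc ‖(w : EuclideanSpace ℝ (Fin n)) + ((capFun P η c R + u) w : Pᗮ) - c‖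
        = ‖((w : EuclideanSpace ℝ (Fin n)) + capFun P η c R w - c) + u w‖ := by
          rw [Pi.add_apply]; push_cast; congr 1; abel
      _ ≤ R + ρ := (norm_add_le _ _).trans (add_le_add h1.2.le (hu w))
  · rw [mem_closedBall_iff_norm, hy]; linarith

theorem isYSubmanifold_perturbedSphere (hη : ‖η‖ = 1) (hρ : 0 < ρ) (hρR : ρ < R / 2)
    (hu : ∀ w, ‖u w‖ ≤ ρ)
    (hu0 : ∀ w ∉ Metric.closedBall (P.orthogonalProjectionOnto c) ρ, u w = 0)
    (huc : ContDiff ℝ 1 u) (hk : 1 ≤ k) (hP : Module.finrank ℝ P = k) {α : ℝ} (hα0 : 0 < α)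
    (hα1 : α < 1) {q : ℝ≥0∞} (hq : 1 ≤ q)
    (huα : MemFracSobolev k α q volume univ (fderiv ℝ u)) :
    IsYSubmanifold k α q (perturbedSphere P η c R u) := by
  have hR : 0 < R := by linarith
  have hatlas : ∀ x ∈ perturbedSphere P η c R u,
      ∃ (P' : Submodule ℝ (EuclideanSpace ℝ (Fin n))) (U : Set P') (φ : P' → P'ᗮ),
        IsC1GraphChart k (perturbedSphere P η c R u) P' U φ ∧ x ∈ graphOver P' U φ ∧
          MemFracSobolev k α q volume U (fderiv ℝ φ) := by
    intro x hx
    rcases mem_upperHalf_or_mem_unperturbedRegion hη hρ hρR hu hu0 hx with hxH | hxO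
    · have hchart : IsC1GraphChart k (perturbedSphere P η c R u) P
          (Metric.ball (P.orthogonalProjectionOnto c) R) (capFun P η c R + u) :=
        ⟨hP, Metric.isOpen_ball, fun w hw => ((contDiffAt_capFun hw).add
          huc.contDiffAt).contDiffWithinAt, _, isOpen_upperHalf η c,
          perturbedSphere_inter_upperHalf hη hρ hρR hu hu0⟩
      have hxg := (perturbedSphere_inter_upperHalf hη hρ hρR hu hu0).subset ⟨hx, hxH⟩
      obtain ⟨w, hw, rfl⟩ := hxg
      obtain ⟨r, hr, hrα⟩ := exists_ball_memFracSobolev_fderiv (hP.symm ▸ hk) hα0 hα1 hq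
        (contDiffAt_capFun (η := η) (m := 2) hw)
      rw [hP] at hrα
      refine ⟨P, Metric.ball w r ∩ Metric.ball (P.orthogonalProjectionOnto c) R, _,
        hchart.restrict (Metric.isOpen_ball.inter Metric.isOpen_ball) inter_subset_right,
        coe_add_coe_mem_graphOver ⟨Metric.mem_ball_self hr, hw⟩, ?_⟩
      refine MemFracSobolev.congr (MemFracSobolev.add hq (hrα.mono inter_subset_left)
        (huα.mono (subset_univ _)) (huc.continuous_fderiv (by norm_num)))
        (measurableSet_ball.inter measurableSet_ball) fun v hv => ?_
      exact (fderiv_add ((contDiffAt_capFun (m := 1) hv.2).differentiableAt (by norm_num))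
        ((huc.differentiable (by norm_num)) v)).symm
    · have hWk : Module.finrank ℝ
          ↥(P ⊔ Submodule.span ℝ {(η : EuclideanSpace ℝ (Fin n))}) = k + 1 := by
        have h1 := Submodule.finrank_sup_add_finrank_inf_eq P
          (Submodule.span ℝ {(η : EuclideanSpace ℝ (Fin n))})
        have h2 : P ⊓ Submodule.span ℝ {(η : EuclideanSpace ℝ (Fin n))} = ⊥ := by
          refine (P.orthogonal_disjoint.mono_right ?_).eq_bot
          rw [Submodule.span_singleton_le_iff_mem]; exact η.2
        have h3 : (η : EuclideanSpace ℝ (Fin n)) ≠ 0 := fun h => by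
          have : ‖(η : EuclideanSpace ℝ (Fin n))‖ = 1 := hη
          simp [h] at this
        rw [h2, finrank_bot, finrank_span_singleton h3, hP] at h1
        exact h1
      have hS := perturbedSphere_inter_unperturbedRegion hη hρ hρR hu hu0
      have hx0 := (hS.subset ⟨hx, hxO⟩).1
      obtain ⟨P', U, φ, hc, hxg, hφ⟩ := exists_smooth_chart_sphereIn hWk hR hx0
      obtain ⟨w, hw, rfl⟩ := hxg
      have hc' := hc.transfer isOpen_unperturbedRegion hS.symm
      obtain ⟨r, hr, hrα⟩ := exists_ball_memFracSobolev_fderiv (hc.finrank_eq.symm ▸ hk) hα0 hα1 hq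
        (hφ w hw)
      rw [hc.finrank_eq] at hrα
      exact ⟨P', _, φ, hc'.restrict (Metric.isOpen_ball.inter hc'.isOpen) inter_subset_right,
        coe_add_coe_mem_graphOver ⟨Metric.mem_ball_self hr, hw, hxO⟩, hrα.mono inter_subset_left⟩
  refine ⟨(isCompact_perturbedSphere hη hρ hρR hu hu0 huc.continuous).isClosed, fun x hx => ?_,
    hatlas⟩
  obtain ⟨P', U, φ, hc, hxg, -⟩ := hatlas x hx
  exact ⟨P', U, φ, hc, hxg⟩

end PerturbedSphere

/-! ### Assembly of the submanifold and the tangency set -/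

theorem exists_ySubmanifold_of_graph {n k : ℕ} (hk : 1 ≤ k)
    {P : Submodule ℝ (EuclideanSpace ℝ (Fin n))} (hP : Module.finrank ℝ P = k) {η : Pᗮ}
    (hη : ‖η‖ = 1) {x₀ : EuclideanSpace ℝ (Fin n)} {Ω : Set (EuclideanSpace ℝ (Fin n))}
    (hΩ : Ω ∈ 𝓝 x₀) {V : EuclideanSpace ℝ (Fin n) → Submodule ℝ (EuclideanSpace ℝ (Fin n))}
    {F : EuclideanSpace ℝ (Fin n) → (P →L[ℝ] Pᗮ)} (hF : ContDiffAt ℝ 1 F x₀)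
    (hVF : ∀ᶠ y in 𝓝 x₀, (V y : Set (EuclideanSpace ℝ (Fin n))) =
      range fun v : P => (v : EuclideanSpace ℝ (Fin n)) + F y v)
    {q : ℝ≥0∞} (hq : 1 ≤ q) {s α : ℝ} (hs0 : 0 < s) (hs : s < 1 / 2) (hα0 : 0 < α) (hα1 : α < 1)
    (hα : α < 1 - (2 - (1 / q).toReal) * s) :
    ∃ S E : Set (EuclideanSpace ℝ (Fin n)),
      S ⊆ Ω ∧ IsYSubmanifold k α q S ∧ MeasurableSet E ∧
      MemFracSobolev k s 1 (μH[(k : ℝ)]) S (E.indicator fun _ => (1 : ℝ)) ∧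
      E ⊆ tangencySet S V ∧ 0 < μH[(k : ℝ)] E := by
  obtain ⟨r, hr, hrΩ⟩ := Metric.nhds_basis_closedBall.mem_iff.1 hΩ
  -- The surface lies within `R + ρ` of `c`, hence within `2 R + ρ < r` of `x₀`, the pole of the
  -- cap.
  set R : ℝ := r / 3 with hRr
  have hR : 0 < R := by positivity
  set c : EuclideanSpace ℝ (Fin n) := x₀ - R • (η : EuclideanSpace ℝ (Fin n)) with hc
  set w₀ := P.orthogonalProjectionOnto c with hw₀
  have hηE : ‖(η : EuclideanSpace ℝ (Fin n))‖ = 1 := hη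
  have hcap₀ : (w₀ : EuclideanSpace ℝ (Fin n)) + capFun P η c R w₀ = x₀ := by
    have h1 := coe_orthogonalProjectionOnto_add P c
    rw [capFun, sub_self, norm_zero, zero_pow two_ne_zero, sub_zero, Real.sqrt_sq hR.le]
    push_cast
    rw [← add_assoc, h1, hc, sub_add_cancel]
  set m : P × Pᗮ → EuclideanSpace ℝ (Fin n) := fun z =>
    (z.1 : EuclideanSpace ℝ (Fin n)) + (capFun P η c R z.1 + z.2 : Pᗮ) with hm
  have hm₀ : m (w₀, 0) = x₀ := by simp only [hm, add_zero, hcap₀]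
  have hw₀B : w₀ ∈ Metric.ball w₀ R := Metric.mem_ball_self hR
  have hcapfst : ∀ l : WithTop ℕ∞, ContDiffAt ℝ l (fun z : P × Pᗮ => capFun P η c R z.1) (w₀, 0) :=
    fun l => ContDiffAt.comp (g := capFun P η c R) (f := Prod.fst) (w₀, (0 : Pᗮ))
      (contDiffAt_capFun hw₀B) contDiffAt_fst
  have hmc : ContDiffAt ℝ 1 m (w₀, 0) :=
    (P.subtypeL.contDiff.contDiffAt.comp _ contDiffAt_fst).add
      (Pᗮ.subtypeL.contDiff.contDiffAt.comp _ ((hcapfst 1).add contDiffAt_snd))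
  -- Tangency of the graph of `capFun + u` asks for its gradient to be `F (m (w, u w))`; this is the
  -- right-hand side of the resulting system for `u`.
  have hΨ : ContDiffAt ℝ 1 (fun z : P × Pᗮ => F (m z) - fderiv ℝ (capFun P η c R) z.1) (w₀, 0) := by
    refine ContDiffAt.sub (ContDiffAt.comp (w₀, (0 : Pᗮ)) (by rwa [hm₀]) hmc) ?_
    exact ((contDiffAt_capFun (η := η) (m := 2) hw₀B).fderiv_right (m := 1) (by norm_num)).comp
      (w₀, (0 : Pᗮ)) contDiffAt_fst
  obtain ⟨G, B, L, hGB, hGL, hG⟩ := exists_lipschitzWith_eventuallyEq hΨ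
  have hVm : ∀ᶠ z in 𝓝 (w₀, (0 : Pᗮ)), (V (m z) : Set (EuclideanSpace ℝ (Fin n))) =
      range fun v : P => (v : EuclideanSpace ℝ (Fin n)) + F (m z) v :=
    hmc.continuousAt.eventually (by rwa [hm₀])
  obtain ⟨ε, hε, hεG⟩ := Metric.eventually_nhds_iff.1 (hG.and hVm)
  -- The bound `ρ < ε` keeps `(w, u w)` where `G` is the true right-hand side and `V` is the graph
  -- of `F`; the bound `ρ < R / 2` is what the gluing needs.
  obtain ⟨ρ, hρ, hρ'⟩ : ∃ ρ : ℝ, 0 < ρ ∧ ρ < min ε (R / 2) := exists_between (by positivity)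
  have hρε : ρ < ε := hρ'.trans_le (min_le_left _ _)
  have hρR : ρ < R / 2 := hρ'.trans_le (min_le_right _ _)
  obtain ⟨u, Q, K, hu1, huρ, hQρ, hQm, hKc, hKQ, huQ, hKpos, hKu, huα, hKs, d, hd, hdQ⟩ :=
    exists_contDiff_fderiv_eq (hP.symm ▸ hk) hq hs0 hs hα0 hα1 hα hGB hGL w₀ hρ
  rw [hP] at huα
  have hu0 : ∀ w ∉ Metric.closedBall w₀ ρ, u w = 0 := fun w hw => huQ w fun h => hw (hQρ h)
  have hcb : Metric.closedBall w₀ ρ ⊆ Metric.ball w₀ R :=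
    Metric.closedBall_subset_ball (by linarith)
  set S := perturbedSphere P η c R u with hS
  set H := {y | 0 < inner ℝ (η : EuclideanSpace ℝ (Fin n)) (y - c)} with hH
  have hSH : S ∩ H = graphOver P (Metric.ball w₀ R) (capFun P η c R + u) :=
    perturbedSphere_inter_upperHalf hη hρ hρR huρ hu0
  have hSY : IsYSubmanifold k α q S :=
    isYSubmanifold_perturbedSphere hη hρ hρR huρ hu0 hu1 hk hP hα0 hα1 hq huα
  have hμS : μH[(k : ℝ)] S < ∞ :=
    (isCompact_perturbedSphere hη hρ hρR huρ hu0
      hu1.continuous).hausdorffMeasure_lt_top_of_isC1Submanifold hSY.isC1Submanifold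
  have : IsFiniteMeasure ((μH[(k : ℝ)] : Measure (EuclideanSpace ℝ (Fin n))).restrict S) :=
    ⟨by rwa [Measure.restrict_apply_univ]⟩
  set g : P → EuclideanSpace ℝ (Fin n) := fun w =>
    (w : EuclideanSpace ℝ (Fin n)) + (capFun P η c R + u) w with hg
  have hKcomp : IsCompact K :=
    (isCompact_closedBall w₀ ρ).of_isClosed_subset hKc (hKQ.trans hQρ)
  have hgd : ContDiffOn ℝ 1 g (Metric.closedBall w₀ ρ) := fun w hw =>
    ((P.subtypeL.contDiff.contDiffAt.comp w contDiffAt_id).add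
      (Pᗮ.subtypeL.contDiff.contDiffAt.comp w
        ((contDiffAt_capFun (hcb hw)).add hu1.contDiffAt))).contDiffWithinAt
  obtain ⟨Lg, hLg⟩ := hgd.exists_lipschitzOnWith (by norm_num) (convex_closedBall w₀ ρ)
    (isCompact_closedBall w₀ ρ)
  -- Orthogonal projection onto `P` undoes `g` and is `1`-Lipschitz.
  have hgdist : ∀ v w, dist v w ≤ dist (g v) (g w) := fun v w => by
    have h1 := P.lipschitzWith_orthogonalProjectionOnto.dist_le_mul (g v) (g w)
    simpa only [hg, orthogonalProjectionOnto_coe_add_coe, NNReal.coe_one, one_mul] using h1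
  have hgi : ∀ v w, edist v w ≤ edist (g v) (g w) := fun v w => by
    rw [edist_dist, edist_dist]; exact ENNReal.ofReal_le_ofReal (hgdist v w)
  have hgSH : ∀ w ∈ Q, g w ∈ S ∩ H := fun w hw => by
    rw [hSH]; exact coe_add_coe_mem_graphOver (hcb (hQρ hw))
  have hgQS : g '' Q ⊆ S := by
    rintro _ ⟨w, hw, rfl⟩; exact (hgSH w hw).1
  have hgK : IsCompact (g '' K) :=
    hKcomp.image_of_continuousOn (hLg.continuousOn.mono (hKQ.trans hQρ))
  have hgKH : g '' K ⊆ H := by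
    rintro _ ⟨w, hw, rfl⟩; exact (hgSH w (hKQ hw)).2
  obtain ⟨δ, hδ, hδH⟩ := hgK.exists_thickening_subset_open (isOpen_upperHalf η c) hgKH
  -- In the upper half, `y` lies above a parameter outside `Q`, at distance at least `d` from `K`.
  -- In the rest, `y` is outside the open set `H`, which contains a `δ`-neighbourhood of the compact
  -- set `g '' K`.
  have hsep : ∀ y ∈ S \ g '' Q, ∀ x ∈ g '' K, min δ d ≤ dist x y := by
    rintro y ⟨hyS, hyQ⟩ _ ⟨v, hv, rfl⟩
    by_cases hyH : y ∈ H
    · have h1 : y ∈ S ∩ H := ⟨hyS, hyH⟩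
      rw [hSH] at h1
      obtain ⟨w, hw, rfl⟩ := h1
      have hwQ : w ∉ Q := fun h => hyQ ⟨w, h, rfl⟩
      refine (min_le_right _ _).trans ((hdQ w hwQ v hv).trans ?_)
      rw [← dist_eq_norm, dist_comm]
      exact hgdist v w
    · refine (min_le_left _ _).trans (not_lt.1 fun h => hyH (hδH ?_))
      exact Metric.mem_thickening_iff.2 ⟨g v, ⟨v, hv, rfl⟩, by rwa [dist_comm]⟩
  have hfar : ∫⁻ y in S \ g '' Q, ∫⁻ x in g '' K, (edist x y ^ (s + k))⁻¹ ∂μH[(k : ℝ)] ∂μH[(k : ℝ)]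
      < ∞ := by
    have hmin : 0 < min δ d := lt_min hδ hd
    have hQgm : MeasurableSet (S \ g '' Q) := by
      refine hSY.isClosed.measurableSet.diff ?_
      refine hQm.image_of_continuousOn_injOn (hLg.continuousOn.mono hQρ) fun v _ w _ h => ?_
      have := hgdist v w
      rw [h, dist_self] at this
      exact dist_le_zero.1 this
    have hle : ∀ y ∈ S \ g '' Q, ∫⁻ x in g '' K, (edist x y ^ (s + k))⁻¹ ∂μH[(k : ℝ)] ≤
        (ENNReal.ofReal (min δ d) ^ (s + k))⁻¹ * μH[(k : ℝ)] S := by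
      intro y hy
      refine (setLIntegral_mono' hgK.measurableSet
        (g := fun _ => (ENNReal.ofReal (min δ d) ^ (s + k))⁻¹) fun x hx => ?_).trans ?_
      · refine ENNReal.inv_le_inv.2 (ENNReal.rpow_le_rpow ?_ (by positivity))
        rw [edist_dist]
        exact ENNReal.ofReal_le_ofReal (hsep y hy x hx)
      · rw [setLIntegral_const]
        gcongr
        exact (image_mono hKQ).trans hgQS
    refine (setLIntegral_mono' hQgm hle).trans_lt ?_
    rw [setLIntegral_const]
    refine ENNReal.mul_lt_top (ENNReal.mul_lt_top ?_ hμS)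
      ((measure_mono sdiff_subset).trans_lt hμS)
    rw [ENNReal.ofReal_rpow_of_pos hmin, ENNReal.inv_lt_top]
    exact ENNReal.ofReal_pos.2 (by positivity)
  refine ⟨S, g '' K, ?_, hSY, hgK.measurableSet, ?_, ?_, ?_⟩
  · refine (perturbedSphere_subset_closedBall hη hR huρ hρ.le).trans (subset_trans ?_ hrΩ)
    refine Metric.closedBall_subset_closedBall' ?_
    have : dist c x₀ = R := by
      rw [dist_eq_norm, hc, sub_sub_cancel_left, norm_neg, norm_smul, hηE, mul_one,
        Real.norm_eq_abs, abs_of_pos hR]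
    rw [this]
    linarith
  · exact memFracSobolev_one_indicator_image hP hs0 (hLg.mono hQρ) (fun v _ w _ => hgi v w) hQm
      hKcomp hKQ hKs hgQS hfar
  · rintro _ ⟨w, hw, rfl⟩
    have hwB := hcb (hQρ (hKQ hw))
    refine ⟨(hgSH w (hKQ hw)).1, ?_⟩
    have hcapd : DifferentiableAt ℝ (capFun P η c R) w :=
      (contDiffAt_capFun (m := 1) hwB).differentiableAt (by norm_num)
    have hud : DifferentiableAt ℝ u w := hu1.differentiable (by norm_num) w
    have hT := tangentConeAt_of_inter_eq_graphOver (isOpen_upperHalf η c) hSH Metric.isOpen_ball hwB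
      (hcapd.add hud)
    have hdist : dist (w, u w) (w₀, (0 : Pᗮ)) < ε := by
      refine lt_of_le_of_lt (max_le ?_ ?_) hρε
      · exact hQρ (hKQ hw)
      · rw [dist_zero_right]; exact huρ w
    obtain ⟨h1, h2⟩ := hεG hdist
    have h3 : fderiv ℝ (capFun P η c R + u) w = F (m (w, u w)) := by
      rw [fderiv_add hcapd hud, hKu w hw, h1, add_sub_cancel]
    rw [hT, h3]
    exact h2.symm
  · exact hausdorffMeasure_image_pos hP (fun v _ w _ => hgi v w) hKpos

theorem isYSubmanifold_univ {n : ℕ} (hn : 1 ≤ n) {α : ℝ} (hα0 : 0 < α) (hα1 : α < 1) {q : ℝ≥0∞}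
    (hq : 1 ≤ q) : IsYSubmanifold n α q (univ : Set (EuclideanSpace ℝ (Fin n))) := by
  have hP : Module.finrank ℝ (⊤ : Submodule ℝ (EuclideanSpace ℝ (Fin n))) = n := by simp
  have hatlas : ∀ x ∈ (univ : Set (EuclideanSpace ℝ (Fin n))),
      ∃ (P : Submodule ℝ (EuclideanSpace ℝ (Fin n))) (U : Set P) (φ : P → Pᗮ),
        IsC1GraphChart n univ P U φ ∧ x ∈ graphOver P U φ ∧
          MemFracSobolev n α q volume U (fderiv ℝ φ) := by
    intro x _
    have hg : graphOver (⊤ : Submodule ℝ (EuclideanSpace ℝ (Fin n))) univ 0 = univ := by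
      refine eq_univ_of_forall fun y => ⟨⟨y, trivial⟩, mem_univ _, by simp⟩
    have hc : IsC1GraphChart n univ (⊤ : Submodule ℝ (EuclideanSpace ℝ (Fin n))) univ 0 :=
      ⟨hP, isOpen_univ, contDiffOn_const, univ, isOpen_univ, by rw [hg, univ_inter]⟩
    obtain ⟨r, hr, hrα⟩ := exists_ball_memFracSobolev_fderiv (hP.symm ▸ hn) hα0 hα1 hq
      (f := (0 : (⊤ : Submodule ℝ (EuclideanSpace ℝ (Fin n))) →
        (⊤ : Submodule ℝ (EuclideanSpace ℝ (Fin n)))ᗮ)) (w := ⟨x, trivial⟩) contDiffAt_const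
    rw [hP] at hrα
    exact ⟨⊤, _, 0, hc.restrict Metric.isOpen_ball (subset_univ _),
      ⟨⟨x, trivial⟩, Metric.mem_ball_self hr, by simp⟩, hrα⟩
  refine ⟨isClosed_univ, fun x hx => ?_, hatlas⟩
  obtain ⟨P, U, φ, hc, hxg, -⟩ := hatlas x hx
  exact ⟨P, U, φ, hc, hxg⟩

/-- Here only the set `K` matters, so the system is taken to be `Du = 0`. The ambient measure is
infinite, and the far part is controlled by the decay of the kernel at infinity instead of by
finiteness of the measure. -/
theorem exists_memFracSobolev_indicator_univ {n : ℕ} (hn : 1 ≤ n) {q : ℝ≥0∞} (hq : 1 ≤ q)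
    {s α : ℝ} (hs0 : 0 < s) (hs : s < 1 / 2) (hα0 : 0 < α) (hα1 : α < 1)
    (hα : α < 1 - (2 - (1 / q).toReal) * s) :
    ∃ E : Set (EuclideanSpace ℝ (Fin n)), MeasurableSet E ∧
      MemFracSobolev n s 1 (μH[(n : ℝ)]) univ (E.indicator fun _ => (1 : ℝ)) ∧
      0 < μH[(n : ℝ)] E := by
  have hfr : Module.finrank ℝ (EuclideanSpace ℝ (Fin n)) = n := by simp
  obtain ⟨u, Q, K, -, -, hQρ, hQm, hKc, hKQ, -, hKpos, -, -, hKs, d, hd, hdQ⟩ :=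
    exists_contDiff_fderiv_eq (hfr.symm ▸ hn) hq hs0 hs hα0 hα1 hα
      (G := fun _ : EuclideanSpace ℝ (Fin n) × ℝ => (0 : EuclideanSpace ℝ (Fin n) →L[ℝ] ℝ)) (B := 0)
      (fun _ => by simp) (LipschitzWith.const _) 0 one_pos
  have hKcomp : IsCompact K :=
    (isCompact_closedBall _ _).of_isClosed_subset hKc (hKQ.trans hQρ)
  have hHaar : (μH[(n : ℝ)] : Measure (EuclideanSpace ℝ (Fin n))).IsAddHaarMeasure := by
    have h := isAddHaarMeasure_hausdorffMeasure (E := EuclideanSpace ℝ (Fin n))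
    rwa [hfr] at h
  set μ : Measure (EuclideanSpace ℝ (Fin n)) := μH[(n : ℝ)] with hμ
  have hkm : Measurable fun z : EuclideanSpace ℝ (Fin n) × EuclideanSpace ℝ (Fin n) =>
      (edist z.1 z.2 ^ (s + n))⁻¹ := (measurable_edist.pow_const _).inv
  refine ⟨K, hKc.measurableSet, ?_, ?_⟩
  · have hfar : ∫⁻ y in univ \ id '' Q, ∫⁻ x in id '' K, (edist x y ^ (s + n))⁻¹ ∂μ ∂μ < ∞ := by
      rw [image_id, image_id, ← compl_eq_univ_sdiff,
        lintegral_lintegral_swap (f := fun y x => (edist x y ^ (s + n))⁻¹)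
          (hkm.comp measurable_swap).aemeasurable]
      obtain ⟨C, hC, h⟩ := exists_lintegral_max_rpow_le μ hs0
      rw [hfr] at h
      have hle : ∀ x ∈ K, ∫⁻ y in Qᶜ, (edist x y ^ (s + n))⁻¹ ∂μ ≤
          C * ENNReal.ofReal (d ^ (-s)) := by
        intro x hx
        calc ∫⁻ y in Qᶜ, (edist x y ^ (s + n))⁻¹ ∂μ
            ≤ ∫⁻ y in Qᶜ, ENNReal.ofReal ((max ‖y - x‖ d) ^ (-(s + n))) ∂μ := by
              refine setLIntegral_mono' hQm.compl fun y hy => ?_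
              have h1 := hdQ y hy x hx
              rw [max_eq_left h1, ← ENNReal.rpow_neg, edist_comm, edist_dist, dist_eq_norm,
                ENNReal.ofReal_rpow_of_pos (hd.trans_le h1)]
          _ ≤ ∫⁻ y, ENNReal.ofReal ((max ‖y - x‖ d) ^ (-(s + n))) ∂μ :=
              setLIntegral_le_lintegral _ _
          _ = ∫⁻ y, ENNReal.ofReal ((max ‖y‖ d) ^ (-(s + n))) ∂μ :=
              lintegral_sub_right_eq_self (μ := μ)
                (fun y => ENNReal.ofReal ((max ‖y‖ d) ^ (-(s + n)))) x
          _ ≤ _ := h d hd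
      refine (setLIntegral_mono' hKc.measurableSet hle).trans_lt ?_
      rw [setLIntegral_const]
      exact ENNReal.mul_lt_top (ENNReal.mul_lt_top hC ENNReal.ofReal_lt_top) hKcomp.measure_lt_top
    have key := memFracSobolev_one_indicator_image hfr hs0 (LipschitzWith.id.lipschitzOnWith (s := Q))
      (fun v _ w _ => le_rfl) hQm hKcomp hKQ hKs (subset_univ _) hfar
    rwa [image_id] at key
  · have key := hausdorffMeasure_image_pos (g := id) hfr (fun v _ w _ => le_rfl) hKpos
    rwa [image_id] at key

theorem theorem1p4 (n k : ℕ) (hk : 1 ≤ k) (hkn : k ≤ n)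
    (Ω : Set (EuclideanSpace ℝ (Fin n))) (hΩ : IsOpen Ω) (hΩne : Ω.Nonempty)
    (hfull : k < n ∨ Ω = Set.univ)
    (V : EuclideanSpace ℝ (Fin n) → Submodule ℝ (EuclideanSpace ℝ (Fin n)))
    (hV : IsC1Distribution k Ω V)
    (q : ℝ≥0∞) (hq : 1 ≤ q) (s α : ℝ) (hs0 : 0 < s) (hs : s < 1 / 2)
    (hα0 : 0 < α) (hα1 : α < 1) (hα : α < 1 - (2 - (1 / q).toReal) * s) :
    ∃ S E : Set (EuclideanSpace ℝ (Fin n)),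
      S ⊆ Ω ∧ IsYSubmanifold k α q S ∧
      MeasurableSet E ∧
      MemFracSobolev k s 1 (μH[(k : ℝ)]) S (E.indicator fun _ => (1 : ℝ)) ∧
      E ⊆ tangencySet S V ∧ 0 < μH[(k : ℝ)] E := by
  rcases hkn.lt_or_eq with hlt | rfl
  · obtain ⟨x₀, hx₀⟩ := hΩne
    have hP := hV.finrank_eq x₀ hx₀
    -- As `k < n`, there is a normal direction in which to close up the surface to a sphere.
    have hnt : Nontrivial (V x₀)ᗮ := by
      have h1 := (V x₀).finrank_add_finrank_orthogonal
      rw [hP, finrank_euclideanSpace_fin] at h1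
      exact Module.nontrivial_of_finrank_pos (R := ℝ) (by omega)
    obtain ⟨η, hη⟩ := exists_norm_eq (V x₀)ᗮ zero_le_one
    obtain ⟨F, hF, hVF⟩ := hV.exists_graph hx₀
    exact exists_ySubmanifold_of_graph hk hP hη (hΩ.mem_nhds hx₀) hF hVF hq hs0 hs hα0 hα1 hα
  -- When `k = n`, every `V x` is the whole space, so tangency holds at every point of `ℝⁿ`.
  · obtain rfl : Ω = univ := hfull.resolve_left (lt_irrefl _)
    obtain ⟨E, hE, hEs, hE0⟩ := exists_memFracSobolev_indicator_univ hk hq hs0 hs hα0 hα1 hα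
    refine ⟨univ, E, Subset.rfl, isYSubmanifold_univ hk hα0 hα1 hq, hE, hEs, fun x _ => ?_, hE0⟩
    have hVx : V x = ⊤ := Submodule.eq_top_of_finrank_eq (by
      rw [hV.finrank_eq x (mem_univ x), finrank_euclideanSpace_fin])
    exact ⟨mem_univ x, by rw [tangentConeAt_univ, hVx]; rfl⟩
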